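/- **Setting.** Let $W_i=(Y_i,X_i,Z_i)$, $i=1,2,\dots$, be i.i.d. with law $F_0$, where $Y=\gamma_0(X)+\varepsilon$ and $E[\varepsilon\mid Z]=0$. Write $\|\gamma\|=(E[\gamma(X)^2])^{1/2}$. Let $\Gamma\ni\gamma_0$ be a linear space of measurable functions $\gamma$ with $\|\gamma\|<\infty$ (for instance all of them), and let $m(w,\gamma)$, $\gamma\in\Gamma$, be a possibly nonlinear functional with a Gateaux derivative $D(w,\gamma,\zeta)=\frac{d}{d\tau}m(w,\gamma+\tau\zeta)|_{\tau=0}$ that is linear in $\zeta\in\Gamma$. Suppose that $\alpha_0(Z)$ with $E[\alpha_0(Z)^2]<\infty$ satisfies $E[D(W,\gamma_0,\zeta)]=E[\alpha_0(Z)\zeta(X)]$ for all $\zeta\in\Gamma$. Put $\theta_0=E[m(W,\gamma_0)]$, $\psi_0(w)=m(w,\gamma_0)-\theta_0+\alpha_0(z)[y-\gamma_0(x)]$ and $V=E[\psi_0(W)^2]$. **Estimator.** Let $I_1,\dots,I_L$ ($L\ge2$ fixed) partition $\{1,\dots,n\}$, with $n_\ell=|I_\ell|$ and $n_\ell/n\to1/L$.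 Let $\hat\gamma_\ell$ be computed from the observations outside $I_\ell$, and $\hat\gamma_{\ell,\ell'}$ from those outside $I_\ell\cup I_{\ell'}$; all estimates lie in $\Gamma$. Let $b=(b_1,\dots,b_p)$ be functions of $Z$ and $d=(d_1,\dots,d_q)$ functions of $X$ in $\Gamma$, both depending on $n$, with $p\le q$ and $q\ge 2$. For each $\ell$ put $\hat G_\ell=\frac1{n-n_\ell}\sum_{i\notin I_\ell}d(X_i)b(Z_i)'$, $\hat M_{\ell j}=\frac1{n-n_\ell}\sum_{\ell'\ne\ell}\sum_{i\in I_{\ell'}}D(W_i,\hat\gamma_{\ell,\ell'},d_j)$ and $$\hat\sigma_{\ell j}^2(\rho)=\frac1{n-n_\ell}\sum_{\ell'\ne\ell}\sum_{i\in I_{\ell'}}\big(D(W_i,\hat\gamma_{\ell,\ell'},d_j)-d_j(X_i)b(Z_i)'\rho\big)^2 .$$ With a penalty $\lambda_n>0$, let $\tilde\rho_\ell$ and $\hat\rho_\ell$ be minimizers over $\rho\in\mathbb R^p$, computed measurably from the observations outside $I_\ell$, of $$(\hat M_\ell-\hat G_\ell\rho)'\tfrac1q\Omega(\hat M_\ell-\hat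 G_\ell\rho)+2\lambda_n|\rho|_1$$ with $\Omega=I_q$ and with $\Omega=\mathrm{diag}(\hat\sigma_{\ell1}^{-2}(\tilde\rho_\ell),\dots,\hat\sigma_{\ell q}^{-2}(\tilde\rho_\ell))$, respectively. Put $\hat\alpha_\ell=b'\hat\rho_\ell$ and $$\hat\theta=\frac1n\sum_{\ell}\sum_{i\in I_\ell}\{m(W_i,\hat\gamma_\ell)+\hat\alpha_\ell(Z_i)[Y_i-\hat\gamma_\ell(X_i)]\},\qquad \hat V=\frac1n\sum_\ell\sum_{i\in I_\ell}\{m(W_i,\hat\gamma_\ell)-\hat\theta+\hat\alpha_\ell(Z_i)[Y_i-\hat\gamma_\ell(X_i)]\}^2 .$$ **Assumptions.** Let $\kappa_n^\gamma>0$ with $\sqrt{\log q/n}=O(\kappa_n^\gamma)$, and let $\bar s=\bar s_n\ge1$ be integers. "$\gamma$ near $\gamma_0$" means $\gamma\in\Gamma$, $\|\gamma-\gamma_0\|\le\epsilon$, for some fixed $\epsilon>0$; constants do not depend on $n$. 1. $\max_k|b_k(Z)|\le C_b$ and $\max_j|d_j(X)|\le C_d$ almost surely. 2. There are $\bar\rho\in\mathbb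 R^p$ with at most $\bar s$ nonzero entries, $|\bar\rho|_1\le\bar A$, and $E[(\alpha_0(Z)-b(Z)'\bar\rho)^2]\le C\bar s(\kappa_n^\gamma)^2$. 3. Let $G=E[d(X)b(Z)']$, $M=E[D(W,\gamma_0,d)]$, let $\rho_L$ minimize $(M-G\rho)'\frac1q(M-G\rho)+2\kappa_n^\gamma|\rho|_1$, and let $\rho_\star$ minimize $(\rho_L-v)'G'\frac1qG(\rho_L-v)+2\kappa_n^\gamma\sum_{k:\bar\rho_k=0}|v_k|$ over $v$. The moments are non-degenerate: for some $\underline\sigma^2>0$, $E[(D(W,\gamma,d_j)-d_j(X)b(Z)'\rho_\star)^2]\ge\underline\sigma^2$ for all $n$, all $j\le q$ and all $\gamma$ near $\gamma_0$. 4. Let $\sigma_j^2=E[(D(W,\gamma_0,d_j)-d_j(X)b(Z)'\rho_\star)^2]$ and $A=G'\frac1q\mathrm{diag}(\sigma_1^{-2},\dots,\sigma_q^{-2})G$. The eigenvalues of $A$ are bounded uniformly in $n$, and for some $c>0$, $\delta'A\delta\ge c\sum_{k\in S}\delta_k^2$ whenever $|S|\le\bar s$ and $\sum_{k\notin S}|\delta_k|\le3\sum_{k\in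 S}|\delta_k|$. 5. $\alpha_0(Z)$ and $E[\varepsilon^2\mid Z]$ are bounded, and $E[m(W,\gamma_0)^2]<\infty$. 6. For $\gamma$ near $\gamma_0$ and all $n$, $\max_j|D(W,\gamma,d_j)|\le C$ almost surely and $\max_j|E[D(W,\gamma,d_j)-D(W,\gamma_0,d_j)]|\le C\|\gamma-\gamma_0\|$. 7. For $\gamma$ near $\gamma_0$, $m(W,\gamma)$ is integrable and $|E[m(W,\gamma)-m(W,\gamma_0)-D(W,\gamma_0,\gamma-\gamma_0)]|\le C\|\gamma-\gamma_0\|^2$. 8. $\|\hat\gamma_\ell-\gamma_0\|=O_p(\kappa_n^\gamma)$, $\|\hat\gamma_{\ell,\ell'}-\gamma_0\|=O_p(\kappa_n^\gamma)$ for $\ell\ne\ell'$, $n^{1/4}\|\hat\gamma_\ell-\gamma_0\|\to_p0$, and $\int[m(w,\hat\gamma_\ell)-m(w,\gamma_0)]^2F_0(dw)\to_p0$. 9. $\kappa_n^\gamma=o(\lambda_n)$, $\bar s^2\lambda_n=o(1)$, and $\sqrt n\,\kappa_n^\alpha\kappa_n^\gamma=o(1)$ with $\kappa_n^\alpha=\bar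 s\lambda_n$. **Conclusion.** $V<\infty$, $$\sqrt n(\hat\theta-\theta_0)\xrightarrow{d}\mathcal N(0,V)\quad\text{and}\quad\hat V\xrightarrow{p}V=E[\psi_0(W)^2].$$ -/

import Mathlib

open MeasureTheory ProbabilityTheory Filter Topology Asymptotics
open scoped Matrix

noncomputable section

namespace NPIV

/-- An observation `w = (y, x, z)`: outcome, endogenous regressors, instruments. -/
abbrev Obs (𝒳 𝒵 : Type*) := ℝ × 𝒳 × 𝒵

/-! ### Population side -/

/-- The population objects: the law `F` of one observation, the linear space `Γ` of structural
functions on which the functional is considered (for instance all measurable square-integrable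
functions of `X`, or the smooth ones among them), the functional `m (w, γ)`, the structural
function `γ₀` and the Riesz representer `α₀`. The conditions that tie them together are in
`IsNPIV` and `IsRieszRepresenter`. -/
structure Model (𝒳 𝒵 : Type*) [MeasurableSpace 𝒳] [MeasurableSpace 𝒵] where
  F : Measure (Obs 𝒳 𝒵)
  Γ : Submodule ℝ (𝒳 → ℝ)
  m : Obs 𝒳 𝒵 → (𝒳 → ℝ) → ℝ
  γ₀ : 𝒳 → ℝ
  α₀ : 𝒵 → ℝ

section Population

variable {𝒳 𝒵 : Type*} [MeasurableSpace 𝒳] [MeasurableSpace 𝒵] (M : Model 𝒳 𝒵)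

/-- The residual `y - γ₀ (x)`. -/
def Model.resid (w : Obs 𝒳 𝒵) : ℝ := w.1 - M.γ₀ w.2.1

/-- The σ-algebra on observations generated by the instruments. -/
abbrev sigmaZ (𝒳 𝒵 : Type*) [MeasurableSpace 𝒵] : MeasurableSpace (Obs 𝒳 𝒵) :=
  MeasurableSpace.comap (fun w => w.2.2) inferInstance

/-- `D (w, γ, ζ) = d/dτ m (w, γ + τ ζ)` at `τ = 0`. -/
def Model.D (γ ζ : 𝒳 → ℝ) (w : Obs 𝒳 𝒵) : ℝ :=
  deriv (fun τ : ℝ => M.m w (γ + τ • ζ)) 0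

/-- The mean square norm `‖γ‖ = √E[γ(X)²]`. -/
def Model.normX (γ : 𝒳 → ℝ) : ℝ := √(∫ w, γ w.2.1 ^ 2 ∂M.F)

/-- `θ₀ = E[m (W, γ₀)]`. -/
def Model.θ₀ : ℝ := ∫ w, M.m w M.γ₀ ∂M.F

/-- `ψ₀ (w) = m (w, γ₀) - θ₀ + α₀ (z) (y - γ₀ (x))`. -/
def Model.ψ₀ (w : Obs 𝒳 𝒵) : ℝ := M.m w M.γ₀ - M.θ₀ + M.α₀ w.2.2 * M.resid w

/-- `V = E[ψ₀²]`. -/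
def Model.V : ℝ := ∫ w, M.ψ₀ w ^ 2 ∂M.F

/-- The nonparametric instrumental variables model `Y = γ₀(X) + ε`, `E[ε | Z] = 0`, where `Γ`
consists of measurable square-integrable functions and contains `γ₀`. -/
structure Model.IsNPIV : Prop where
  prob : IsProbabilityMeasure M.F
  measurable_Γ : ∀ γ ∈ M.Γ, Measurable γ
  memLp_Γ : ∀ γ ∈ M.Γ, MemLp (fun w : Obs 𝒳 𝒵 => γ w.2.1) 2 M.F
  γ₀_mem : M.γ₀ ∈ M.Γ
  measurable_m : ∀ γ ∈ M.Γ, Measurable fun w => M.m w γ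
  integrable_resid : Integrable M.resid M.F
  exogeneity : M.F[M.resid | sigmaZ 𝒳 𝒵] =ᵐ[M.F] 0

/-- `m (W, γ)` is Gateaux differentiable in `γ`, with a derivative linear in the direction. -/
structure Model.IsGateaux : Prop where
  differentiable : ∀ γ ∈ M.Γ, ∀ ζ ∈ M.Γ, ∀ᵐ w ∂M.F,
    DifferentiableAt ℝ (fun τ : ℝ => M.m w (γ + τ • ζ)) 0
  linear : ∀ γ ∈ M.Γ, ∀ ζ₁ ∈ M.Γ, ∀ ζ₂ ∈ M.Γ, ∀ a₁ a₂ : ℝ, ∀ᵐ w ∂M.F,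
    M.D γ (a₁ • ζ₁ + a₂ • ζ₂) w = a₁ * M.D γ ζ₁ w + a₂ * M.D γ ζ₂ w

/-- `α₀ (Z)` is square integrable and `E[D (W, γ₀, ζ)] = E[α₀ (Z) ζ (X)]` for all `ζ`. -/
structure Model.IsRieszRepresenter : Prop where
  measurable : Measurable M.α₀
  memLp : MemLp (fun w : Obs 𝒳 𝒵 => M.α₀ w.2.2) 2 M.F
  integrable : ∀ ζ ∈ M.Γ, Integrable (M.D M.γ₀ ζ) M.F
  riesz : ∀ ζ ∈ M.Γ, ∫ w, M.D M.γ₀ ζ w ∂M.F = ∫ w, M.α₀ w.2.2 * ζ w.2.1 ∂M.F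

/-- `α₀ (z)` and `E[(y - γ₀ (x))² | z]` are bounded, and `E[m (w, γ₀)²] < ∞`. -/
structure Model.BoundedPrimitives : Prop where
  α₀_bdd : ∃ C : ℝ, ∀ᵐ w ∂M.F, |M.α₀ w.2.2| ≤ C
  resid_memLp : MemLp M.resid 2 M.F
  condVar_bdd : ∃ C : ℝ, ∀ᵐ w ∂M.F, (M.F[fun v => M.resid v ^ 2 | sigmaZ 𝒳 𝒵]) w ≤ C
  m_memLp : MemLp (fun w => M.m w M.γ₀) 2 M.F

/-- Near `γ₀` the mean of the linearization remainder is of second order in `‖γ - γ₀‖`. -/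
def Model.QuadraticRemainder : Prop :=
  ∃ C ε : ℝ, 0 < C ∧ 0 < ε ∧ ∀ γ ∈ M.Γ, M.normX (γ - M.γ₀) ≤ ε →
    Integrable (fun w => M.m w γ) M.F ∧
    |∫ w, (M.m w γ - M.m w M.γ₀ - M.D M.γ₀ (γ - M.γ₀) w) ∂M.F| ≤ C * M.normX (γ - M.γ₀) ^ 2

end Population

/-! ### Penalized GMM -/

/-- `(M - G ρ)' (Ω / q) (M - G ρ) + 2 lam |ρ|₁`. -/
def pgmmObj {p q : ℕ} (Ω : Matrix (Fin q) (Fin q) ℝ) (M : Fin q → ℝ)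
    (G : Matrix (Fin q) (Fin p) ℝ) (lam : ℝ) (ρ : Fin p → ℝ) : ℝ :=
  (M - G *ᵥ ρ) ⬝ᵥ (((q : ℝ)⁻¹ • Ω) *ᵥ (M - G *ᵥ ρ)) + 2 * lam * ∑ k, |ρ k|

/-- `G' (Ω / q) G`. -/
def gram {p q : ℕ} (Ω : Matrix (Fin q) (Fin q) ℝ) (G : Matrix (Fin q) (Fin p) ℝ) :
    Matrix (Fin p) (Fin p) ℝ :=
  Gᵀ * ((q : ℝ)⁻¹ • Ω) * G

/-- `(ρL - v)' A (ρL - v) + 2 ε ∑_{k ∉ S} |v k|`. -/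
def sparseObj {p : ℕ} (A : Matrix (Fin p) (Fin p) ℝ) (ρL : Fin p → ℝ) (ε : ℝ)
    (S : Finset (Fin p)) (v : Fin p → ℝ) : ℝ :=
  (ρL - v) ⬝ᵥ (A *ᵥ (ρL - v)) + 2 * ε * ∑ k ∈ Sᶜ, |v k|

/-- The index set of the nonzero coefficients. -/
def supp {p : ℕ} (ρ : Fin p → ℝ) : Finset (Fin p) := Finset.univ.filter fun k => ρ k ≠ 0

/-- `φ²(s) ≥ c`: the quadratic form of `A` dominates `c ‖δ_S‖²` for every index set `S` of
size at most `s` and every `δ` in the cone `|δ_{Sᶜ}|₁ ≤ 3 |δ_S|₁`. -/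
def RestrictedEigenvalue {p : ℕ} (A : Matrix (Fin p) (Fin p) ℝ) (s : ℕ) (c : ℝ) : Prop :=
  ∀ S : Finset (Fin p), S.card ≤ s → ∀ δ : Fin p → ℝ,
    ∑ k ∈ Sᶜ, |δ k| ≤ 3 * ∑ k ∈ S, |δ k| → c * ∑ k ∈ S, δ k ^ 2 ≤ δ ⬝ᵥ (A *ᵥ δ)

/-! ### The cross-fitted estimation procedure -/

/-- The ingredients of the estimation procedure for every sample size `n`: the split of the
sample into `L` folds, the dictionaries `b` (`p` functions of `Z`) and `d` (`q` functions of
`X`), the penalty level, and the estimators as functions of the data they are computed from.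
`γhat n ℓ`, `ρtilde n ℓ`, `ρhat n ℓ` use the observations outside fold `ℓ`, and
`γhat₂ n ℓ ℓ'` those that are neither in fold `ℓ` nor in fold `ℓ'`. -/
structure Procedure (𝒳 𝒵 : Type*) where
  L : ℕ
  fold : ∀ n : ℕ, Fin n → Fin L
  p : ℕ → ℕ
  q : ℕ → ℕ
  b : ∀ n, Fin (p n) → 𝒵 → ℝ
  d : ∀ n, Fin (q n) → 𝒳 → ℝ
  lam : ℕ → ℝ
  γhat : ∀ (n : ℕ) (ℓ : Fin L), ({i : Fin n // fold n i ≠ ℓ} → Obs 𝒳 𝒵) → 𝒳 → ℝ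
  γhat₂ : ∀ (n : ℕ) (ℓ ℓ' : Fin L),
    ({i : Fin n // fold n i ≠ ℓ ∧ fold n i ≠ ℓ'} → Obs 𝒳 𝒵) → 𝒳 → ℝ
  ρtilde : ∀ (n : ℕ) (ℓ : Fin L), ({i : Fin n // fold n i ≠ ℓ} → Obs 𝒳 𝒵) → Fin (p n) → ℝ
  ρhat : ∀ (n : ℕ) (ℓ : Fin L), ({i : Fin n // fold n i ≠ ℓ} → Obs 𝒳 𝒵) → Fin (p n) → ℝ

section Estimation

variable {𝒳 𝒵 : Type*} [MeasurableSpace 𝒳] [MeasurableSpace 𝒵]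
  (M : Model 𝒳 𝒵) (E : Procedure 𝒳 𝒵)

/-- `b(z)'ρ`. -/
def Procedure.lin (n : ℕ) (ρ : Fin (E.p n) → ℝ) (z : 𝒵) : ℝ := ∑ k, E.b n k z * ρ k

/-- The number `n_ℓ` of observations in fold `ℓ`. -/
def Procedure.foldSize (n : ℕ) (ℓ : Fin E.L) : ℕ :=
  (Finset.univ.filter fun i : Fin n => E.fold n i = ℓ).card

/-- The structural function estimate `γ̂_ℓ` on the full sample `x`. -/
def Procedure.gam {n : ℕ} (x : Fin n → Obs 𝒳 𝒵) (ℓ : Fin E.L) : 𝒳 → ℝ :=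
  E.γhat n ℓ fun i => x i

/-- The structural function estimate `γ̂_{ℓ,ℓ'}` on the full sample `x`. -/
def Procedure.gam₂ {n : ℕ} (x : Fin n → Obs 𝒳 𝒵) (ℓ ℓ' : Fin E.L) : 𝒳 → ℝ :=
  E.γhat₂ n ℓ ℓ' fun i => x i

/-- The preliminary coefficients `ρ̃_ℓ`. -/
def Procedure.ρprelim {n : ℕ} (x : Fin n → Obs 𝒳 𝒵) (ℓ : Fin E.L) : Fin (E.p n) → ℝ :=
  E.ρtilde n ℓ fun i => x i

/-- The final coefficients `ρ̂_ℓ`. -/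
def Procedure.ρfinal {n : ℕ} (x : Fin n → Obs 𝒳 𝒵) (ℓ : Fin E.L) : Fin (E.p n) → ℝ :=
  E.ρhat n ℓ fun i => x i

/-- `Ĝ_ℓ = (n - n_ℓ)⁻¹ ∑_{i ∉ I_ℓ} d(X_i) b(Z_i)'`. -/
def Procedure.Ghat {n : ℕ} (x : Fin n → Obs 𝒳 𝒵) (ℓ : Fin E.L) :
    Matrix (Fin (E.q n)) (Fin (E.p n)) ℝ :=
  fun j k => ((n : ℝ) - E.foldSize n ℓ)⁻¹ *
    ∑ i : Fin n with E.fold n i ≠ ℓ, E.d n j (x i).2.1 * E.b n k (x i).2.2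

/-- `M̂_{ℓj} = (n - n_ℓ)⁻¹ ∑_{ℓ' ≠ ℓ} ∑_{i ∈ I_ℓ'} D(W_i, γ̂_{ℓ,ℓ'}, d_j)`. -/
def Procedure.Mhat {n : ℕ} (x : Fin n → Obs 𝒳 𝒵) (ℓ : Fin E.L) : Fin (E.q n) → ℝ :=
  fun j => ((n : ℝ) - E.foldSize n ℓ)⁻¹ *
    ∑ ℓ' : Fin E.L with ℓ' ≠ ℓ, ∑ i : Fin n with E.fold n i = ℓ',
      M.D (E.gam₂ x ℓ ℓ') (E.d n j) (x i)

/-- The sample second moment `σ̂²_{ℓj}(ρ)` of the `j`-th moment function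
`D(W_i, γ̂_{ℓ,ℓ'}, d_j) - d_j(X_i) b(Z_i)'ρ`, over the observations outside fold `ℓ`. -/
def Procedure.σ2hat {n : ℕ} (x : Fin n → Obs 𝒳 𝒵) (ℓ : Fin E.L) (ρ : Fin (E.p n) → ℝ)
    (j : Fin (E.q n)) : ℝ :=
  ((n : ℝ) - E.foldSize n ℓ)⁻¹ *
    ∑ ℓ' : Fin E.L with ℓ' ≠ ℓ, ∑ i : Fin n with E.fold n i = ℓ',
      (M.D (E.gam₂ x ℓ ℓ') (E.d n j) (x i) - E.d n j (x i).2.1 * E.lin n ρ (x i).2.2) ^ 2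

/-- The diagonal weight matrix `diag(σ̂⁻²_{ℓ1}(ρ̃_ℓ), …, σ̂⁻²_{ℓq}(ρ̃_ℓ))`. -/
def Procedure.Ωhat {n : ℕ} (x : Fin n → Obs 𝒳 𝒵) (ℓ : Fin E.L) :
    Matrix (Fin (E.q n)) (Fin (E.q n)) ℝ :=
  Matrix.diagonal fun j => (E.σ2hat M x ℓ (E.ρprelim x ℓ) j)⁻¹

/-- `m(w, γ̂_ℓ) + α̂_ℓ(z) (y - γ̂_ℓ(x))` with `α̂_ℓ = b'ρ̂_ℓ`. -/
def Procedure.score {n : ℕ} (x : Fin n → Obs 𝒳 𝒵) (ℓ : Fin E.L) (w : Obs 𝒳 𝒵) : ℝ :=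
  M.m w (E.gam x ℓ) + E.lin n (E.ρfinal x ℓ) w.2.2 * (w.1 - E.gam x ℓ w.2.1)

/-- The debiased estimator `θ̂`. -/
def Procedure.θhat {n : ℕ} (x : Fin n → Obs 𝒳 𝒵) : ℝ :=
  (n : ℝ)⁻¹ * ∑ ℓ : Fin E.L, ∑ i : Fin n with E.fold n i = ℓ, E.score M x ℓ (x i)

/-- The variance estimator `V̂`. -/
def Procedure.Vhat {n : ℕ} (x : Fin n → Obs 𝒳 𝒵) : ℝ :=
  (n : ℝ)⁻¹ * ∑ ℓ : Fin E.L, ∑ i : Fin n with E.fold n i = ℓ,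
    (E.score M x ℓ (x i) - E.θhat M x) ^ 2

/-! Population counterparts for the dictionaries of sample size `n`. -/

/-- `G = E[d(X) b(Z)']`. -/
def Procedure.Gpop (n : ℕ) : Matrix (Fin (E.q n)) (Fin (E.p n)) ℝ :=
  fun j k => ∫ w, E.d n j w.2.1 * E.b n k w.2.2 ∂M.F

/-- `M = E[D(W, γ₀, d)]`. -/
def Procedure.Mpop (n : ℕ) : Fin (E.q n) → ℝ :=
  fun j => ∫ w, M.D M.γ₀ (E.d n j) w ∂M.F

/-- `E[(D(W, γ, d_j) - d_j(X) b(Z)'ρ)²]`; for `γ = γ₀` this is `σ_j²(ρ)`. -/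
def Procedure.σ2pop (n : ℕ) (γ : 𝒳 → ℝ) (ρ : Fin (E.p n) → ℝ) (j : Fin (E.q n)) : ℝ :=
  ∫ w, (M.D γ (E.d n j) w - E.d n j w.2.1 * E.lin n ρ w.2.2) ^ 2 ∂M.F

/-- The population diagonal weight matrix `diag(σ₁⁻²(ρ), …, σ_q⁻²(ρ))`. -/
def Procedure.Ωpop (n : ℕ) (ρ : Fin (E.p n) → ℝ) : Matrix (Fin (E.q n)) (Fin (E.q n)) ℝ :=
  Matrix.diagonal fun j => (E.σ2pop M n M.γ₀ ρ j)⁻¹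

/-- Regularity of the procedure: at least two folds of about equal size, `2 ≤ q`, `p ≤ q`,
positive penalty, dictionary functions and estimates that are measurable and of the right kind. -/
structure Procedure.IsRegular : Prop where
  two_le_L : 2 ≤ E.L
  balanced : ∀ ℓ, Tendsto (fun n => (E.foldSize n ℓ : ℝ) / n) atTop (𝓝 (1 / E.L))
  two_le_q : ∀ n, 2 ≤ E.q n
  p_le_q : ∀ n, E.p n ≤ E.q n
  lam_pos : ∀ n, 0 < E.lam n
  measurable_b : ∀ n k, Measurable (E.b n k)
  d_mem : ∀ n j, E.d n j ∈ M.Γ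
  γhat_mem : ∀ n ℓ x, E.γhat n ℓ x ∈ M.Γ
  γhat₂_mem : ∀ n ℓ ℓ' x, E.γhat₂ n ℓ ℓ' x ∈ M.Γ
  measurable_γhat : ∀ n ℓ, Measurable (Function.uncurry (E.γhat n ℓ))
  measurable_γhat₂ : ∀ n ℓ ℓ', Measurable (Function.uncurry (E.γhat₂ n ℓ ℓ'))
  measurable_m_γhat : ∀ n ℓ,
    Measurable (Function.uncurry fun x w => M.m w (E.γhat n ℓ x))
  measurable_D_γhat₂ : ∀ n ℓ ℓ' j,
    Measurable (Function.uncurry fun x w => M.D (E.γhat₂ n ℓ ℓ' x) (E.d n j) w)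
  measurable_ρtilde : ∀ n ℓ, Measurable (E.ρtilde n ℓ)
  measurable_ρhat : ∀ n ℓ, Measurable (E.ρhat n ℓ)

/-- The dictionary functions are uniformly bounded, almost surely. -/
def Procedure.BoundedDictionaries : Prop :=
  ∃ Cb Cd : ℝ, ∀ n, ∀ᵐ w ∂M.F,
    (∀ k, |E.b n k w.2.2| ≤ Cb) ∧ ∀ j, |E.d n j w.2.1| ≤ Cd

/-- Uniformly over a mean square neighbourhood of `γ₀`, the derivatives in the dictionary
directions are bounded and their means are Lipschitz at `γ₀`. -/
def Procedure.BoundedDerivative : Prop :=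
  ∃ C ε : ℝ, 0 < C ∧ 0 < ε ∧ ∀ γ ∈ M.Γ, M.normX (γ - M.γ₀) ≤ ε → ∀ n,
    (∀ᵐ w ∂M.F, ∀ j, |M.D γ (E.d n j) w| ≤ C) ∧
    ∀ j, |∫ w, (M.D γ (E.d n j) w - M.D M.γ₀ (E.d n j) w) ∂M.F| ≤ C * M.normX (γ - M.γ₀)

/-- Sparse approximation: `ρbar n` has at most `s n ≥ 1` nonzero entries, its `ℓ₁` norm is
bounded, and `‖α₀ - b'ρbar‖² ≤ C s ε²`. -/
def Procedure.SparseApprox (s : ℕ → ℕ) (ε : ℕ → ℝ) (ρbar : ∀ n, Fin (E.p n) → ℝ) : Prop :=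
  (∀ n, 1 ≤ s n) ∧ (∀ n, (supp (ρbar n)).card ≤ s n) ∧
  (∃ A : ℝ, ∀ n, ∑ k, |ρbar n k| ≤ A) ∧
  ∃ C : ℝ, 1 < C ∧ ∀ n,
    ∫ w, (M.α₀ w.2.2 - E.lin n (ρbar n) w.2.2) ^ 2 ∂M.F ≤ C * s n * ε n ^ 2

/-- `ρstar n` is the population target of the preliminary (identity weighted) estimator:
`ρL n` minimizes the population criterion with penalty level `ε n`, and `ρstar n` minimizes the
criterion that penalizes only the coordinates outside the support of `ρbar n`. -/
def Procedure.IsPopulationTarget (ε : ℕ → ℝ) (ρbar ρL ρstar : ∀ n, Fin (E.p n) → ℝ) : Prop :=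
  ∀ n, IsMinOn (pgmmObj 1 (E.Mpop M n) (E.Gpop M n) (ε n)) Set.univ (ρL n) ∧
    IsMinOn (sparseObj (gram 1 (E.Gpop M n)) (ρL n) (ε n) (supp (ρbar n))) Set.univ (ρstar n)

/-- Non-degenerate moments: the variances at `ρstar` of the population moments are bounded away
from zero, uniformly over a mean square neighbourhood of `γ₀`. -/
def Procedure.NondegenerateMoments (ρstar : ∀ n, Fin (E.p n) → ℝ) : Prop :=
  ∃ v ε : ℝ, 0 < v ∧ 0 < ε ∧ ∀ γ ∈ M.Γ, M.normX (γ - M.γ₀) ≤ ε →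
    ∀ n j, v ≤ E.σ2pop M n γ (ρstar n) j

/-- The eigenvalues of `G' Ω_q G` are bounded uniformly in `n`, and its restricted eigenvalue
`φ²(s)` is bounded away from zero, with the population diagonal weight matrix `Ω`. -/
def Procedure.EigenvalueCondition (s : ℕ → ℕ) (ρstar : ∀ n, Fin (E.p n) → ℝ) : Prop :=
  (∃ C : ℝ, ∀ n, ∀ μ : ℝ, Module.End.HasEigenvalue
    (Matrix.toLin' (gram (E.Ωpop M n (ρstar n)) (E.Gpop M n))) μ → μ ≤ C) ∧
  ∃ c : ℝ, 0 < c ∧ ∀ n,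
    RestrictedEigenvalue (gram (E.Ωpop M n (ρstar n)) (E.Gpop M n)) (s n) c

end Estimation

/-! ### Sampling and stochastic orders -/

/-- `X n = O_p (r n)`. -/
def IsBigOp {Ω : Type*} [MeasurableSpace Ω] (P : Measure Ω) (X : ℕ → Ω → ℝ) (r : ℕ → ℝ) :
    Prop :=
  ∀ η : ℝ, 0 < η → ∃ K : ℝ, ∀ᶠ n in atTop, P {ω | K * r n < |X n ω|} ≤ ENNReal.ofReal η

/-- The first `n` observations. -/
def sample {Ω 𝒳 𝒵 : Type*} (W : ℕ → Ω → Obs 𝒳 𝒵) (n : ℕ) (ω : Ω) : Fin n → Obs 𝒳 𝒵 :=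
  fun i => W i ω

section Sampling

variable {Ω 𝒳 𝒵 : Type*} [MeasurableSpace Ω] [MeasurableSpace 𝒳] [MeasurableSpace 𝒵]
  (M : Model 𝒳 𝒵) (E : Procedure 𝒳 𝒵) (P : Measure Ω) (W : ℕ → Ω → Obs 𝒳 𝒵)

/-- `W 0, W 1, …` are independent with common law `F`. -/
structure IsIIDSample : Prop where
  measurable : ∀ i, Measurable (W i)
  indep : iIndepFun W P
  law : ∀ i, P.map (W i) = M.F

/-- The Riesz representer coefficients are penalized GMM estimates: the preliminary ones with
the identity weight matrix, the final ones with the estimated diagonal weight matrix. -/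
def Procedure.IsDiagonalPGMM : Prop :=
  ∀ n ℓ, ∀ᵐ ω ∂P,
    IsMinOn (pgmmObj 1 (E.Mhat M (sample W n ω) ℓ) (E.Ghat (sample W n ω) ℓ) (E.lam n))
      Set.univ (E.ρprelim (sample W n ω) ℓ) ∧
    IsMinOn (pgmmObj (E.Ωhat M (sample W n ω) ℓ) (E.Mhat M (sample W n ω) ℓ)
      (E.Ghat (sample W n ω) ℓ) (E.lam n)) Set.univ (E.ρfinal (sample W n ω) ℓ)

/-- Rates of the structural function estimates: `‖γ̂ - γ₀‖ = O_p(κ)` for all `γ̂_ℓ` and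
`γ̂_{ℓ,ℓ'}`, and `n^{1/4} ‖γ̂_ℓ - γ₀‖ → 0` in probability. -/
structure Procedure.StructuralRates (κ : ℕ → ℝ) : Prop where
  rate : ∀ ℓ, IsBigOp P (fun n ω => M.normX (E.gam (sample W n ω) ℓ - M.γ₀)) κ
  rate₂ : ∀ ℓ ℓ', ℓ ≠ ℓ' →
    IsBigOp P (fun n ω => M.normX (E.gam₂ (sample W n ω) ℓ ℓ' - M.γ₀)) κ
  fourthRoot : ∀ ℓ, TendstoInMeasure P
    (fun (n : ℕ) ω => (n : ℝ) ^ (1 / 4 : ℝ) * M.normX (E.gam (sample W n ω) ℓ - M.γ₀))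
    atTop (fun _ => 0)

/-- `∫ (m(w, γ̂_ℓ) - m(w, γ₀))² F(dw) → 0` in probability. -/
def Procedure.MeanSquareConsistent : Prop :=
  ∀ ℓ, ∀ η : ℝ, 0 < η → Tendsto (fun n => P {ω | ENNReal.ofReal η ≤
    ∫⁻ w, ENNReal.ofReal ((M.m w (E.gam (sample W n ω) ℓ) - M.m w M.γ₀) ^ 2) ∂M.F})
    atTop (𝓝 0)

end Sampling

end NPIV

end

/-! The score `m(w, γ) + α(z)(y - γ(x))` is orthogonal: its mean reacts to errors in `γ` and `α`
only at second order. By `E[ε | Z] = 0` and the Riesz identity, for `α = b'ρ` the mean deviation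
from the score at `(γ₀, α₀)` is the linearization remainder of `m` minus `E[(α - α₀)(γ - γ₀)]`
(`Procedure.scoreDiff_bounds`). The remainder is of order `‖γ̂ - γ₀‖²`, which is `o(n^{-1/2})` by
the fourth-root rate; the product is at most the product of the two rates, `s·lam` for `α̂` and `κ`
for `γ̂`, which is `o(n^{-1/2})` by assumption.

Cross-fitting removes the empirical process term. Given the data outside a fold, the estimates are
fixed and the observations in the fold are still i.i.d., so Chebyshev's inequality bounds the
centred sum of score errors by a small multiple of `√n` once their second moment is small
(`Procedure.scoreErr_negligible`). What is left is the central limit theorem for `ψ₀`; the variance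
estimator follows from the law of large numbers for `ψ₀²`.

The rate of `α̂` comes from a Lasso argument, `pgmm_rate`. With high probability `Ĝ` and `M̂` are
within `lam` of their population values in every entry: this is Hoeffding's inequality and a union
bound, affordable because `log q = o(n·lam²)` (`crossfit_holdsWHP`). The moments at `ρbar` are then
`O(√s·lam)`. Comparing the criterion at the minimizer and at `ρbar`, a restricted eigenvalue gives
`|ρ̂ - ρbar|₁ = O(s·lam)`. The diagonal weights need not converge; they only have to stay between
two positive constants. This holds at `ρstar` by non-degeneracy, and it carries over to `ρ̃` because
`ρ̃` and `ρstar` are both `ℓ₁`-close to `ρbar`, the former by `pgmm_rate` with unit weights and the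
latter by `sparseObj_rate`. The `ℓ₁` rate then bounds the mean square error of `α̂`, since the
dictionary is bounded. -/

noncomputable section

namespace NPIV

/-! ### Events of probability tending to one -/

/-- The events `A n` have probability tending to one. -/
def HoldsWHP {Ω : Type*} [MeasurableSpace Ω] (P : Measure Ω) (A : ℕ → Ω → Prop) : Prop :=
  Tendsto (fun n => P {ω | ¬ A n ω}) atTop (𝓝 0)

lemma exists_pos_ofReal_le {τ : ENNReal} (hτ : 0 < τ) :
    ∃ r : ℝ, 0 < r ∧ ENNReal.ofReal r ≤ τ := by
  by_cases h : τ = ⊤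
  · exact ⟨1, one_pos, by simp [h]⟩
  · exact ⟨τ.toReal, ENNReal.toReal_pos hτ.ne' h, ENNReal.ofReal_toReal_le⟩

section WHP

variable {Ω : Type*} [MeasurableSpace Ω] {P : Measure Ω} {A B : ℕ → Ω → Prop}

lemma tendsto_zero_of_eventually_le {u v : ℕ → ENNReal} (hv : Tendsto v atTop (𝓝 0))
    (h : ∀ᶠ n in atTop, u n ≤ v n) : Tendsto u atTop (𝓝 0) :=
  tendsto_of_tendsto_of_tendsto_of_le_of_le' tendsto_const_nhds hv
    (Eventually.of_forall fun _ => zero_le) h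

/-- Only monotonicity and subadditivity of `P` as an outer measure are used in this calculus, so the
events need not be measurable. -/
lemma HoldsWHP.mono_ae (hA : HoldsWHP P A)
    (h : ∀ᶠ n in atTop, ∀ᵐ ω ∂P, A n ω → B n ω) : HoldsWHP P B := by
  refine tendsto_zero_of_eventually_le hA (h.mono fun n hn => measure_mono_ae ?_)
  filter_upwards [hn] with ω hω hB hA
  exact hB (hω hA)

lemma HoldsWHP.mono (hA : HoldsWHP P A)
    (h : ∀ᶠ n in atTop, ∀ ω, A n ω → B n ω) : HoldsWHP P B :=
  hA.mono_ae (h.mono fun _ hn => ae_of_all _ hn)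

lemma HoldsWHP.of_ae (h : ∀ᶠ n in atTop, ∀ᵐ ω ∂P, A n ω) : HoldsWHP P A := by
  refine tendsto_zero_of_eventually_le (v := fun _ => 0) tendsto_const_nhds
    (h.mono fun n hn => ?_)
  exact le_of_eq hn

lemma HoldsWHP.and (hA : HoldsWHP P A) (hB : HoldsWHP P B) :
    HoldsWHP P fun n ω => A n ω ∧ B n ω := by
  have h := hA.add hB
  rw [add_zero] at h
  refine tendsto_zero_of_eventually_le h (Eventually.of_forall fun n => ?_)
  refine (measure_mono fun ω hω => ?_).trans (measure_union_le _ _)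
  by_cases hA : A n ω
  · exact Or.inr fun hB => hω ⟨hA, hB⟩
  · exact Or.inl hA

lemma HoldsWHP.all {ι : Type*} [Finite ι] {A : ι → ℕ → Ω → Prop}
    (h : ∀ i, HoldsWHP P (A i)) : HoldsWHP P fun n ω => ∀ i, A i n ω := by
  have := Fintype.ofFinite ι
  have h' := tendsto_finsetSum (Finset.univ : Finset ι) fun i _ => h i
  simp only [Finset.sum_const_zero] at h'
  refine tendsto_zero_of_eventually_le h' (Eventually.of_forall fun n => ?_)
  refine (measure_mono fun ω hω => ?_).trans (measure_biUnion_finset_le _ _)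
  simpa using hω

/-- The form in which sample splitting delivers its bounds: `A` is a condition on the training data
and `e n` the failure probability under it. -/
lemma HoldsWHP.of_le_add (hA : HoldsWHP P A) {e : ℕ → ℝ} (he : Tendsto e atTop (𝓝 0))
    (h : ∀ᶠ n in atTop, P {ω | ¬ B n ω} ≤ P {ω | ¬ A n ω} + ENNReal.ofReal (e n)) :
    HoldsWHP P B := by
  have h' := hA.add (ENNReal.tendsto_ofReal he)
  rw [ENNReal.ofReal_zero, add_zero] at h'
  exact tendsto_zero_of_eventually_le h' h

/-- A quantity that is `O_p(r)` is eventually below `u` if `r = o(u)`. -/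
lemma IsBigOp.holdsWHP_le {X : ℕ → Ω → ℝ} {r u : ℕ → ℝ} (hX : IsBigOp P X r)
    (hu : ∀ K : ℝ, ∀ᶠ n in atTop, K * r n ≤ u n) : HoldsWHP P fun n ω => |X n ω| ≤ u n := by
  refine ENNReal.tendsto_nhds_zero.2 fun η hη => ?_
  obtain ⟨η', hη', hle⟩ := exists_pos_ofReal_le hη
  obtain ⟨K, hK⟩ := hX η' hη'
  filter_upwards [hK, hu K] with n h1 h2
  refine (measure_mono fun ω hω => ?_).trans (h1.trans hle)
  simp only [Set.mem_ofPred_eq, not_le] at hω ⊢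
  linarith

lemma tendstoInMeasure_zero_of_holdsWHP {X : ℕ → Ω → ℝ}
    (h : ∀ u > 0, HoldsWHP P fun n ω => |X n ω| ≤ u) : TendstoInMeasure P X atTop fun _ => 0 := by
  rw [tendstoInMeasure_iff_norm]
  intro u hu
  -- Convergence in measure concerns `u ≤ |X|`, whereas failure is a strict inequality; halving `u`
  -- bridges the two.
  refine tendsto_zero_of_eventually_le (h (u / 2) (by linarith)) (Eventually.of_forall fun n => ?_)
  refine measure_mono fun ω hω => ?_
  simp only [Set.mem_ofPred_eq, sub_zero, Real.norm_eq_abs, not_le] at hω ⊢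
  linarith

lemma TendstoInMeasure.holdsWHP {X : ℕ → Ω → ℝ} {a : ℝ}
    (h : TendstoInMeasure P X atTop fun _ => a) {u : ℝ} (hu : 0 < u) :
    HoldsWHP P fun n ω => |X n ω - a| ≤ u := by
  rw [tendstoInMeasure_iff_norm] at h
  refine tendsto_zero_of_eventually_le (h u hu) (Eventually.of_forall fun n => ?_)
  refine measure_mono fun ω hω => ?_
  simp only [Set.mem_ofPred_eq, Real.norm_eq_abs, not_le] at hω ⊢
  exact hω.le

end WHP

/-! ### Sample splitting -/

/-- If `A` and `B` are independent, a bound on the probability of `{(t, B) ∈ S}` for every fixed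
`t ∈ Good` bounds the probability of `{(A, B) ∈ S}`. -/
lemma measure_le_of_indepFun {Ω α β : Type*} [MeasurableSpace Ω] [MeasurableSpace α]
    [MeasurableSpace β] {P : Measure Ω} [IsProbabilityMeasure P] {A : Ω → α} {B : Ω → β}
    (hAB : IndepFun A B P) (hA : Measurable A) (hB : Measurable B) {S : Set (α × β)}
    (hS : MeasurableSet S) {Good : Set α} (hG : MeasurableSet Good) {η : ENNReal}
    (h : ∀ t ∈ Good, P {ω | (t, B ω) ∈ S} ≤ η) :
    P {ω | (A ω, B ω) ∈ S} ≤ P {ω | A ω ∉ Good} + η := by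
  have : IsProbabilityMeasure (P.map A) := Measure.isProbabilityMeasure_map hA.aemeasurable
  have : IsProbabilityMeasure (P.map B) := Measure.isProbabilityMeasure_map hB.aemeasurable
  -- Independence makes the joint law a product, so the probability is an integral over sections;
  -- sections at `t ∉ Good` will be bounded by one.
  have h1 : P {ω | (A ω, B ω) ∈ S} = ∫⁻ t, P {ω | (t, B ω) ∈ S} ∂(P.map A) := by
    have h2 : P {ω | (A ω, B ω) ∈ S} = (P.map fun ω => (A ω, B ω)) S :=
      (Measure.map_apply (hA.prodMk hB) hS).symm
    rw [h2, hAB.map_prod_eq_prod_map_map hA.aemeasurable hB.aemeasurable,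
      Measure.prod_apply hS]
    refine lintegral_congr fun t => ?_
    rw [Measure.map_apply hB (measurable_prodMk_left hS)]
    rfl
  have h3 : P {ω | A ω ∉ Good} = ∫⁻ t, Goodᶜ.indicator 1 t ∂(P.map A) := by
    rw [lintegral_indicator_one hG.compl, Measure.map_apply hA hG.compl]
    rfl
  have h4 : η = ∫⁻ _, η ∂(P.map A) := by simp
  rw [h1, h3, h4]
  rw [← lintegral_add_left (measurable_one.indicator hG.compl)]
  refine lintegral_mono fun t => ?_
  by_cases ht : t ∈ Good
  · exact (h t ht).trans (le_add_of_nonneg_left zero_le)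
  · simp only [Set.mem_compl_iff, ht, not_false_eq_true, Set.indicator_of_mem, Pi.one_apply]
    exact prob_le_one.trans (le_add_of_nonneg_right zero_le)

section Split

variable {Ω 𝒳 𝒵 : Type*} [MeasurableSpace Ω] [MeasurableSpace 𝒳] [MeasurableSpace 𝒵]
  {M : Model 𝒳 𝒵} {P : Measure Ω} {W : ℕ → Ω → Obs 𝒳 𝒵}

/-- The observations with index in `T`. -/
def subsample (W : ℕ → Ω → Obs 𝒳 𝒵) {n : ℕ} (T : Fin n → Prop) (ω : Ω) :
    {i : Fin n // T i} → Obs 𝒳 𝒵 :=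
  fun i => sample W n ω i

lemma measurable_subsample (hW : IsIIDSample M P W) {n : ℕ} (T : Fin n → Prop) :
    Measurable (subsample W T) :=
  measurable_pi_lambda _ fun i => hW.measurable i

/-- Training indices `T` and test indices `I` are disjoint, so the two blocks are independent and
the training data may be frozen at a value `t`. -/
lemma crossfit_le [IsProbabilityMeasure P] (hW : IsIIDSample M P W) {n : ℕ} {T : Fin n → Prop} {I : Finset (Fin n)}
    (hTI : ∀ i ∈ I, ¬ T i) {S : Set (({i : Fin n // T i} → Obs 𝒳 𝒵) × (I → Obs 𝒳 𝒵))}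
    (hS : MeasurableSet S) {Good : Set ({i : Fin n // T i} → Obs 𝒳 𝒵)}
    (hG : MeasurableSet Good) {η : ENNReal}
    (h : ∀ t ∈ Good, P {ω | (t, fun i : I => W i ω) ∈ S} ≤ η) :
    P {ω | (subsample W T ω, fun i : I => W i ω) ∈ S} ≤
      P {ω | subsample W T ω ∉ Good} + η := by
  classical
  refine measure_le_of_indepFun (B := fun ω (i : I) => W i ω) ?_ (measurable_subsample hW T)
    (measurable_pi_lambda _ fun i => hW.measurable _) hS hG h
  have hind : iIndepFun (fun i : Fin n => W i) P := hW.indep.precomp Fin.val_injective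
  have hdis : Disjoint (Finset.univ.filter T) I := by
    rw [Finset.disjoint_left]
    intro i hi hI
    exact hTI i hI (Finset.mem_filter.1 hi).2
  have h2 := hind.indepFun_finset _ _ hdis fun i => hW.measurable i
  exact h2.comp (φ := fun y (i : {i : Fin n // T i}) => y ⟨i, by simp [i.2]⟩)
    (measurable_pi_lambda _ fun i => measurable_pi_apply _) measurable_id

lemma IsIIDSample.ae (hW : IsIIDSample M P W) {p : Obs 𝒳 𝒵 → Prop} (h : ∀ᵐ w ∂M.F, p w)
    (i : ℕ) : ∀ᵐ ω ∂P, p (W i ω) := by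
  rw [← hW.law i] at h
  exact ae_of_ae_map (hW.measurable i).aemeasurable h

lemma IsIIDSample.aemeasurable_comp (hW : IsIIDSample M P W) {f : Obs 𝒳 𝒵 → ℝ}
    (hf : AEMeasurable f M.F) (i : ℕ) : AEMeasurable (fun ω => f (W i ω)) P := by
  rw [← hW.law i] at hf
  exact hf.comp_measurable (hW.measurable i)

lemma IsIIDSample.integral_comp (hW : IsIIDSample M P W) {f : Obs 𝒳 𝒵 → ℝ}
    (hf : AEMeasurable f M.F) (i : ℕ) : ∫ ω, f (W i ω) ∂P = ∫ w, f w ∂M.F := by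
  have h := hf.aestronglyMeasurable
  rw [← hW.law i] at h ⊢
  rw [integral_map (hW.measurable i).aemeasurable h]

lemma IsIIDSample.memLp_comp (hW : IsIIDSample M P W) {f : Obs 𝒳 𝒵 → ℝ} {r : ENNReal}
    (hf : MemLp f r M.F) (i : ℕ) : MemLp (fun ω => f (W i ω)) r P := by
  rw [← hW.law i] at hf
  exact hf.comp_of_map (hW.measurable i).aemeasurable

lemma IsIIDSample.isProbabilityMeasure [IsProbabilityMeasure P] (hW : IsIIDSample M P W) : IsProbabilityMeasure M.F := by
  rw [← hW.law 0]
  exact Measure.isProbabilityMeasure_map (hW.measurable 0).aemeasurable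

/-- Hoeffding's lemma on `[-C, C]`, whose squared half-length is the variance proxy. -/
lemma IsIIDSample.hasSubgaussianMGF [IsProbabilityMeasure P] (hW : IsIIDSample M P W) {f : Obs 𝒳 𝒵 → ℝ}
    (hf : Measurable f) {C : ℝ} (hb : ∀ᵐ w ∂M.F, |f w| ≤ C) (i : ℕ) :
    HasSubgaussianMGF (fun ω => f (W i ω) - ∫ w, f w ∂M.F) (C.toNNReal ^ 2) P := by
  have h := hasSubgaussianMGF_of_mem_Icc (μ := P) (X := fun ω => f (W i ω)) (a := -C) (b := C)
    (hf.comp (hW.measurable i)).aemeasurable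
    ((hW.ae hb i).mono fun ω hω => abs_le.1 hω)
  rw [hW.integral_comp hf.aemeasurable] at h
  have hC : 0 ≤ C := by
    have := hW.isProbabilityMeasure
    obtain ⟨w, hw⟩ := hb.exists
    exact (abs_nonneg _).trans hw
  convert h using 2
  ext
  simp only [Real.coe_toNNReal', NNReal.coe_div, coe_nnnorm, Real.norm_eq_abs, NNReal.coe_ofNat]
  rw [max_eq_left hC, abs_of_nonneg (by linarith)]
  ring

/-- Hoeffding's inequality for a bounded function of the observations in `I`. -/
lemma IsIIDSample.hoeffding [IsProbabilityMeasure P] (hW : IsIIDSample M P W) {f : Obs 𝒳 𝒵 → ℝ} (hf : Measurable f)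
    {C : ℝ} (hC : 0 < C) (hb : ∀ᵐ w ∂M.F, |f w| ≤ C) {n : ℕ} (I : Finset (Fin n)) {u : ℝ}
    (hu : 0 ≤ u) :
    P {ω | u < |∑ i ∈ I, (f (W i ω) - ∫ w, f w ∂M.F)|} ≤
      ENNReal.ofReal (2 * Real.exp (-u ^ 2 / (2 * (n * C ^ 2)))) := by
  have key : ∀ g : Obs 𝒳 𝒵 → ℝ, Measurable g → (∀ᵐ w ∂M.F, |g w| ≤ C) →
      P {ω | u < ∑ i ∈ I, (g (W i ω) - ∫ w, g w ∂M.F)} ≤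
        ENNReal.ofReal (Real.exp (-u ^ 2 / (2 * (n * C ^ 2)))) := by
    intro g hg hgb
    -- The sharper exponent has `I.card` in its denominator, so the empty set is treated apart
    -- before `I.card` is replaced by `n`.
    rcases I.eq_empty_or_nonempty with rfl | hI
    · simp [not_lt.2 hu]
    have hind : iIndepFun (fun (i : Fin n) ω => g (W i ω) - ∫ w, g w ∂M.F) P :=
      (hW.indep.precomp (g := fun i : Fin n => (i : ℕ)) Fin.val_injective).comp
        (fun _ w => g w - ∫ w, g w ∂M.F) fun _ => hg.sub_const _
    have h := HasSubgaussianMGF.measure_sum_ge_le_of_iIndepFun hind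
      (c := fun _ => C.toNNReal ^ 2) (s := I)
      (fun i _ => hW.hasSubgaussianMGF hg hgb i) hu
    rw [← ofReal_measureReal]
    refine ENNReal.ofReal_le_ofReal ((measureReal_mono fun ω hω => ?_).trans (h.trans ?_))
    · simp only [Set.mem_ofPred_eq] at hω ⊢
      exact hω.le
    · have hcard : (I.card : ℝ) ≤ n := by
        exact_mod_cast (Finset.card_le_univ I).trans_eq (Fintype.card_fin n)
      have hpos : (0 : ℝ) < I.card := by exact_mod_cast hI.card_pos
      have hsum : ((∑ i ∈ I, C.toNNReal ^ 2 : NNReal) : ℝ) = I.card * C ^ 2 := by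
        simp [hC.le]
      rw [hsum]
      refine Real.exp_le_exp.2 ?_
      rw [neg_div, neg_div, neg_le_neg_iff]
      gcongr
  have h1 := key f hf hb
  have h2 := key (fun w => -f w) hf.neg (by simpa using hb)
  rw [two_mul, ENNReal.ofReal_add (by positivity) (by positivity)]
  refine (measure_mono fun ω hω => ?_).trans ((measure_union_le _ _).trans (add_le_add h1 h2))
  simp only [Set.mem_ofPred_eq, Set.mem_union, integral_neg] at hω ⊢
  rcases lt_abs.1 hω with h | h
  · exact Or.inl h
  · right
    rw [← Finset.sum_neg_distrib] at h
    refine h.trans_eq (Finset.sum_congr rfl fun i _ => by ring)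

lemma measurable_integral_uncurry {α β : Type*} [MeasurableSpace α] [MeasurableSpace β]
    {F : Measure β} [SFinite F] {f : α → β → ℝ} (hf : Measurable (Function.uncurry f)) :
    Measurable fun t => ∫ w, f t w ∂F :=
  (hf.stronglyMeasurable.integral_prod_right').measurable

/-- Uniform deviation bound for functions that depend on an independent subsample. -/
lemma crossfit_hoeffding [IsProbabilityMeasure P] (hW : IsIIDSample M P W) {n : ℕ} {T : Fin n → Prop}
    {I : Finset (Fin n)} (hTI : ∀ i ∈ I, ¬ T i) {J : Type*} [Fintype J]
    {f : J → ({i : Fin n // T i} → Obs 𝒳 𝒵) → Obs 𝒳 𝒵 → ℝ}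
    (hf : ∀ j, Measurable (Function.uncurry (f j)))
    {Good : Set ({i : Fin n // T i} → Obs 𝒳 𝒵)} (hG : MeasurableSet Good) {C : ℝ} (hC : 0 < C)
    (hb : ∀ t ∈ Good, ∀ j, ∀ᵐ w ∂M.F, |f j t w| ≤ C) {u : ℝ} (hu : 0 ≤ u) :
    P {ω | ¬ ∀ j, |∑ i ∈ I, (f j (subsample W T ω) (W i ω) -
        ∫ w, f j (subsample W T ω) w ∂M.F)| ≤ u} ≤
      P {ω | subsample W T ω ∉ Good} +
        ENNReal.ofReal (Fintype.card J * (2 * Real.exp (-u ^ 2 / (2 * (n * C ^ 2))))) := by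
  have := hW.isProbabilityMeasure
  let S : Set (({i : Fin n // T i} → Obs 𝒳 𝒵) × (I → Obs 𝒳 𝒵)) :=
    ⋃ j, {x | u < |∑ i : I, (f j x.1 (x.2 i) - ∫ w, f j x.1 w ∂M.F)|}
  have hS : MeasurableSet S := by
    refine MeasurableSet.iUnion fun j => measurableSet_lt measurable_const ?_
    refine Measurable.abs (Finset.measurable_sum _ fun i _ => Measurable.sub ?_ ?_)
    · exact (hf j).comp (measurable_fst.prodMk ((measurable_pi_apply i).comp measurable_snd))
    · exact (measurable_integral_uncurry (hf j)).comp measurable_fst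
  have hs : ∀ j t ω, ∑ i : I, (f j t (W i ω) - ∫ w, f j t w ∂M.F) =
      ∑ i ∈ I, (f j t (W i ω) - ∫ w, f j t w ∂M.F) := fun j t ω =>
    Finset.sum_coe_sort I fun i : Fin n => f j t (W i ω) - ∫ w, f j t w ∂M.F
  refine le_trans (le_of_eq ?_) (crossfit_le hW hTI hS hG fun t ht => ?_)
  · congr 1
    ext ω
    simp only [Set.mem_ofPred_eq, not_forall, not_le, S, Set.mem_iUnion, hs]
  · have h1 : {ω | (t, fun i : I => W i ω) ∈ S} ⊆
        ⋃ j, {ω | u < |∑ i ∈ I, (f j t (W i ω) - ∫ w, f j t w ∂M.F)|} := by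
      intro ω hω
      simp only [Set.mem_ofPred_eq, S, Set.mem_iUnion, hs] at hω ⊢
      exact hω
    refine (measure_mono h1).trans ((measure_iUnion_fintype_le _ _).trans ?_)
    refine (Finset.sum_le_sum fun j _ => hW.hoeffding
      ((hf j).comp measurable_prodMk_left) hC (hb t ht j) I hu).trans ?_
    rw [Finset.sum_const, nsmul_eq_mul, ENNReal.ofReal_mul (Nat.cast_nonneg _),
      ENNReal.ofReal_natCast]
    rfl

/-- Markov's inequality for functions that depend on an independent subsample. -/
lemma crossfit_markov [IsProbabilityMeasure P] (hW : IsIIDSample M P W) {n : ℕ} (hn : 0 < n) {T : Fin n → Prop}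
    {I : Finset (Fin n)} (hTI : ∀ i ∈ I, ¬ T i)
    {f : ({i : Fin n // T i} → Obs 𝒳 𝒵) → Obs 𝒳 𝒵 → ℝ}
    (hf : Measurable (Function.uncurry f)) (h0 : ∀ t w, 0 ≤ f t w)
    {Good : Set ({i : Fin n // T i} → Obs 𝒳 𝒵)} (hG : MeasurableSet Good) {δ : ℝ}
    (hb : ∀ t ∈ Good, ∫⁻ w, ENNReal.ofReal (f t w) ∂M.F ≤ ENNReal.ofReal δ) {u : ℝ} (hu : 0 < u) :
    P {ω | ¬ ∑ i ∈ I, f (subsample W T ω) (W i ω) ≤ u * n} ≤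
      P {ω | subsample W T ω ∉ Good} + ENNReal.ofReal (δ / u) := by
  let S : Set (({i : Fin n // T i} → Obs 𝒳 𝒵) × (I → Obs 𝒳 𝒵)) :=
    {x | u * n < ∑ i : I, f x.1 (x.2 i)}
  have hS : MeasurableSet S := by
    refine measurableSet_lt measurable_const (Finset.measurable_sum _ fun i _ => ?_)
    exact hf.comp (measurable_fst.prodMk ((measurable_pi_apply i).comp measurable_snd))
  refine le_trans (le_of_eq ?_) (crossfit_le hW hTI hS hG fun t ht => ?_)
  · congr 1
    ext ω
    simp only [Set.mem_ofPred_eq, not_le, S, Finset.univ_eq_attach, Finset.sum_attach I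
      fun i => f (subsample W T ω) (W i ω)]
  · have hn' : (0 : ℝ) < n := by exact_mod_cast hn
    have hft : Measurable (f t) := hf.comp measurable_prodMk_left
    have h1 : {ω | (t, fun i : I => W i ω) ∈ S} ⊆
        {ω | ENNReal.ofReal (u * n) ≤ ∑ i ∈ I, ENNReal.ofReal (f t (W i ω))} := by
      intro ω hω
      simp only [Set.mem_ofPred_eq, S, Finset.univ_eq_attach, Finset.sum_attach I
        fun i => f t (W i ω)] at hω ⊢
      rw [← ENNReal.ofReal_sum_of_nonneg fun i _ => h0 _ _]
      exact ENNReal.ofReal_le_ofReal hω.le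
    have hm : ∀ i : Fin n, Measurable fun ω => ENNReal.ofReal (f t (W i ω)) := fun i =>
      (hft.comp (hW.measurable i)).ennreal_ofReal
    refine (measure_mono h1).trans ((meas_ge_le_lintegral_div
      (Finset.measurable_sum _ fun i _ => hm i).aemeasurable
      (by simpa using mul_pos hu hn') ENNReal.ofReal_ne_top).trans ?_)
    rw [lintegral_finsetSum _ fun i _ => hm i]
    have h2 : ∀ i ∈ I, ∫⁻ ω, ENNReal.ofReal (f t (W i ω)) ∂P ≤ ENNReal.ofReal δ := by
      intro i _
      refine le_trans (le_of_eq ?_) (hb t ht)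
      rw [← hW.law i, lintegral_map hft.ennreal_ofReal (hW.measurable i)]
    have hcard : (I.card : ENNReal) ≤ n := by
      exact_mod_cast (Finset.card_le_univ I).trans_eq (Fintype.card_fin n)
    calc (∑ i ∈ I, ∫⁻ ω, ENNReal.ofReal (f t (W i ω)) ∂P) / ENNReal.ofReal (u * n)
        ≤ (n * ENNReal.ofReal δ) / ENNReal.ofReal (u * n) := by
          gcongr
          refine (Finset.sum_le_sum h2).trans ?_
          rw [Finset.sum_const, nsmul_eq_mul]
          gcongr
      _ = ENNReal.ofReal (n * δ) / ENNReal.ofReal (u * n) := by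
          rw [ENNReal.ofReal_mul hn'.le, ENNReal.ofReal_natCast]
      _ = ENNReal.ofReal (δ / u) := by
          rw [← ENNReal.ofReal_div_of_pos (mul_pos hu hn')]
          congr 1
          field_simp

/-- Chebyshev's inequality for functions that depend on an independent subsample. -/
lemma crossfit_chebyshev [IsProbabilityMeasure P] (hW : IsIIDSample M P W) {n : ℕ} (hn : 0 < n) {T : Fin n → Prop}
    {I : Finset (Fin n)} (hTI : ∀ i ∈ I, ¬ T i)
    {f : ({i : Fin n // T i} → Obs 𝒳 𝒵) → Obs 𝒳 𝒵 → ℝ}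
    (hf : Measurable (Function.uncurry f))
    {Good : Set ({i : Fin n // T i} → Obs 𝒳 𝒵)} (hG : MeasurableSet Good) {δ : ℝ}
    (hL2 : ∀ t ∈ Good, MemLp (f t) 2 M.F) (hb : ∀ t ∈ Good, ∫ w, f t w ^ 2 ∂M.F ≤ δ)
    {u : ℝ} (hu : 0 < u) :
    P {ω | ¬ |∑ i ∈ I, (f (subsample W T ω) (W i ω) - ∫ w, f (subsample W T ω) w ∂M.F)| ≤
        u * √n} ≤
      P {ω | subsample W T ω ∉ Good} + ENNReal.ofReal (δ / u ^ 2) := by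
  have := hW.isProbabilityMeasure
  let S : Set (({i : Fin n // T i} → Obs 𝒳 𝒵) × (I → Obs 𝒳 𝒵)) :=
    {x | u * √n < |∑ i : I, (f x.1 (x.2 i) - ∫ w, f x.1 w ∂M.F)|}
  have hS : MeasurableSet S := by
    refine measurableSet_lt measurable_const
      (Measurable.abs (Finset.measurable_sum _ fun i _ => Measurable.sub ?_ ?_))
    · exact hf.comp (measurable_fst.prodMk ((measurable_pi_apply i).comp measurable_snd))
    · exact (measurable_integral_uncurry hf).comp measurable_fst
  refine le_trans (le_of_eq ?_) (crossfit_le hW hTI hS hG fun t ht => ?_)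
  · congr 1
    ext ω
    simp only [Set.mem_ofPred_eq, not_le, S, Finset.univ_eq_attach, Finset.sum_attach I
      fun i => (f (subsample W T ω) (W i ω) - ∫ w, f (subsample W T ω) w ∂M.F)]
  · have hn' : (0 : ℝ) < n := by exact_mod_cast hn
    have hft : Measurable (f t) := hf.comp measurable_prodMk_left
    have hX : ∀ i : Fin n, MemLp (fun ω => f t (W i ω)) 2 P := fun i => hW.memLp_comp (hL2 t ht) i
    have hvar : ∀ i ∈ I, variance (fun ω => f t (W i ω)) P ≤ δ := by
      intro i _
      refine (variance_le_expectation_sq (hX i).1).trans ?_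
      refine le_trans (le_of_eq ?_) (hb t ht)
      exact hW.integral_comp (f := fun w => f t w ^ 2) (hft.pow_const 2).aemeasurable i
    have hδ : 0 ≤ δ := (integral_nonneg fun w => sq_nonneg _).trans (hb t ht)
    have hsum : variance (∑ i ∈ I, fun ω => f t (W i ω)) P ≤ n * δ := by
      rw [IndepFun.variance_sum (fun i _ => hX i)]
      · refine (Finset.sum_le_sum hvar).trans ?_
        rw [Finset.sum_const, nsmul_eq_mul]
        have hcard : (I.card : ℝ) ≤ n := by
          exact_mod_cast (Finset.card_le_univ I).trans_eq (Fintype.card_fin n)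
        gcongr
      · intro i _ j _ hij
        exact (hW.indep.indepFun (fun h => hij (Fin.ext h))).comp hft hft
    have hL : MemLp (∑ i ∈ I, fun ω => f t (W i ω)) 2 P := memLp_finsetSum' _ fun i _ => hX i
    have hcheb := meas_ge_le_variance_div_sq hL (c := u * √n) (by positivity)
    refine (measure_mono fun ω hω => ?_).trans (hcheb.trans (ENNReal.ofReal_le_ofReal ?_))
    · simp only [Set.mem_ofPred_eq, S, Finset.univ_eq_attach, Finset.sum_attach I
        fun i => (f t (W i ω) - ∫ w, f t w ∂M.F)] at hω ⊢
      have hint : ∫ ω, (∑ i ∈ I, fun ω => f t (W i ω)) ω ∂P = ∑ i ∈ I, ∫ w, f t w ∂M.F := by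
        simp only [Finset.sum_apply]
        rw [integral_finsetSum _ fun i _ => (hX i).integrable one_le_two]
        exact Finset.sum_congr rfl fun i _ => hW.integral_comp hft.aemeasurable i
      rw [hint, Finset.sum_apply, ← Finset.sum_sub_distrib]
      exact hω.le
    · rw [mul_pow, Real.sq_sqrt hn'.le, div_le_div_iff₀ (by positivity) (by positivity)]
      calc _ ≤ n * δ * u ^ 2 := by gcongr
        _ = _ := by ring

end Split

/-! ### Deterministic bounds for penalized GMM -/

section Deterministic

variable {p q : ℕ}

/-- The mean of the squared entries of `u` with weights `ω`. -/
def wms (ω u : Fin q → ℝ) : ℝ := (q : ℝ)⁻¹ * ∑ j, ω j * u j ^ 2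

/-- The `ℓ₁` norm. -/
def l1 (ρ : Fin p → ℝ) : ℝ := ∑ k, |ρ k|

lemma l1_nonneg (ρ : Fin p → ℝ) : 0 ≤ l1 ρ := Finset.sum_nonneg fun _ _ => abs_nonneg _

lemma l1_add_le (u v : Fin p → ℝ) : l1 (u + v) ≤ l1 u + l1 v := by
  rw [l1, l1, l1, ← Finset.sum_add_distrib]
  exact Finset.sum_le_sum fun k _ => abs_add_le _ _

lemma l1_split (S : Finset (Fin p)) (u : Fin p → ℝ) :
    l1 u = ∑ k ∈ S, |u k| + ∑ k ∈ Sᶜ, |u k| := (Finset.sum_add_sum_compl S _).symm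

lemma l1_sub_comm (u v : Fin p → ℝ) : l1 (u - v) = l1 (v - u) := by
  simp only [l1, Pi.sub_apply, abs_sub_comm]

lemma l1_sub_le (u v w : Fin p → ℝ) : l1 (u - w) ≤ l1 (u - v) + l1 (v - w) := by
  simpa using l1_add_le (u - v) (v - w)

lemma l1_le_add (u v : Fin p → ℝ) : l1 u ≤ l1 (u - v) + l1 v := by
  simpa using l1_add_le (u - v) v

lemma abs_sum_mul_le {a ρ : Fin p → ℝ} {C : ℝ} (ha : ∀ k, |a k| ≤ C) :
    |∑ k, a k * ρ k| ≤ C * l1 ρ := by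
  refine (Finset.abs_sum_le_sum_abs _ _).trans ?_
  rw [l1, Finset.mul_sum]
  refine Finset.sum_le_sum fun k _ => ?_
  rw [abs_mul]
  exact mul_le_mul_of_nonneg_right (ha k) (abs_nonneg _)

lemma dotProduct_diagonal_smul (ω u : Fin q → ℝ) :
    u ⬝ᵥ (((q : ℝ)⁻¹ • Matrix.diagonal ω) *ᵥ u) = wms ω u := by
  rw [wms, Matrix.smul_mulVec, dotProduct_smul, smul_eq_mul]
  simp only [dotProduct, Matrix.mulVec_diagonal]
  congr 1
  exact Finset.sum_congr rfl fun j _ => by ring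

lemma pgmmObj_diagonal (ω : Fin q → ℝ) (M : Fin q → ℝ) (G : Matrix (Fin q) (Fin p) ℝ) (lam : ℝ)
    (ρ : Fin p → ℝ) :
    pgmmObj (Matrix.diagonal ω) M G lam ρ = wms ω (M - G *ᵥ ρ) + 2 * lam * l1 ρ := by
  rw [pgmmObj, dotProduct_diagonal_smul, l1]

lemma gram_diagonal (ω : Fin q → ℝ) (G : Matrix (Fin q) (Fin p) ℝ) (δ : Fin p → ℝ) :
    δ ⬝ᵥ (gram (Matrix.diagonal ω) G *ᵥ δ) = wms ω (G *ᵥ δ) := by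
  rw [gram, ← Matrix.mulVec_mulVec, ← Matrix.mulVec_mulVec, Matrix.dotProduct_mulVec,
    Matrix.vecMul_transpose, dotProduct_diagonal_smul]

lemma one_eq_diagonal : (1 : Matrix (Fin q) (Fin q) ℝ) = Matrix.diagonal fun _ => 1 :=
  Matrix.diagonal_one.symm

lemma wms_mono {ω ω' u u' : Fin q → ℝ} (h : ∀ j, ω j * u j ^ 2 ≤ ω' j * u' j ^ 2) :
    wms ω u ≤ wms ω' u' :=
  mul_le_mul_of_nonneg_left (Finset.sum_le_sum fun j _ => h j) (by positivity)

lemma wms_const_mul (a : ℝ) (ω u : Fin q → ℝ) : wms (fun j => a * ω j) u = a * wms ω u := by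
  simp only [wms, mul_assoc, ← Finset.mul_sum]
  ring

lemma wms_nonneg {ω u : Fin q → ℝ} (h : ∀ j, 0 ≤ ω j) : 0 ≤ wms ω u :=
  mul_nonneg (by positivity) (Finset.sum_nonneg fun j _ => mul_nonneg (h j) (sq_nonneg _))

lemma wms_one_const (hq : 0 < q) (e : ℝ) : wms (fun _ : Fin q => 1) (fun _ => e) = e ^ 2 := by
  have : (q : ℝ) ≠ 0 := by positivity
  simp [wms, this]

/-- Thanks to the factor `1 / q` in the criterion, a uniform bound on `q` moments costs no power of
`q`. -/
lemma wms_one_le (hq : 0 < q) {u : Fin q → ℝ} {e : ℝ} (hu : ∀ j, |u j| ≤ e) :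
    wms (fun _ => 1) u ≤ e ^ 2 := by
  rw [← wms_one_const hq]
  exact wms_mono fun j => by
    rw [one_mul, one_mul]
    exact sq_le_sq' (abs_le.1 (hu j)).1 (abs_le.1 (hu j)).2

lemma wms_add_le {ω u v : Fin q → ℝ} (h : ∀ j, 0 ≤ ω j) :
    wms ω (u + v) ≤ 2 * wms ω u + 2 * wms ω v := by
  rw [wms, wms, wms, ← mul_assoc, ← mul_assoc, mul_comm 2, mul_assoc, mul_assoc, ← mul_add]
  refine mul_le_mul_of_nonneg_left ?_ (by positivity)
  rw [Finset.mul_sum, Finset.mul_sum, ← Finset.sum_add_distrib]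
  refine Finset.sum_le_sum fun j _ => ?_
  have := mul_nonneg (h j) (sq_nonneg (u j - v j))
  simp only [Pi.add_apply]
  nlinarith

/-- `|r - u|² ≥ |u|²/2 - |r|²` in the weighted mean square. -/
lemma wms_sub_ge {ω r u : Fin q → ℝ} (h : ∀ j, 0 ≤ ω j) :
    wms ω u / 2 - wms ω r ≤ wms ω (r - u) := by
  have h1 := wms_add_le (u := r) (v := u - r) h
  have h2 : wms ω (u - r) = wms ω (r - u) := by
    simp only [wms, Pi.sub_apply, sub_sq_comm]
  rw [add_sub_cancel, h2] at h1
  linarith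

lemma abs_mulVec_le {A : Matrix (Fin q) (Fin p) ℝ} {g : ℝ} (hA : ∀ j k, |A j k| ≤ g)
    (δ : Fin p → ℝ) (j : Fin q) : |(A *ᵥ δ) j| ≤ g * l1 δ :=
  abs_sum_mul_le (hA j)

/-- The penalty at `ρ` against the penalty at a vector supported on `S`. -/
lemma l1_sub_l1_le {S : Finset (Fin p)} {ρ ρ₀ : Fin p → ℝ} (h : ∀ k ∉ S, ρ₀ k = 0) :
    l1 ρ₀ - l1 ρ ≤ ∑ k ∈ S, |(ρ - ρ₀) k| - ∑ k ∈ Sᶜ, |(ρ - ρ₀) k| := by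
  have h2 : ∑ k ∈ Sᶜ, |(ρ - ρ₀) k| = ∑ k ∈ Sᶜ, |ρ k| :=
    Finset.sum_congr rfl fun k hk => by simp [h k (Finset.mem_compl.1 hk)]
  have h3 : ∑ k ∈ Sᶜ, |ρ₀ k| = 0 :=
    Finset.sum_eq_zero fun k hk => by simp [h k (Finset.mem_compl.1 hk)]
  have h4 : ∑ k ∈ S, |ρ₀ k| ≤ ∑ k ∈ S, |(ρ - ρ₀) k| + ∑ k ∈ S, |ρ k| := by
    rw [← Finset.sum_add_distrib]
    refine Finset.sum_le_sum fun k _ => ?_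
    have := abs_sub_abs_le_abs_sub (ρ₀ k) (ρ k)
    rw [abs_sub_comm] at this
    simp only [Pi.sub_apply]
    linarith
  rw [l1_split S ρ₀, l1_split S ρ, h2, h3]
  linarith

/-- Restricted eigenvalue bound for the `ℓ₁` norm on the support. -/
lemma sq_sum_abs_le {S : Finset (Fin p)} {s : ℕ} (hS : S.card ≤ s) (δ : Fin p → ℝ) :
    (∑ k ∈ S, |δ k|) ^ 2 ≤ s * ∑ k ∈ S, δ k ^ 2 := by
  have h := sq_sum_le_card_mul_sum_sq (s := S) (f := fun k => |δ k|)
  simp only [sq_abs] at h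
  refine h.trans (mul_le_mul_of_nonneg_right (by exact_mod_cast hS)
    (Finset.sum_nonneg fun _ _ => sq_nonneg _))

/-- If the bound fails then `y ≤ x`, because the constant is at least one; the right side is then at
most `(K₁ K₂ + K₁) y x`, which is less than `x²`. -/
lemma le_mul_of_sq_le {x K₁ K₂ y : ℝ} (h1 : 0 ≤ K₁) (h2 : 0 ≤ K₂) (hy : 0 ≤ y)
    (h : x ^ 2 ≤ K₁ * y * (K₂ * y + x)) : x ≤ (K₁ + K₁ * K₂ + 1) * y := by
  by_contra! hx
  have hC : 1 ≤ K₁ + K₁ * K₂ + 1 := by nlinarith [mul_nonneg h1 h2]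
  have hxy : y ≤ x := by nlinarith
  have hx0 : 0 < x := by
    rcases hy.eq_or_lt with h0 | h0
    · simpa [← h0] using hx
    · linarith
  have : x ^ 2 ≤ (K₁ * K₂ + K₁) * y * x := by
    nlinarith [mul_nonneg h1 h2, mul_nonneg (mul_nonneg (mul_nonneg h1 h2) hy) (sub_nonneg.2 hxy)]
  nlinarith

/-- The constant of the `ℓ₁` rate. -/
def rateConst (a B c E : ℝ) : ℝ :=
  -- The first summand serves errors in the cone: `4 = 1 + 3` from the cone, times the constant of
  -- `le_mul_of_sq_le` at `K₁ = 16 / (c a)`, `K₂ = B E²`. The second serves errors outside it.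
  4 * (16 / (c * a) + 16 / (c * a) * (B * E ^ 2) + 1) + 2 * B * E ^ 2

lemma rateConst_nonneg {a B c E : ℝ} (ha : 0 < a) (hB : 0 ≤ B) (hc : 0 < c) :
    0 ≤ rateConst a B c E := by
  unfold rateConst
  positivity

/-- Rate of a penalized GMM estimate with diagonal weights between `a` and `B`, from a restricted
eigenvalue condition on a nearby moment matrix. -/
lemma pgmm_rate (hq : 0 < q) {s : ℕ} (hs : 1 ≤ s) {ω Mh : Fin q → ℝ}
    {G Gh : Matrix (Fin q) (Fin p) ℝ} {ρ ρ₀ : Fin p → ℝ} {a B c E g lam : ℝ} (ha : 0 < a)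
    (hω : ∀ j, a ≤ ω j ∧ ω j ≤ B) (hc : 0 < c)
    (hRE : RestrictedEigenvalue (gram 1 G) s c) (hlam : 0 < lam)
    (hG : ∀ j k, |Gh j k - G j k| ≤ g) (hgs : 64 * g ^ 2 * s ≤ c)
    (hM : ∀ j, |Mh j - (Gh *ᵥ ρ₀) j| ≤ E * (√s * lam)) (hcard : (supp ρ₀).card ≤ s)
    (hmin : IsMinOn (pgmmObj (Matrix.diagonal ω) Mh Gh lam) Set.univ ρ) :
    l1 (ρ - ρ₀) ≤ rateConst a B c E * (s * lam) ∧
      wms ω (Gh *ᵥ (ρ - ρ₀)) ≤ (4 * B * E ^ 2 + 4 * rateConst a B c E) * (s * lam ^ 2) := by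
  have hω0 : ∀ j, 0 ≤ ω j := fun j => ha.le.trans (hω j).1
  have hB : 0 ≤ B := (hω0 ⟨0, hq⟩).trans (hω ⟨0, hq⟩).2
  set S := supp ρ₀ with hS
  set δ := ρ - ρ₀ with hδ
  set T := wms ω (Gh *ᵥ δ) with hT
  set x := ∑ k ∈ S, |δ k| with hx
  set z := ∑ k ∈ Sᶜ, |δ k| with hz
  have hx0 : 0 ≤ x := Finset.sum_nonneg fun _ _ => abs_nonneg _
  have hz0 : 0 ≤ z := Finset.sum_nonneg fun _ _ => abs_nonneg _
  have hT0 : 0 ≤ T := wms_nonneg hω0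
  have hsplit : l1 δ = x + z := l1_split S δ
  have hs0 : (1 : ℝ) ≤ s := by exact_mod_cast hs
  have hr : wms ω (Mh - Gh *ᵥ ρ₀) ≤ B * E ^ 2 * (s * lam ^ 2) := by
    calc wms ω (Mh - Gh *ᵥ ρ₀) ≤ wms (fun _ => B * 1) (Mh - Gh *ᵥ ρ₀) :=
          wms_mono fun j => mul_le_mul_of_nonneg_right ((hω j).2.trans_eq (mul_one B).symm)
            (sq_nonneg _)
      _ = B * wms (fun _ => 1) (Mh - Gh *ᵥ ρ₀) := wms_const_mul B (fun _ => 1) _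
      _ ≤ B * (E * (√s * lam)) ^ 2 := mul_le_mul_of_nonneg_left (wms_one_le hq hM) hB
      _ = B * E ^ 2 * (s * lam ^ 2) := by
          rw [mul_pow, mul_pow, Real.sq_sqrt (by linarith)]
          ring
  -- Basic inequality. The cross term is absorbed into half of `T` by `wms_sub_ge`, not played
  -- against the penalty, so `lam` need not dominate the moments at `ρ₀`.
  have hbasic : T / 2 ≤ 2 * (B * E ^ 2 * (s * lam ^ 2)) + 2 * lam * (x - z) := by
    have h1 : pgmmObj (Matrix.diagonal ω) Mh Gh lam ρ ≤
        pgmmObj (Matrix.diagonal ω) Mh Gh lam ρ₀ := isMinOn_iff.1 hmin ρ₀ (Set.mem_univ _)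
    rw [pgmmObj_diagonal, pgmmObj_diagonal] at h1
    have h2 : Mh - Gh *ᵥ ρ = (Mh - Gh *ᵥ ρ₀) - Gh *ᵥ δ := by
      rw [hδ, Matrix.mulVec_sub]
      abel
    have h3 := wms_sub_ge (r := Mh - Gh *ᵥ ρ₀) (u := Gh *ᵥ δ) hω0
    rw [← h2, ← hT] at h3
    have h4 : l1 ρ₀ - l1 ρ ≤ x - z := l1_sub_l1_le fun k hk => by
      simpa [hS, supp] using hk
    have h5 := mul_le_mul_of_nonneg_left h4 (by linarith : 0 ≤ 2 * lam)
    linarith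
  have hl1 : l1 δ ≤ rateConst a B c E * (s * lam) := by
    have hBE : 0 ≤ B * E ^ 2 := by positivity
    have hsl : 0 < s * lam := by positivity
    unfold rateConst
    -- In the cone the restricted eigenvalue applies. Outside it `x - z ≤ -(x + z) / 2`, so the
    -- basic inequality alone bounds the `ℓ₁` norm.
    by_cases hcone : z ≤ 3 * x
    · have hre := hRE S hcard δ hcone
      rw [one_eq_diagonal, gram_diagonal] at hre
      -- The restricted eigenvalue is known for `G`, the criterion controls `Gh`: the entrywise gap
      -- `g` costs `g` times `l1 δ`, at most `4 x` in the cone, and weights at least `a` cost `1 /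
      -- a`.
      have h1 : wms (fun _ => 1) (G *ᵥ δ) ≤ 2 * (T / a) + 2 * (g * (4 * x)) ^ 2 := by
        have h2 : G *ᵥ δ = Gh *ᵥ δ + (G - Gh) *ᵥ δ := by
          rw [Matrix.sub_mulVec]
          abel
        rw [h2]
        refine (wms_add_le fun _ => zero_le_one).trans (add_le_add ?_ ?_)
        · refine mul_le_mul_of_nonneg_left ?_ zero_le_two
          rw [le_div_iff₀ ha, mul_comm, ← wms_const_mul]
          exact wms_mono fun j => mul_le_mul_of_nonneg_right (by linarith [(hω j).1])
            (sq_nonneg _)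
        · refine mul_le_mul_of_nonneg_left (wms_one_le hq fun j => ?_) zero_le_two
          have hg : ∀ j k, |(G - Gh) j k| ≤ g := fun j k => by
            rw [Matrix.sub_apply, abs_sub_comm]
            exact hG j k
          -- With no columns there is no entry from which `0 ≤ g` could be read off, but then `δ` is
          -- empty.
          rcases Nat.eq_zero_or_pos p with hp | hp
          · subst hp
            simp [Matrix.mulVec, dotProduct, hx, Finset.eq_empty_of_isEmpty S]
          · have hg0 : 0 ≤ g := (abs_nonneg _).trans (hG ⟨0, hq⟩ ⟨0, hp⟩)
            refine (abs_mulVec_le hg δ j).trans (mul_le_mul_of_nonneg_left ?_ hg0)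
            linarith
      have h2 : x ^ 2 ≤ s * ∑ k ∈ S, δ k ^ 2 := sq_sum_abs_le hcard δ
      have h3 : c * x ^ 2 ≤ s * (2 * (T / a) + 2 * (g * (4 * x)) ^ 2) := by
        calc c * x ^ 2 ≤ c * (s * ∑ k ∈ S, δ k ^ 2) := mul_le_mul_of_nonneg_left h2 hc.le
          _ = s * (c * ∑ k ∈ S, δ k ^ 2) := by ring
          _ ≤ _ := mul_le_mul_of_nonneg_left (hre.trans h1) (by linarith)
      -- The perturbation term is `32 s g² x²`; the bound `64 g² s ≤ c` makes it at most half of the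
      -- left side.
      have h4 : c * x ^ 2 ≤ 4 * s * (T / a) := by
        nlinarith [mul_le_mul_of_nonneg_right hgs (sq_nonneg x)]
      have h5 : T ≤ 4 * (B * E ^ 2 * (s * lam ^ 2) + lam * x) := by
        nlinarith [mul_nonneg hlam.le hz0]
      have h6 : x ^ 2 ≤ 16 / (c * a) * (s * lam) * (B * E ^ 2 * (s * lam) + x) := by
        have h7 : c * a * x ^ 2 ≤ 4 * s * T := by
          have := mul_le_mul_of_nonneg_left h4 ha.le
          have e : a * (4 * s * (T / a)) = 4 * s * T := by field_simp
          rw [e] at this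
          linarith
        have h8 : 4 * s * T ≤ 16 * (s * lam) * (B * E ^ 2 * (s * lam) + x) := by
          have := mul_le_mul_of_nonneg_left h5 (by linarith : (0 : ℝ) ≤ 4 * s)
          linarith
        have hca : 0 < c * a := mul_pos hc ha
        rw [div_mul_eq_mul_div, div_mul_eq_mul_div, le_div_iff₀ hca]
        linarith
      have h7 := le_mul_of_sq_le (by positivity) hBE hsl.le h6
      rw [hsplit]
      have h8 : 0 ≤ 2 * B * E ^ 2 * (s * lam) := by positivity
      nlinarith
    · have h1 : lam * (l1 δ) ≤ 2 * (B * E ^ 2 * (s * lam ^ 2)) := by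
        rw [hsplit]
        nlinarith [mul_pos hlam (sub_pos.2 (not_le.1 hcone))]
      have h2 : l1 δ ≤ 2 * B * E ^ 2 * (s * lam) := by
        refine le_of_mul_le_mul_left (h1.trans_eq ?_) hlam
        ring
      have h3 : 0 ≤ 4 * (16 / (c * a) + 16 / (c * a) * (B * E ^ 2) + 1) * (s * lam) := by
        positivity
      linarith
  refine ⟨hl1, ?_⟩
  have h1 : x - z ≤ l1 δ := by linarith
  have h2 := mul_le_mul_of_nonneg_left (h1.trans hl1) (by linarith : 0 ≤ 4 * lam)
  nlinarith

/-- The distance of the population target from `ρ₀`. -/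
lemma sparseObj_rate {s : ℕ} {G : Matrix (Fin q) (Fin p) ℝ} {ρL ρ₀ v : Fin p → ℝ}
    {c K ε : ℝ} (hc : 0 < c) (hK : 0 ≤ K) (hRE : RestrictedEigenvalue (gram 1 G) s c)
    (hε : 0 < ε) (hcard : (supp ρ₀).card ≤ s)
    (hL : wms (fun _ => 1) (G *ᵥ (ρL - ρ₀)) ≤ K * (s * ε ^ 2))
    (hmin : IsMinOn (sparseObj (gram 1 G) ρL ε (supp ρ₀)) Set.univ v) :
    l1 (v - ρ₀) ≤ 4 * (K + √(4 * K / c)) * (s * ε) := by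
  set S := supp ρ₀ with hS
  set δ := v - ρ₀ with hδ
  have h0 : ∀ k ∈ Sᶜ, ρ₀ k = 0 := fun k hk => by simpa [hS, supp] using hk
  have h1 : sparseObj (gram 1 G) ρL ε S v ≤ sparseObj (gram 1 G) ρL ε S ρ₀ :=
    isMinOn_iff.1 hmin ρ₀ (Set.mem_univ _)
  have h3 : ∑ k ∈ Sᶜ, |ρ₀ k| = 0 := Finset.sum_eq_zero fun k hk => by rw [h0 k hk, abs_zero]
  unfold sparseObj at h1
  rw [one_eq_diagonal, gram_diagonal, gram_diagonal, h3] at h1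
  have h2 : ∑ k ∈ Sᶜ, |δ k| = ∑ k ∈ Sᶜ, |v k| :=
    Finset.sum_congr rfl fun k hk => by simp [hδ, h0 k hk]
  rw [← h2, mul_zero, add_zero] at h1
  set x := ∑ k ∈ S, |δ k| with hx
  set z := ∑ k ∈ Sᶜ, |δ k| with hz
  have hx0 : 0 ≤ x := Finset.sum_nonneg fun _ _ => abs_nonneg _
  have hz0 : 0 ≤ z := Finset.sum_nonneg fun _ _ => abs_nonneg _
  have hw0 : 0 ≤ wms (fun _ => 1) (G *ᵥ (ρL - v)) := wms_nonneg fun _ => zero_le_one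
  -- The penalty vanishes at `ρ₀`, so optimality bounds the mass off the support directly.
  have hz1 : z ≤ K * (s * ε) := by
    have : ε * (2 * z) ≤ ε * (K * (s * ε)) := by nlinarith
    have := le_of_mul_le_mul_left this hε
    linarith
  have hsplit : l1 δ = x + z := l1_split S δ
  have hsq : 0 ≤ √(4 * K / c) * (s * ε) := by positivity
  have hKs : 0 ≤ K * (s * ε) := by positivity
  rw [hsplit]
  -- In the cone, the restricted eigenvalue and the triangle inequality through `ρL` bound `x`.
  -- Outside it `x` is less than a third of `z`, which is already bounded.
  by_cases hcone : z ≤ 3 * x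
  · have hre := hRE S hcard δ hcone
    rw [one_eq_diagonal, gram_diagonal] at hre
    have h3 : wms (fun _ => 1) (G *ᵥ δ) ≤ 4 * K * (s * ε ^ 2) := by
      have h4 : G *ᵥ δ = -(G *ᵥ (ρL - v)) + G *ᵥ (ρL - ρ₀) := by
        rw [hδ, Matrix.mulVec_sub, Matrix.mulVec_sub, Matrix.mulVec_sub]
        abel
      have h5 : wms (fun _ => 1) (-(G *ᵥ (ρL - v))) = wms (fun _ => 1) (G *ᵥ (ρL - v)) := by
        simp [wms]
      have h6 := wms_add_le (u := -(G *ᵥ (ρL - v))) (v := G *ᵥ (ρL - ρ₀))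
        (ω := fun _ => 1) fun _ => zero_le_one
      rw [← h4, h5] at h6
      nlinarith [mul_nonneg hε.le hz0]
    have h4 : x ^ 2 ≤ s * ∑ k ∈ S, δ k ^ 2 := sq_sum_abs_le hcard δ
    have h5 : x ^ 2 ≤ 4 * K / c * (s * ε) ^ 2 := by
      rw [div_mul_eq_mul_div, le_div_iff₀ hc]
      calc x ^ 2 * c ≤ (s * ∑ k ∈ S, δ k ^ 2) * c := mul_le_mul_of_nonneg_right h4 hc.le
        _ = s * (c * ∑ k ∈ S, δ k ^ 2) := by ring
        _ ≤ s * (4 * K * (s * ε ^ 2)) :=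
            mul_le_mul_of_nonneg_left (hre.trans h3) (Nat.cast_nonneg _)
        _ = _ := by ring
    have h6 : x ≤ √(4 * K / c) * (s * ε) := by
      refine abs_le_of_sq_le_sq' ?_ hsq |>.2
      rw [mul_pow, Real.sq_sqrt (by positivity)]
      exact h5
    nlinarith
  · nlinarith

/-- A restricted eigenvalue condition for weights at most `1 / v` gives one for unit weights. -/
lemma RestrictedEigenvalue.one_of_diagonal {ω : Fin q → ℝ} {G : Matrix (Fin q) (Fin p) ℝ} {s : ℕ}
    {c v : ℝ} (hv : 0 < v) (hω : ∀ j, ω j ≤ v⁻¹)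
    (h : RestrictedEigenvalue (gram (Matrix.diagonal ω) G) s c) :
    RestrictedEigenvalue (gram 1 G) s (v * c) := by
  intro S hS δ hδ
  have h1 := h S hS δ hδ
  rw [gram_diagonal] at h1
  rw [one_eq_diagonal, gram_diagonal, mul_assoc]
  refine (mul_le_mul_of_nonneg_left h1 hv.le).trans ?_
  rw [← wms_const_mul]
  refine wms_mono fun j => mul_le_mul_of_nonneg_right ?_ (sq_nonneg _)
  calc v * ω j ≤ v * v⁻¹ := mul_le_mul_of_nonneg_left (hω j) hv.le
    _ = 1 := mul_inv_cancel₀ hv.ne'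

end Deterministic

/-! ### Rates -/

section Rates

variable {q s : ℕ → ℕ} {κ lam : ℕ → ℝ}

lemma eventually_const_mul_le (hlam : ∀ n, 0 < lam n) (h : κ =o[atTop] lam) (K : ℝ) {g : ℝ}
    (hg : 0 < g) : ∀ᶠ n in atTop, K * κ n ≤ g * lam n := by
  have h' := isLittleO_iff.1 h (c := g / (|K| + 1)) (by positivity)
  filter_upwards [h'] with n hn
  rw [Real.norm_eq_abs, Real.norm_eq_abs, abs_of_pos (hlam n), div_mul_eq_mul_div,
    le_div_iff₀ (by positivity)] at hn
  calc K * κ n ≤ |K| * |κ n| := by rw [← abs_mul]; exact le_abs_self _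
    _ ≤ |κ n| * (|K| + 1) := by nlinarith [abs_nonneg (κ n)]
    _ ≤ _ := hn

/-- Pays for union bounds over up to `q²` averages. Since `log q = o(n·lam²)`, half of the exponent
absorbs `q²`; the other half diverges because `log q ≥ log 2 > 0`, which is where `2 ≤ q` enters. -/
lemma tendsto_sq_mul_exp (hq : ∀ n, 2 ≤ q n) (hlam : ∀ n, 0 < lam n)
    (h1 : (fun n : ℕ => √(Real.log (q n) / n)) =O[atTop] κ) (h2 : κ =o[atTop] lam)
    {c : ℝ} (hc : 0 < c) :
    Tendsto (fun n : ℕ => (q n : ℝ) ^ 2 * Real.exp (-(c * (n * lam n ^ 2)))) atTop (𝓝 0) := by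
  have h3 := h1.trans_isLittleO h2
  have key : ∀ R : ℝ, 0 < R → ∀ᶠ n : ℕ in atTop, R * Real.log (q n) ≤ n * lam n ^ 2 := by
    intro R hR
    filter_upwards [isLittleO_iff.1 h3 (c := √R⁻¹) (by positivity), eventually_gt_atTop 0]
      with n hn hn0
    have hn0' : (0 : ℝ) < n := by exact_mod_cast hn0
    have hlog : 0 ≤ Real.log (q n) := Real.log_natCast_nonneg _
    rw [Real.norm_eq_abs, Real.norm_eq_abs, abs_of_pos (hlam n),
      abs_of_nonneg (Real.sqrt_nonneg _)] at hn
    have h4 := pow_le_pow_left₀ (Real.sqrt_nonneg _) hn 2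
    rw [mul_pow, Real.sq_sqrt (by positivity), Real.sq_sqrt (by positivity),
      div_le_iff₀ hn0'] at h4
    calc R * Real.log (q n) ≤ R * (R⁻¹ * lam n ^ 2 * n) := by gcongr
      _ = n * lam n ^ 2 := by field_simp
  have hlog2 : ∀ n, Real.log 2 ≤ Real.log (q n) := fun n =>
    Real.log_le_log two_pos (by exact_mod_cast hq n)
  have htop : Tendsto (fun n : ℕ => (n : ℝ) * lam n ^ 2) atTop atTop := by
    refine tendsto_atTop.2 fun R => ?_
    have hl := Real.log_pos one_lt_two
    filter_upwards [key ((|R| + 1) / Real.log 2) (by positivity)] with n hn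
    refine le_trans ?_ hn
    calc R ≤ |R| + 1 := by linarith [le_abs_self R]
      _ = (|R| + 1) / Real.log 2 * Real.log 2 := by field_simp
      _ ≤ _ := by gcongr; exact_mod_cast hq n
  have h5 : Tendsto (fun n : ℕ => Real.exp (-(c / 2 * (n * lam n ^ 2)))) atTop (𝓝 0) :=
    Real.tendsto_exp_neg_atTop_nhds_zero.comp (htop.const_mul_atTop (by positivity))
  refine tendsto_of_tendsto_of_tendsto_of_le_of_le' tendsto_const_nhds h5
    (Eventually.of_forall fun n => by positivity) ?_
  filter_upwards [key (4 / c) (by positivity)] with n hn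
  have hq0 : (0 : ℝ) < q n := by exact_mod_cast (hq n).trans_lt' two_pos
  have h6 : (q n : ℝ) ^ 2 = Real.exp (2 * Real.log (q n)) := by
    rw [two_mul, Real.exp_add, Real.exp_log hq0, sq]
  rw [h6, ← Real.exp_add]
  refine Real.exp_le_exp.2 ?_
  rw [div_mul_eq_mul_div, div_le_iff₀ hc] at hn
  linarith

lemma tendsto_zero_of_sq_mul (hs : ∀ n, 1 ≤ s n) (hlam : ∀ n, 0 < lam n)
    (h : Tendsto (fun n => (s n : ℝ) ^ 2 * lam n) atTop (𝓝 0)) :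
    Tendsto (fun n => (s n : ℝ) * lam n) atTop (𝓝 0) ∧ Tendsto lam atTop (𝓝 0) := by
  have hs' : ∀ n, (1 : ℝ) ≤ s n := fun n => by exact_mod_cast hs n
  constructor
  · refine squeeze_zero (fun n => mul_nonneg (Nat.cast_nonneg _) (hlam n).le) (fun n => ?_) h
    exact mul_le_mul_of_nonneg_right (by nlinarith [hs' n]) (hlam n).le
  · refine squeeze_zero (fun n => (hlam n).le) (fun n => ?_) h
    exact le_mul_of_one_le_left (hlam n).le (by nlinarith [hs' n])

end Rates

/-! ### Mean square norms -/

section MeanSquare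

variable {α : Type*} [MeasurableSpace α] {μ : Measure α}

lemma abs_integral_mul_le {f g : α → ℝ} (hf : MemLp f 2 μ) (hg : MemLp g 2 μ) :
    |∫ w, f w * g w ∂μ| ≤ √(∫ w, f w ^ 2 ∂μ) * √(∫ w, g w ^ 2 ∂μ) := by
  have h := integral_mul_norm_le_Lp_mul_Lq (μ := μ) (f := f) (g := g) (p := 2) (q := 2)
    Real.HolderConjugate.two_two (by simpa using hf) (by simpa using hg)
  simp only [Real.rpow_two, Real.norm_eq_abs, sq_abs, ← Real.sqrt_eq_rpow] at h
  refine (abs_integral_le_integral_abs).trans (le_trans (le_of_eq ?_) h)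
  exact integral_congr_ae (ae_of_all _ fun w => abs_mul _ _)

variable {𝒳 𝒵 : Type*} [MeasurableSpace 𝒳] [MeasurableSpace 𝒵] {M : Model 𝒳 𝒵}

lemma Model.normX_nonneg (γ : 𝒳 → ℝ) : 0 ≤ M.normX γ := Real.sqrt_nonneg _

lemma Model.sq_normX (γ : 𝒳 → ℝ) : M.normX γ ^ 2 = ∫ w, γ w.2.1 ^ 2 ∂M.F :=
  Real.sq_sqrt (integral_nonneg fun _ => sq_nonneg _)

lemma Model.normX_zero : M.normX 0 = 0 := by simp [Model.normX]

/-- Makes closeness of an estimate to `γ₀` a measurable condition on its training data. -/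
lemma Model.IsNPIV.measurable_normX (hM : M.IsNPIV) {g : α → 𝒳 → ℝ}
    (hg : Measurable (Function.uncurry g)) : Measurable fun t => M.normX (g t - M.γ₀) := by
  have := hM.prob
  refine Measurable.sqrt (measurable_integral_uncurry (f := fun t (w : Obs 𝒳 𝒵) =>
    (g t - M.γ₀) w.2.1 ^ 2) ?_)
  have h1 : Measurable fun x : α × Obs 𝒳 𝒵 => g x.1 x.2.2.1 :=
    hg.comp (measurable_fst.prodMk (measurable_snd.snd.fst))
  have h2 : Measurable fun x : α × Obs 𝒳 𝒵 => M.γ₀ x.2.2.1 :=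
    (hM.measurable_Γ _ hM.γ₀_mem).comp measurable_snd.snd.fst
  exact (h1.sub h2).pow_const 2

end MeanSquare

/-! ### Folds -/

section Folds

variable {𝒳 𝒵 : Type*} {E : Procedure 𝒳 𝒵}

lemma Procedure.card_ne_fold (n : ℕ) (ℓ : Fin E.L) :
    ((Finset.univ.filter fun i : Fin n => E.fold n i ≠ ℓ).card : ℝ) = n - E.foldSize n ℓ := by
  have h := Finset.card_filter_add_card_filter_not (s := (Finset.univ : Finset (Fin n)))
    (fun i => E.fold n i = ℓ)
  rw [Finset.card_univ, Fintype.card_fin] at h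
  rw [eq_sub_iff_add_eq', Procedure.foldSize]
  exact_mod_cast h

lemma Procedure.card_fold_le (n : ℕ) (ℓ : Fin E.L) :
    ((Finset.univ.filter fun i : Fin n => E.fold n i = ℓ).card : ℝ) ≤ n := by
  exact_mod_cast (Finset.card_le_univ _).trans_eq (Fintype.card_fin n)

/-- Each fold's share tends to `1 / L ≤ 1 / 2`, strictly below `2 / 3`. -/
lemma Procedure.IsRegular.eventually_compl_size [MeasurableSpace 𝒳] [MeasurableSpace 𝒵]
    {M : Model 𝒳 𝒵} (hE : E.IsRegular M) :
    ∀ᶠ n : ℕ in atTop, 0 < n ∧ ∀ ℓ, (n : ℝ) / 3 ≤ n - E.foldSize n ℓ := by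
  have h1 : ∀ ℓ, ∀ᶠ n : ℕ in atTop, (E.foldSize n ℓ : ℝ) / n ≤ 2 / 3 := by
    intro ℓ
    refine (hE.balanced ℓ).eventually_le_const ?_
    have : (2 : ℝ) ≤ E.L := by exact_mod_cast hE.two_le_L
    rw [div_lt_div_iff₀ (by linarith) (by norm_num)]
    linarith
  filter_upwards [eventually_gt_atTop 0, eventually_all.2 h1] with n hn h
  refine ⟨hn, fun ℓ => ?_⟩
  have := h ℓ
  rw [div_le_iff₀ (by exact_mod_cast hn)] at this
  linarith

/-- Summing over the folds other than `ℓ` is summing over the observations outside `ℓ`. -/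
lemma Procedure.sum_folds_ne {n : ℕ} (ℓ : Fin E.L) (g : Fin n → ℝ) :
    ∑ ℓ' : Fin E.L with ℓ' ≠ ℓ, ∑ i : Fin n with E.fold n i = ℓ', g i =
      ∑ i : Fin n with E.fold n i ≠ ℓ, g i := by
  rw [← Finset.sum_fiberwise_of_maps_to (s := Finset.univ.filter fun i : Fin n => E.fold n i ≠ ℓ)
    (t := Finset.univ.filter fun ℓ' : Fin E.L => ℓ' ≠ ℓ) (g := E.fold n) (by simp)]
  refine Finset.sum_congr rfl fun ℓ' hℓ' => ?_
  rw [Finset.filter_filter]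
  refine Finset.sum_congr ?_ fun _ _ => rfl
  ext i
  simp only [Finset.mem_filter, Finset.mem_univ, true_and] at hℓ' ⊢
  constructor
  · rintro rfl
    exact ⟨hℓ', rfl⟩
  · exact fun h => h.2

lemma Procedure.sum_folds_ne_const {n : ℕ} (ℓ : Fin E.L) (a : ℝ) :
    ∑ ℓ' : Fin E.L with ℓ' ≠ ℓ, ∑ i : Fin n with E.fold n i = ℓ', a =
      (n - E.foldSize n ℓ) * a := by
  rw [E.sum_folds_ne ℓ fun _ => a, Finset.sum_const, nsmul_eq_mul, E.card_ne_fold]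

lemma card_filter_ne_le {L : ℕ} (ℓ : Fin L) :
    ((Finset.univ.filter fun ℓ' : Fin L => ℓ' ≠ ℓ).card : ℝ) ≤ L := by
  exact_mod_cast (Finset.card_le_univ _).trans_eq (Fintype.card_fin L)

/-- A bound on the deviation within every fold bounds the deviation of the average. -/
lemma Procedure.abs_average_sub_le {n : ℕ} (ℓ : Fin E.L) (hn : 0 < n)
    (hN : (n : ℝ) / 3 ≤ n - E.foldSize n ℓ) {g : Fin E.L → Fin n → ℝ} {a u : ℝ} (hu : 0 ≤ u)
    (h : ∀ ℓ', ℓ' ≠ ℓ → |∑ i : Fin n with E.fold n i = ℓ', (g ℓ' i - a)| ≤ u * n) :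
    |((n : ℝ) - E.foldSize n ℓ)⁻¹ *
      ∑ ℓ' : Fin E.L with ℓ' ≠ ℓ, ∑ i : Fin n with E.fold n i = ℓ', g ℓ' i - a| ≤
      3 * E.L * u := by
  have hn' : (0 : ℝ) < n := by exact_mod_cast hn
  have hN' : 0 < (n : ℝ) - E.foldSize n ℓ := by linarith
  have h1 : ((n : ℝ) - E.foldSize n ℓ)⁻¹ *
      ∑ ℓ' : Fin E.L with ℓ' ≠ ℓ, ∑ i : Fin n with E.fold n i = ℓ', g ℓ' i - a =
      ((n : ℝ) - E.foldSize n ℓ)⁻¹ *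
      ∑ ℓ' : Fin E.L with ℓ' ≠ ℓ, ∑ i : Fin n with E.fold n i = ℓ', (g ℓ' i - a) := by
    simp only [Finset.sum_sub_distrib]
    have := E.sum_folds_ne_const (n := n) ℓ a
    rw [this, mul_sub, inv_mul_cancel_left₀ hN'.ne']
  rw [h1, abs_mul, abs_of_pos (inv_pos.2 hN'), inv_mul_le_iff₀ hN']
  -- In the constant `3 L`, the factor `L` bounds the number of folds and `3` bounds `n / (n -
  -- n_ℓ)`.
  calc _ ≤ ∑ ℓ' : Fin E.L with ℓ' ≠ ℓ, |∑ i : Fin n with E.fold n i = ℓ', (g ℓ' i - a)| :=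
        Finset.abs_sum_le_sum_abs _ _
    _ ≤ ∑ ℓ' : Fin E.L with ℓ' ≠ ℓ, u * n :=
        Finset.sum_le_sum fun ℓ' hℓ' => h ℓ' (Finset.mem_filter.1 hℓ').2
    _ ≤ E.L * (u * n) := by
        rw [Finset.sum_const, nsmul_eq_mul]
        exact mul_le_mul_of_nonneg_right (card_filter_ne_le ℓ) (by positivity)
    _ = n / 3 * (3 * E.L * u) := by ring
    _ ≤ _ := mul_le_mul_of_nonneg_right hN (by positivity)

lemma Procedure.lin_sub (n : ℕ) (ρ ρ' : Fin (E.p n) → ℝ) (z : 𝒵) :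
    E.lin n (ρ - ρ') z = E.lin n ρ z - E.lin n ρ' z := by
  simp [Procedure.lin, mul_sub, Finset.sum_sub_distrib]

lemma Procedure.abs_lin_le {n : ℕ} {z : 𝒵} {C : ℝ} (h : ∀ k, |E.b n k z| ≤ C)
    (ρ : Fin (E.p n) → ℝ) : |E.lin n ρ z| ≤ C * l1 ρ :=
  abs_sum_mul_le h

end Folds

/-! ### The population target -/

section Population

variable {𝒳 𝒵 : Type*} [MeasurableSpace 𝒳] [MeasurableSpace 𝒵] {M : Model 𝒳 𝒵}
  {E : Procedure 𝒳 𝒵}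

lemma Procedure.IsRegular.q_pos (hE : E.IsRegular M) (n : ℕ) : 0 < E.q n :=
  two_pos.trans_le (hE.two_le_q n)

/-- The almost sure bounds on the dictionaries with a common nonnegative constant. -/
lemma Procedure.BoundedDictionaries.exists_pos (h : E.BoundedDictionaries M) :
    ∃ C : ℝ, 1 ≤ C ∧ ∀ n, ∀ᵐ w ∂M.F,
      (∀ k, |E.b n k w.2.2| ≤ C) ∧ ∀ j, |E.d n j w.2.1| ≤ C := by
  obtain ⟨Cb, Cd, h⟩ := h
  refine ⟨max 1 (max Cb Cd), le_max_left _ _, fun n => (h n).mono fun w hw =>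
    ⟨fun k => (hw.1 k).trans ?_, fun j => (hw.2 j).trans ?_⟩⟩
  · exact (le_max_left _ _).trans (le_max_right _ _)
  · exact (le_max_right _ _).trans (le_max_right _ _)

lemma Procedure.IsRegular.measurable_lin (hE : E.IsRegular M) (n : ℕ) (ρ : Fin (E.p n) → ℝ) :
    Measurable fun w : Obs 𝒳 𝒵 => E.lin n ρ w.2.2 :=
  Finset.measurable_sum _ fun k _ =>
    ((hE.measurable_b n k).comp measurable_snd.snd).mul_const _

lemma Procedure.IsRegular.measurable_d (hM : M.IsNPIV) (hE : E.IsRegular M) (n : ℕ)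
    (j : Fin (E.q n)) : Measurable fun w : Obs 𝒳 𝒵 => E.d n j w.2.1 :=
  (hM.measurable_Γ _ (hE.d_mem n j)).comp measurable_snd.fst

lemma Procedure.IsRegular.memLp_lin (hM : M.IsNPIV) (hE : E.IsRegular M) {C : ℝ}
    (hC : ∀ n, ∀ᵐ w ∂M.F, (∀ k, |E.b n k w.2.2| ≤ C) ∧ ∀ j, |E.d n j w.2.1| ≤ C) (n : ℕ)
    (ρ : Fin (E.p n) → ℝ) : MemLp (fun w : Obs 𝒳 𝒵 => E.lin n ρ w.2.2) 2 M.F := by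
  have := hM.prob
  exact MemLp.of_bound (hE.measurable_lin n ρ).aestronglyMeasurable (C * l1 ρ)
    ((hC n).mono fun w hw => E.abs_lin_le hw.1 ρ)

/-- The moment conditions at `ρbar` are of the order of the approximation error. -/
lemma Procedure.exists_moment_bound (hM : M.IsNPIV) (hα : M.IsRieszRepresenter)
    (hE : E.IsRegular M) (hdict : E.BoundedDictionaries M) {s : ℕ → ℕ} {κ : ℕ → ℝ}
    {ρbar : ∀ n, Fin (E.p n) → ℝ} (hsparse : E.SparseApprox M s κ ρbar) (hκ : ∀ n, 0 < κ n) :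
    ∃ K : ℝ, 0 ≤ K ∧ ∀ n j, |E.Mpop M n j - (E.Gpop M n *ᵥ ρbar n) j| ≤ K * (√(s n) * κ n) := by
  have := hM.prob
  obtain ⟨C, hC1, hC⟩ := hdict.exists_pos
  obtain ⟨-, -, -, A, hA1, hA⟩ := hsparse
  refine ⟨√A * C, by positivity, fun n j => ?_⟩
  have hd : MemLp (fun w : Obs 𝒳 𝒵 => E.d n j w.2.1) 2 M.F := hM.memLp_Γ _ (hE.d_mem n j)
  have hl : MemLp (fun w : Obs 𝒳 𝒵 => E.lin n (ρbar n) w.2.2) 2 M.F := hE.memLp_lin hM hC n _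
  have hb : ∀ k, MemLp (fun w : Obs 𝒳 𝒵 => E.b n k w.2.2) 2 M.F := fun k =>
    MemLp.of_bound ((hE.measurable_b n k).comp measurable_snd.snd).aestronglyMeasurable C
      ((hC n).mono fun w hw => hw.1 k)
  have h1 : (E.Gpop M n *ᵥ ρbar n) j = ∫ w, E.lin n (ρbar n) w.2.2 * E.d n j w.2.1 ∂M.F := by
    simp only [Matrix.mulVec, dotProduct, Procedure.Gpop, Procedure.lin, Finset.sum_mul]
    rw [integral_finsetSum _ fun k _ => ?_]
    · refine Finset.sum_congr rfl fun k _ => ?_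
      rw [← integral_mul_const]
      exact integral_congr_ae (ae_of_all _ fun w => by ring)
    · have := ((hb k).integrable_mul hd).mul_const (ρbar n k)
      exact this.congr (ae_of_all _ fun w => by simp only [Pi.mul_apply]; ring)
  -- By the Riesz identity the moment is the approximation error of `α₀` integrated against `d_j`,
  -- so Cauchy–Schwarz gives the order `√s·κ`.
  have h2 : E.Mpop M n j - (E.Gpop M n *ᵥ ρbar n) j =
      ∫ w, (M.α₀ w.2.2 - E.lin n (ρbar n) w.2.2) * E.d n j w.2.1 ∂M.F := by
    rw [h1, Procedure.Mpop, hα.riesz _ (hE.d_mem n j), ← integral_sub]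
    · exact integral_congr_ae (ae_of_all _ fun w => by ring)
    · exact hα.memLp.integrable_mul hd
    · exact hl.integrable_mul hd
  rw [h2]
  refine (abs_integral_mul_le (hα.memLp.sub hl) hd).trans ?_
  have h3 : √(∫ w, (M.α₀ w.2.2 - E.lin n (ρbar n) w.2.2) ^ 2 ∂M.F) ≤ √A * (√(s n) * κ n) := by
    rw [← Real.sqrt_sq (hκ n).le, ← Real.sqrt_mul (Nat.cast_nonneg _),
      ← Real.sqrt_mul (by linarith), ← mul_assoc]
    exact Real.sqrt_le_sqrt (hA n)
  have h4 : √(∫ w, E.d n j w.2.1 ^ 2 ∂M.F) ≤ C := by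
    refine Real.sqrt_le_iff.2 ⟨by linarith, ?_⟩
    calc ∫ w, E.d n j w.2.1 ^ 2 ∂M.F ≤ ∫ _, C ^ 2 ∂M.F := by
          refine integral_mono_ae hd.integrable_sq (integrable_const _) ?_
          filter_upwards [hC n] with w hw
          exact sq_le_sq' (abs_le.1 (hw.2 j)).1 (abs_le.1 (hw.2 j)).2
      _ = C ^ 2 := by simp
  calc _ ≤ √A * (√(s n) * κ n) * C := mul_le_mul h3 h4 (Real.sqrt_nonneg _)
        (by have := hκ n; positivity)
    _ = _ := by ring

/-- The restricted eigenvalue condition for the unweighted population moments. -/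
lemma Procedure.exists_restrictedEigenvalue (hM : M.IsNPIV) {s : ℕ → ℕ}
    {ρstar : ∀ n, Fin (E.p n) → ℝ} (hnondeg : E.NondegenerateMoments M ρstar)
    (heig : E.EigenvalueCondition M s ρstar) :
    ∃ c : ℝ, 0 < c ∧ ∀ n, RestrictedEigenvalue (gram 1 (E.Gpop M n)) (s n) c := by
  obtain ⟨v, ε, hv, hε, h⟩ := hnondeg
  obtain ⟨-, c, hc, hRE⟩ := heig
  refine ⟨v * c, mul_pos hv hc, fun n => (hRE n).one_of_diagonal hv fun j => ?_⟩
  exact inv_anti₀ hv (h M.γ₀ hM.γ₀_mem (by rw [sub_self, Model.normX_zero]; exact hε.le) n j)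

/-- The population target is close to `ρbar`. -/
lemma Procedure.exists_target_rate (hM : M.IsNPIV) (hα : M.IsRieszRepresenter)
    (hE : E.IsRegular M) (hdict : E.BoundedDictionaries M) {s : ℕ → ℕ} {κ : ℕ → ℝ}
    {ρbar ρL ρstar : ∀ n, Fin (E.p n) → ℝ} (hsparse : E.SparseApprox M s κ ρbar)
    (hκ : ∀ n, 0 < κ n) (htarget : E.IsPopulationTarget M κ ρbar ρL ρstar)
    (hnondeg : E.NondegenerateMoments M ρstar) (heig : E.EigenvalueCondition M s ρstar) :
    ∃ K : ℝ, 0 ≤ K ∧ ∀ n, l1 (ρstar n - ρbar n) ≤ K * (s n * κ n) := by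
  obtain ⟨A, hA0, hA⟩ := E.exists_moment_bound hM hα hE hdict hsparse hκ
  obtain ⟨c, hc, hRE⟩ := E.exists_restrictedEigenvalue hM hnondeg heig
  obtain ⟨hs, hcard, -, -⟩ := hsparse
  have hr := rateConst_nonneg (E := A) one_pos zero_le_one hc
  refine ⟨4 * ((4 * 1 * A ^ 2 + 4 * rateConst 1 1 c A) +
    √(4 * (4 * 1 * A ^ 2 + 4 * rateConst 1 1 c A) / c)), by positivity, fun n => ?_⟩
  obtain ⟨h1, h2⟩ := htarget n
  rw [one_eq_diagonal] at h1
  -- The population problem is an instance of the sample bound: exact matrix (`g = 0`), unit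
  -- weights, penalty `κ`. Its mean square part is what `sparseObj_rate` needs about `ρL`.
  have h3 := (pgmm_rate (hE.q_pos n) (hs n) one_pos (fun _ => ⟨le_rfl, le_rfl⟩) hc (hRE n) (hκ n)
    (g := 0) (by simp) (by simpa using hc.le) (hA n) (hcard n) h1).2
  exact sparseObj_rate hc (by positivity) (hRE n) (hκ n) (hcard n) h3 h2

end Population

/-! ### Uniform laws of large numbers for the sample moments -/

section Moments

variable {Ω 𝒳 𝒵 : Type*} [MeasurableSpace Ω] [MeasurableSpace 𝒳] [MeasurableSpace 𝒵]
  {M : Model 𝒳 𝒵} {E : Procedure 𝒳 𝒵} {P : Measure Ω} {W : ℕ → Ω → Obs 𝒳 𝒵}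

/-- Uniform law of large numbers at scale `lam` for functions that depend on the training data.
Under good training data the failure probability is at most `2 q² exp(-a² n lam² / (2 C²))`. -/
lemma crossfit_holdsWHP [IsProbabilityMeasure P] (hW : IsIIDSample M P W)
    {T : ∀ n, Fin n → Prop} {I : ∀ n, Finset (Fin n)} (hTI : ∀ n, ∀ i ∈ I n, ¬ T n i)
    {J : ℕ → Type} [∀ n, Fintype (J n)] {q : ℕ → ℕ} (hJ : ∀ n, Fintype.card (J n) ≤ q n ^ 2)
    {f : ∀ n, J n → ({i : Fin n // T n i} → Obs 𝒳 𝒵) → Obs 𝒳 𝒵 → ℝ}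
    (hf : ∀ n j, Measurable (Function.uncurry (f n j)))
    {Good : ∀ n, Set ({i : Fin n // T n i} → Obs 𝒳 𝒵)} (hG : ∀ n, MeasurableSet (Good n))
    {C : ℝ} (hC : 0 < C)
    (hb : ∀ᶠ n in atTop, ∀ t ∈ Good n, ∀ j, ∀ᵐ w ∂M.F, |f n j t w| ≤ C)
    (hgood : HoldsWHP P fun n ω => subsample W (T n) ω ∈ Good n)
    {lam : ℕ → ℝ} (hlam : ∀ n, 0 < lam n)
    (hexp : ∀ c : ℝ, 0 < c →
      Tendsto (fun n : ℕ => (q n : ℝ) ^ 2 * Real.exp (-(c * (n * lam n ^ 2)))) atTop (𝓝 0))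
    {a : ℝ} (ha : 0 < a) :
    HoldsWHP P fun n ω => ∀ j, |∑ i ∈ I n, (f n j (subsample W (T n) ω) (W i ω) -
      ∫ w, f n j (subsample W (T n) ω) w ∂M.F)| ≤ a * lam n * n := by
  have he := (hexp (a ^ 2 / (2 * C ^ 2)) (by positivity)).const_mul 2
  rw [mul_zero] at he
  refine hgood.of_le_add he ?_
  filter_upwards [hb, eventually_gt_atTop 0] with n hn hn0
  have hn' : (0 : ℝ) < n := by exact_mod_cast hn0
  have := hlam n
  refine (crossfit_hoeffding hW (hTI n) (hf n) (hG n) hC hn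
    (u := a * lam n * n) (by positivity)).trans (add_le_add le_rfl (ENNReal.ofReal_le_ofReal ?_))
  have h1 : -(a * lam n * n) ^ 2 / (2 * (n * C ^ 2)) =
      -(a ^ 2 / (2 * C ^ 2) * (n * lam n ^ 2)) := by
    field_simp
  rw [h1]
  have h2 : (Fintype.card (J n) : ℝ) ≤ (q n : ℝ) ^ 2 := by exact_mod_cast hJ n
  calc _ ≤ (q n : ℝ) ^ 2 * (2 * Real.exp (-(a ^ 2 / (2 * C ^ 2) * (n * lam n ^ 2)))) := by gcongr
    _ = _ := by ring

/-- `Ĝ_ℓ` is uniformly close to its mean. -/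
lemma Procedure.Ghat_close [IsProbabilityMeasure P] (hM : M.IsNPIV) (hW : IsIIDSample M P W)
    (hE : E.IsRegular M) (hdict : E.BoundedDictionaries M)
    (hexp : ∀ c : ℝ, 0 < c → Tendsto
      (fun n : ℕ => (E.q n : ℝ) ^ 2 * Real.exp (-(c * (n * E.lam n ^ 2)))) atTop (𝓝 0))
    (ℓ : Fin E.L) {g : ℝ} (hg : 0 < g) :
    HoldsWHP P fun n ω => ∀ j k, |E.Ghat (sample W n ω) ℓ j k - E.Gpop M n j k| ≤
      g * E.lam n := by
  obtain ⟨C, hC1, hC⟩ := hdict.exists_pos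
  -- The products `d_j b_k` involve no estimates, so the training set is empty and every training
  -- sample is good.
  have key := crossfit_holdsWHP (P := P) hW (T := fun _ _ => False)
    (I := fun n => Finset.univ.filter fun i => E.fold n i ≠ ℓ) (fun _ _ _ => not_false)
    (J := fun n => Fin (E.q n) × Fin (E.p n)) (q := E.q)
    (fun n => by
      rw [Fintype.card_prod, Fintype.card_fin, Fintype.card_fin, sq]
      exact Nat.mul_le_mul_left _ (hE.p_le_q n))
    (f := fun n jk _ w => E.d n jk.1 w.2.1 * E.b n jk.2 w.2.2)
    (fun n jk => ((hE.measurable_d hM n jk.1).mul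
      ((hE.measurable_b n jk.2).comp measurable_snd.snd)).comp measurable_snd)
    (Good := fun _ => Set.univ) (fun _ => MeasurableSet.univ) (C := C * C) (by positivity)
    (Eventually.of_forall fun n _ _ jk => (hC n).mono fun w hw => by
      rw [abs_mul]
      exact mul_le_mul (hw.2 _) (hw.1 _) (abs_nonneg _) (by linarith))
    (HoldsWHP.of_ae (by simp)) hE.lam_pos hexp (a := g / 3) (by positivity)
  refine key.mono (hE.eventually_compl_size.mono fun n hn ω hω j k => ?_)
  have hn' : (0 : ℝ) < n := by exact_mod_cast hn.1
  have hN := hn.2 ℓ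
  have hN' : 0 < (n : ℝ) - E.foldSize n ℓ := by linarith
  have h := hω (j, k)
  rw [Finset.sum_sub_distrib, Finset.sum_const, nsmul_eq_mul, E.card_ne_fold] at h
  have h1 : E.Ghat (sample W n ω) ℓ j k - E.Gpop M n j k = ((n : ℝ) - E.foldSize n ℓ)⁻¹ *
      (∑ i : Fin n with E.fold n i ≠ ℓ, E.d n j (W i ω).2.1 * E.b n k (W i ω).2.2 -
        (n - E.foldSize n ℓ) * E.Gpop M n j k) := by
    rw [mul_sub, inv_mul_cancel_left₀ hN'.ne']
    rfl
  rw [h1, abs_mul, abs_of_pos (inv_pos.2 hN'), inv_mul_le_iff₀ hN']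
  refine h.trans ?_
  calc g / 3 * E.lam n * n = n / 3 * (g * E.lam n) := by ring
    _ ≤ _ := mul_le_mul_of_nonneg_right hN (mul_pos hg (hE.lam_pos n)).le

/-- The subsample outside the folds `ℓ` and `ℓ'`. -/
abbrev Procedure.outside (E : Procedure 𝒳 𝒵) (ℓ ℓ' : Fin E.L) (n : ℕ) (i : Fin n) : Prop :=
  E.fold n i ≠ ℓ ∧ E.fold n i ≠ ℓ'

lemma Procedure.measurableSet_near (hM : M.IsNPIV) (hE : E.IsRegular M) (ℓ ℓ' : Fin E.L) (ε : ℝ)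
    (n : ℕ) : MeasurableSet {t | M.normX (E.γhat₂ n ℓ ℓ' t - M.γ₀) ≤ ε} :=
  measurableSet_le (hM.measurable_normX (hE.measurable_γhat₂ n ℓ ℓ')) measurable_const

lemma Procedure.StructuralRates.holdsWHP_gam₂ {κ : ℕ → ℝ} (hγ : E.StructuralRates M P W κ)
    {u : ℕ → ℝ} (hu : ∀ K : ℝ, ∀ᶠ n in atTop, K * κ n ≤ u n) {ℓ ℓ' : Fin E.L} (hℓ : ℓ ≠ ℓ') :
    HoldsWHP P fun n ω => M.normX (E.gam₂ (sample W n ω) ℓ ℓ' - M.γ₀) ≤ u n :=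
  ((hγ.rate₂ ℓ ℓ' hℓ).holdsWHP_le hu).mono
    (Eventually.of_forall fun _ _ h => (le_abs_self _).trans h)

lemma Procedure.StructuralRates.holdsWHP_gam {κ : ℕ → ℝ} (hγ : E.StructuralRates M P W κ)
    {u : ℕ → ℝ} (hu : ∀ K : ℝ, ∀ᶠ n in atTop, K * κ n ≤ u n) (ℓ : Fin E.L) :
    HoldsWHP P fun n ω => M.normX (E.gam (sample W n ω) ℓ - M.γ₀) ≤ u n :=
  ((hγ.rate ℓ).holdsWHP_le hu).mono
    (Eventually.of_forall fun _ _ h => (le_abs_self _).trans h)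

lemma Procedure.IsRegular.measurable_D (hE : E.IsRegular M) {n : ℕ} {ℓ ℓ' : Fin E.L}
    (j : Fin (E.q n)) (t : {i : Fin n // E.outside ℓ ℓ' n i} → Obs 𝒳 𝒵) :
    Measurable (M.D (E.γhat₂ n ℓ ℓ' t) (E.d n j)) :=
  (hE.measurable_D_γhat₂ n ℓ ℓ' j).comp measurable_prodMk_left

/-- `M̂_ℓ` is uniformly close to `E[D(W, γ₀, d)]`. -/
lemma Procedure.Mhat_close [IsProbabilityMeasure P] (hM : M.IsNPIV) (hα : M.IsRieszRepresenter)
    (hW : IsIIDSample M P W) (hE : E.IsRegular M) (hderiv : E.BoundedDerivative M)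
    {κ : ℕ → ℝ} (hγ : E.StructuralRates M P W κ) (hκ_lam : κ =o[atTop] E.lam)
    (hlam : Tendsto E.lam atTop (𝓝 0))
    (hexp : ∀ c : ℝ, 0 < c → Tendsto
      (fun n : ℕ => (E.q n : ℝ) ^ 2 * Real.exp (-(c * (n * E.lam n ^ 2)))) atTop (𝓝 0))
    (ℓ : Fin E.L) {g : ℝ} (hg : 0 < g) :
    HoldsWHP P fun n ω => ∀ j, |E.Mhat M (sample W n ω) ℓ j - E.Mpop M n j| ≤ g * E.lam n := by
  have := hM.prob
  obtain ⟨C, ε, hC, hε, hD⟩ := hderiv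
  have hL : (0 : ℝ) < E.L := by exact_mod_cast two_pos.trans_le hE.two_le_L
  -- Sampling error and bias cost `a·lam` each, and averaging over folds multiplies by `3 L`, for a
  -- total of `g·lam`.
  set a := g / (6 * E.L) with ha_def
  have ha : 0 < a := by positivity
  -- Closeness `ε` makes the derivatives bounded; closeness `(a / C)·lam` keeps the bias from
  -- replacing `γ₀` by its estimate below `a·lam`.
  have hnear : ∀ K : ℝ, ∀ᶠ n in atTop, K * κ n ≤ min ε (a / C * E.lam n) := by
    intro K
    filter_upwards [eventually_const_mul_le hE.lam_pos hκ_lam K one_pos,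
      eventually_const_mul_le hE.lam_pos hκ_lam K (div_pos ha hC),
      hlam.eventually_le_const hε] with n h1 h2 h3
    exact le_min (by linarith) h2
  -- The guard sits inside the event so that all folds can be intersected, although no rate is
  -- assumed at `ℓ' = ℓ`.
  have key : ∀ ℓ', HoldsWHP P fun n ω => ℓ' ≠ ℓ →
      ∀ j, |∑ i : Fin n with E.fold n i = ℓ',
        (M.D (E.gam₂ (sample W n ω) ℓ ℓ') (E.d n j) (sample W n ω i) - E.Mpop M n j)| ≤
        2 * a * E.lam n * n := by
    intro ℓ'
    by_cases hℓ : ℓ' = ℓ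
    · exact HoldsWHP.of_ae (by simp [hℓ])
    have h1 := hγ.holdsWHP_gam₂ hnear (Ne.symm hℓ)
    have h2 := crossfit_holdsWHP (P := P) hW (T := E.outside ℓ ℓ')
      (I := fun n => Finset.univ.filter fun i => E.fold n i = ℓ')
      (fun n i hi h => h.2 (Finset.mem_filter.1 hi).2)
      (J := fun n => Fin (E.q n)) (q := E.q)
      (fun n => by rw [Fintype.card_fin]; exact Nat.le_self_pow two_ne_zero _)
      (f := fun n j t w => M.D (E.γhat₂ n ℓ ℓ' t) (E.d n j) w)
      (fun n j => hE.measurable_D_γhat₂ n ℓ ℓ' j)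
      (Good := fun n => {t | M.normX (E.γhat₂ n ℓ ℓ' t - M.γ₀) ≤ ε})
      (E.measurableSet_near hM hE ℓ ℓ' ε) hC
      (Eventually.of_forall fun n t ht j =>
        ((hD _ (hE.γhat₂_mem n ℓ ℓ' t) ht n).1).mono fun w hw => hw j)
      (h1.mono (Eventually.of_forall fun n ω h => h.trans (min_le_left _ _)))
      hE.lam_pos hexp ha
    refine (h1.and h2).mono (Eventually.of_forall fun n ω hω _ j => ?_)
    obtain ⟨hω1, hω2⟩ := hω
    have hmem := hE.γhat₂_mem n ℓ ℓ' (subsample W (E.outside ℓ ℓ' n) ω)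
    have hDn := hD _ hmem (hω1.trans (min_le_left _ _)) n
    set D' := M.D (E.gam₂ (sample W n ω) ℓ ℓ') (E.d n j) with hD'
    have hint : Integrable D' M.F := Integrable.of_bound
      (hE.measurable_D j _).aestronglyMeasurable C (hDn.1.mono fun w hw => hw j)
    have h3 : |∫ w, D' w ∂M.F - E.Mpop M n j| ≤ a * E.lam n := by
      rw [Procedure.Mpop, ← integral_sub hint (hα.integrable _ (hE.d_mem n j))]
      refine (hDn.2 j).trans ?_
      calc _ ≤ C * (a / C * E.lam n) :=
            mul_le_mul_of_nonneg_left (hω1.trans (min_le_right _ _)) hC.le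
        _ = a * E.lam n := by field_simp
    have h4 : ∑ i : Fin n with E.fold n i = ℓ', (D' (sample W n ω i) - E.Mpop M n j) =
        ∑ i : Fin n with E.fold n i = ℓ', (D' (W i ω) - ∫ w, D' w ∂M.F) +
        (Finset.univ.filter fun i : Fin n => E.fold n i = ℓ').card *
          (∫ w, D' w ∂M.F - E.Mpop M n j) := by
      rw [← nsmul_eq_mul, ← Finset.sum_const, ← Finset.sum_add_distrib]
      refine Finset.sum_congr rfl fun i _ => ?_
      rw [sample]
      ring
    rw [h4]
    refine (abs_add_le _ _).trans ((add_le_add (hω2 j) (?_ : _ ≤ a * E.lam n * n)).trans_eq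
      (by ring))
    rw [abs_mul, Nat.abs_cast, mul_comm]
    exact mul_le_mul h3 (E.card_fold_le n ℓ') (Nat.cast_nonneg _)
      (mul_pos ha (hE.lam_pos n)).le
  refine (HoldsWHP.all key).mono (hE.eventually_compl_size.mono fun n hn ω hω j => ?_)
  have := E.abs_average_sub_le ℓ hn.1 (hn.2 ℓ)
    (g := fun ℓ' i => M.D (E.gam₂ (sample W n ω) ℓ ℓ') (E.d n j) (sample W n ω i))
    (a := E.Mpop M n j) (u := 2 * a * E.lam n) (by have := hE.lam_pos n; positivity)
    fun ℓ' hℓ' => hω ℓ' hℓ' j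
  refine this.trans_eq ?_
  rw [ha_def]
  field_simp
  ring

/-- The second moments of the sample moment functions at a bounded coefficient vector. -/
lemma Procedure.σ2hat_bounds [IsProbabilityMeasure P] (hM : M.IsNPIV)
    (hW : IsIIDSample M P W) (hE : E.IsRegular M) (hderiv : E.BoundedDerivative M)
    (hdict : E.BoundedDictionaries M)
    {κ : ℕ → ℝ} (hγ : E.StructuralRates M P W κ) (hκ_lam : κ =o[atTop] E.lam)
    (hlam : Tendsto E.lam atTop (𝓝 0))
    (hexp : ∀ c : ℝ, 0 < c → Tendsto
      (fun n : ℕ => (E.q n : ℝ) ^ 2 * Real.exp (-(c * (n * E.lam n ^ 2)))) atTop (𝓝 0))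
    {ρstar : ∀ n, Fin (E.p n) → ℝ} (hnondeg : E.NondegenerateMoments M ρstar) {R : ℝ}
    (hR : ∀ᶠ n in atTop, l1 (ρstar n) ≤ R) (ℓ : Fin E.L) :
    ∃ v B : ℝ, 0 < v ∧ 0 < B ∧ HoldsWHP P fun n ω =>
      ∀ j, v ≤ E.σ2hat M (sample W n ω) ℓ (ρstar n) j ∧
        E.σ2hat M (sample W n ω) ℓ (ρstar n) j ≤ B := by
  have := hM.prob
  obtain ⟨C₁, ε₁, hC₁, hε₁, hD⟩ := hderiv
  obtain ⟨C₂, hC₂, hdb⟩ := hdict.exists_pos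
  obtain ⟨v, ε₂, hv, hε₂, hnd⟩ := hnondeg
  have hL : (0 : ℝ) < E.L := by exact_mod_cast two_pos.trans_le hE.two_le_L
  set ε := min ε₁ ε₂
  have hε : 0 < ε := lt_min hε₁ hε₂
  set B := (C₁ + C₂ * (C₂ * |R|)) ^ 2 with hB
  have hB0 : 0 < B := by positivity
  have hnear : ∀ K : ℝ, ∀ᶠ n in atTop, K * κ n ≤ ε := by
    intro K
    filter_upwards [eventually_const_mul_le hE.lam_pos hκ_lam K one_pos,
      hlam.eventually_le_const hε] with n h1 h3
    linarith
  set ψ : ∀ n, (𝒳 → ℝ) → Fin (E.q n) → Obs 𝒳 𝒵 → ℝ := fun n γ j w =>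
    (M.D γ (E.d n j) w - E.d n j w.2.1 * E.lin n (ρstar n) w.2.2) ^ 2 with hψ
  have hψb : ∀ᶠ n in atTop, ∀ γ ∈ M.Γ, M.normX (γ - M.γ₀) ≤ ε → ∀ j, ∀ᵐ w ∂M.F,
      |ψ n γ j w| ≤ B := by
    filter_upwards [hR] with n hRn γ hγm hγn j
    filter_upwards [(hD γ hγm (hγn.trans (min_le_left _ _)) n).1, hdb n] with w hw1 hw2
    rw [abs_of_nonneg (sq_nonneg _), hB]
    change (M.D γ (E.d n j) w - E.d n j w.2.1 * E.lin n (ρstar n) w.2.2) ^ 2 ≤ _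
    rw [← sq_abs]
    refine pow_le_pow_left₀ (abs_nonneg _) ((abs_sub _ _).trans (add_le_add (hw1 j) ?_)) 2
    rw [abs_mul]
    refine mul_le_mul (hw2.2 j) ((E.abs_lin_le hw2.1 _).trans ?_) (abs_nonneg _) (by linarith)
    exact mul_le_mul_of_nonneg_left (hRn.trans (le_abs_self R)) (by linarith)
  have key : ∀ ℓ', HoldsWHP P fun n ω => ℓ' ≠ ℓ →
      M.normX (E.gam₂ (sample W n ω) ℓ ℓ' - M.γ₀) ≤ ε ∧
      ∀ j, |∑ i : Fin n with E.fold n i = ℓ',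
        (ψ n (E.gam₂ (sample W n ω) ℓ ℓ') j (sample W n ω i) -
          ∫ w, ψ n (E.gam₂ (sample W n ω) ℓ ℓ') j w ∂M.F)| ≤ 1 * E.lam n * n := by
    intro ℓ'
    by_cases hℓ : ℓ' = ℓ
    · exact HoldsWHP.of_ae (by simp [hℓ])
    have h1 := hγ.holdsWHP_gam₂ hnear (Ne.symm hℓ)
    have h2 := crossfit_holdsWHP (P := P) hW (T := E.outside ℓ ℓ')
      (I := fun n => Finset.univ.filter fun i => E.fold n i = ℓ')
      (fun n i hi h => h.2 (Finset.mem_filter.1 hi).2)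
      (J := fun n => Fin (E.q n)) (q := E.q)
      (fun n => by rw [Fintype.card_fin]; exact Nat.le_self_pow two_ne_zero _)
      (f := fun n j t w => ψ n (E.γhat₂ n ℓ ℓ' t) j w)
      (fun n j => ((hE.measurable_D_γhat₂ n ℓ ℓ' j).sub
        (((hE.measurable_d hM n j).mul (hE.measurable_lin n (ρstar n))).comp
          measurable_snd)).pow_const 2)
      (Good := fun n => {t | M.normX (E.γhat₂ n ℓ ℓ' t - M.γ₀) ≤ ε})
      (E.measurableSet_near hM hE ℓ ℓ' ε) hB0
      (hψb.mono fun n hn t ht j => hn _ (hE.γhat₂_mem n ℓ ℓ' t) ht j)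
      h1 hE.lam_pos hexp one_pos
    exact (h1.and h2).mono (Eventually.of_forall fun n ω hω _ => hω)
  refine ⟨v / 2, 2 * B + v, by linarith, by positivity, ?_⟩
  have hsmall : ∀ᶠ n in atTop, 3 * E.L * E.lam n ≤ v / 2 := by
    have := hlam.const_mul (3 * (E.L : ℝ))
    rw [mul_zero] at this
    exact this.eventually_le_const (by linarith)
  refine (HoldsWHP.all key).mono ?_
  filter_upwards [hE.eventually_compl_size, hψb, hsmall] with n hn hψn hsn ω hω j
  have hn' : (0 : ℝ) < n := by exact_mod_cast hn.1
  have hN' : 0 < (n : ℝ) - E.foldSize n ℓ := by linarith [hn.2 ℓ]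
  -- The conditional mean differs from fold to fold. As non-degeneracy and boundedness hold on a
  -- whole neighbourhood of `γ₀`, each mean lies in `[v, B]` and so does their average; continuity
  -- of the variance in `γ` is not needed.
  set μ : Fin E.L → ℝ := fun ℓ' => ∫ w, ψ n (E.gam₂ (sample W n ω) ℓ ℓ') j w ∂M.F with hμ
  have hμb : ∀ ℓ', ℓ' ≠ ℓ → v ≤ μ ℓ' ∧ μ ℓ' ≤ B := by
    intro ℓ' hℓ'
    have hmem : E.gam₂ (sample W n ω) ℓ ℓ' ∈ M.Γ := hE.γhat₂_mem _ _ _ _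
    have hnr := (hω ℓ' hℓ').1
    refine ⟨hnd _ hmem (hnr.trans (min_le_right _ _)) n j, ?_⟩
    have h := norm_integral_le_of_norm_le_const (μ := M.F)
      (f := ψ n (E.gam₂ (sample W n ω) ℓ ℓ') j) (C := B) (hψn _ hmem hnr j)
    simp only [probReal_univ, mul_one] at h
    exact (le_abs_self _).trans h
  have havg := E.abs_average_sub_le ℓ hn.1 (hn.2 ℓ) (a := 0)
    (g := fun ℓ' i => ψ n (E.gam₂ (sample W n ω) ℓ ℓ') j (sample W n ω i) - μ ℓ')
    (u := E.lam n) (hE.lam_pos n).le fun ℓ' hℓ' => by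
      have := (hω ℓ' hℓ').2 j
      simpa using this
  rw [sub_zero] at havg
  have hσ : E.σ2hat M (sample W n ω) ℓ (ρstar n) j = ((n : ℝ) - E.foldSize n ℓ)⁻¹ *
      ∑ ℓ' : Fin E.L with ℓ' ≠ ℓ, ∑ i : Fin n with E.fold n i = ℓ',
        (ψ n (E.gam₂ (sample W n ω) ℓ ℓ') j (sample W n ω i) - μ ℓ') +
      ((n : ℝ) - E.foldSize n ℓ)⁻¹ *
      ∑ ℓ' : Fin E.L with ℓ' ≠ ℓ, ∑ i : Fin n with E.fold n i = ℓ', μ ℓ' := by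
    rw [← mul_add, ← Finset.sum_add_distrib]
    simp only [← Finset.sum_add_distrib, sub_add_cancel]
    rfl
  have hlow : v ≤ ((n : ℝ) - E.foldSize n ℓ)⁻¹ *
      ∑ ℓ' : Fin E.L with ℓ' ≠ ℓ, ∑ i : Fin n with E.fold n i = ℓ', μ ℓ' := by
    rw [le_inv_mul_iff₀ hN', ← E.sum_folds_ne_const]
    exact Finset.sum_le_sum fun ℓ' hℓ' => Finset.sum_le_sum fun i _ =>
      (hμb ℓ' (Finset.mem_filter.1 hℓ').2).1
  have hup : ((n : ℝ) - E.foldSize n ℓ)⁻¹ *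
      ∑ ℓ' : Fin E.L with ℓ' ≠ ℓ, ∑ i : Fin n with E.fold n i = ℓ', μ ℓ' ≤ B := by
    rw [inv_mul_le_iff₀ hN', ← E.sum_folds_ne_const]
    exact Finset.sum_le_sum fun ℓ' hℓ' => Finset.sum_le_sum fun i _ =>
      (hμb ℓ' (Finset.mem_filter.1 hℓ').2).2
  have h1 := abs_le.1 havg
  rw [hσ]
  constructor <;> linarith

/-- The sample second moments depend continuously on the coefficients. -/
lemma Procedure.σ2hat_le {n : ℕ} {x : Fin n → Obs 𝒳 𝒵} {ℓ : Fin E.L} {C : ℝ}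
    (hN : 0 < (n : ℝ) - E.foldSize n ℓ)
    (hx : ∀ i, (∀ k, |E.b n k (x i).2.2| ≤ C) ∧ ∀ j, |E.d n j (x i).2.1| ≤ C)
    (ρ ρ' : Fin (E.p n) → ℝ) (j : Fin (E.q n)) :
    E.σ2hat M x ℓ ρ j ≤ 2 * E.σ2hat M x ℓ ρ' j + 2 * (C * (C * l1 (ρ - ρ'))) ^ 2 := by
  rw [← mul_add]
  have h1 : (C * (C * l1 (ρ - ρ'))) ^ 2 = ((n : ℝ) - E.foldSize n ℓ)⁻¹ *
      ∑ ℓ' : Fin E.L with ℓ' ≠ ℓ, ∑ i : Fin n with E.fold n i = ℓ',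
        (C * (C * l1 (ρ - ρ'))) ^ 2 := by
    rw [E.sum_folds_ne_const, inv_mul_cancel_left₀ hN.ne']
  rw [h1, Procedure.σ2hat, Procedure.σ2hat, ← mul_add, mul_left_comm]
  refine mul_le_mul_of_nonneg_left ?_ (inv_pos.2 hN).le
  rw [← Finset.sum_add_distrib, Finset.mul_sum]
  refine Finset.sum_le_sum fun ℓ' _ => ?_
  rw [← Finset.sum_add_distrib, Finset.mul_sum]
  refine Finset.sum_le_sum fun i _ => ?_
  set A := M.D (E.gam₂ x ℓ ℓ') (E.d n j) (x i)
  have h2 : |E.d n j (x i).2.1 * E.lin n (ρ - ρ') (x i).2.2| ≤ C * (C * l1 (ρ - ρ')) := by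
    rw [abs_mul]
    exact mul_le_mul ((hx i).2 j) (E.abs_lin_le (hx i).1 _) (abs_nonneg _)
      ((abs_nonneg _).trans ((hx i).2 j))
  have h3 := sq_le_sq' (abs_le.1 h2).1 (abs_le.1 h2).2
  rw [E.lin_sub] at h3
  nlinarith [sq_nonneg (A - E.d n j (x i).2.1 * E.lin n ρ' (x i).2.2 +
    E.d n j (x i).2.1 * (E.lin n ρ (x i).2.2 - E.lin n ρ' (x i).2.2))]

end Moments

/-! ### The rate of the Riesz representer coefficients -/

section Coefficients

variable {Ω 𝒳 𝒵 : Type*} [MeasurableSpace Ω] [MeasurableSpace 𝒳] [MeasurableSpace 𝒵]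
  {M : Model 𝒳 𝒵} {E : Procedure 𝒳 𝒵} {P : Measure Ω} {W : ℕ → Ω → Obs 𝒳 𝒵}

/-- The sample moments at `ρ₀` inherit the size of the population moments. -/
lemma abs_moment_le {p q : ℕ} {G Gh : Matrix (Fin q) (Fin p) ℝ} {Mp Mh : Fin q → ℝ}
    {ρ₀ : Fin p → ℝ} {r A K κ lam : ℝ} (hr : 1 ≤ r) (hlam : 0 ≤ lam)
    (hG : ∀ j k, |Gh j k - G j k| ≤ lam) (hM : ∀ j, |Mh j - Mp j| ≤ lam)
    (hA : l1 ρ₀ ≤ A) (hK : ∀ j, |Mp j - (G *ᵥ ρ₀) j| ≤ K * (r * κ)) (hκ : K * κ ≤ lam)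
    (j : Fin q) : |Mh j - (Gh *ᵥ ρ₀) j| ≤ (2 + A) * (r * lam) := by
  have hA0 : 0 ≤ A := (l1_nonneg ρ₀).trans hA
  have h1 : Mh j - (Gh *ᵥ ρ₀) j =
      (Mh j - Mp j) + (Mp j - (G *ᵥ ρ₀) j) - ((Gh - G) *ᵥ ρ₀) j := by
    rw [Matrix.sub_mulVec, Pi.sub_apply]
    ring
  have h2 : |((Gh - G) *ᵥ ρ₀) j| ≤ lam * A :=
    (abs_mulVec_le hG ρ₀ j).trans (mul_le_mul_of_nonneg_left hA hlam)
  -- The error in `Mh` gives `lam`, the population moment `r·lam`, and the error in `Gh` at most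
  -- `A·lam`; with `1 ≤ r` this adds up to `(2 + A) r lam`.
  rw [h1]
  refine (abs_sub _ _).trans ((add_le_add ((abs_add_le _ _).trans
    (add_le_add (hM j) (hK j))) h2).trans ?_)
  have h3 : K * (r * κ) ≤ r * lam := by
    calc K * (r * κ) = r * (K * κ) := by ring
      _ ≤ r * lam := mul_le_mul_of_nonneg_left hκ (by linarith)
  have h4 : lam ≤ r * lam := le_mul_of_one_le_left hlam hr
  nlinarith

/-- `pgmm_rate` is applied twice on one event: with unit weights it places `ρ̃` near `ρbar`, which
confines the estimated weights to a fixed interval, and with those weights it gives the rate of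
`ρ̂`. Both times the restricted eigenvalue is that of the unweighted population matrix. -/
lemma Procedure.exists_coef_rate [IsProbabilityMeasure P] {κ : ℕ → ℝ} {s : ℕ → ℕ}
    {ρbar ρL ρstar : ∀ n, Fin (E.p n) → ℝ}
    (hM : M.IsNPIV) (hα : M.IsRieszRepresenter) (hW : IsIIDSample M P W) (hE : E.IsRegular M)
    (hPGMM : E.IsDiagonalPGMM M P W) (hdict : E.BoundedDictionaries M)
    (hsparse : E.SparseApprox M s κ ρbar) (htarget : E.IsPopulationTarget M κ ρbar ρL ρstar)
    (hnondeg : E.NondegenerateMoments M ρstar) (heig : E.EigenvalueCondition M s ρstar)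
    (hderiv : E.BoundedDerivative M) (hγ : E.StructuralRates M P W κ)
    (hκ_pos : ∀ n, 0 < κ n)
    (hκ_slow : (fun n : ℕ => √(Real.log (E.q n) / n)) =O[atTop] κ)
    (hκ_lam : κ =o[atTop] E.lam)
    (hs_lam : Tendsto (fun n => (s n : ℝ) ^ 2 * E.lam n) atTop (𝓝 0)) (ℓ : Fin E.L) :
    ∃ K : ℝ, HoldsWHP P fun n ω =>
      l1 (E.ρfinal (sample W n ω) ℓ - ρbar n) ≤ K * (s n * E.lam n) := by
  have hexp : ∀ c : ℝ, 0 < c → Tendsto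
      (fun n : ℕ => (E.q n : ℝ) ^ 2 * Real.exp (-(c * (n * E.lam n ^ 2)))) atTop (𝓝 0) :=
    fun c hc => tendsto_sq_mul_exp hE.two_le_q hE.lam_pos hκ_slow hκ_lam hc
  obtain ⟨hsl, hlam⟩ := tendsto_zero_of_sq_mul hsparse.1 hE.lam_pos hs_lam
  obtain ⟨A, hA0, hA⟩ := E.exists_moment_bound hM hα hE hdict hsparse hκ_pos
  obtain ⟨c, hc, hRE⟩ := E.exists_restrictedEigenvalue hM hnondeg heig
  obtain ⟨K₀, hK₀, htr⟩ := E.exists_target_rate hM hα hE hdict hsparse hκ_pos htarget hnondeg heig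
  obtain ⟨C, hC1, hC⟩ := hdict.exists_pos
  obtain ⟨hs, hcard, ⟨R, hR⟩, -⟩ := hsparse
  have hs' : ∀ n, (1 : ℝ) ≤ s n := fun n => by exact_mod_cast hs n
  have hslam0 : ∀ n, 0 ≤ s n * E.lam n := fun n =>
    mul_nonneg (Nat.cast_nonneg _) (hE.lam_pos n).le
  have hsκ : ∀ᶠ n in atTop, K₀ * (s n * κ n) ≤ s n * E.lam n := by
    filter_upwards [eventually_const_mul_le hE.lam_pos hκ_lam K₀ one_pos] with n hn
    calc K₀ * (s n * κ n) = s n * (K₀ * κ n) := by ring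
      _ ≤ s n * E.lam n := mul_le_mul_of_nonneg_left (by linarith) (Nat.cast_nonneg _)
  have hRstar : ∀ᶠ n in atTop, l1 (ρstar n) ≤ 1 + R := by
    filter_upwards [hsκ, hsl.eventually_le_const one_pos] with n h1 h2
    exact (l1_le_add _ (ρbar n)).trans (add_le_add ((htr n).trans (h1.trans h2)) (hR n))
  obtain ⟨v, B, hv, hB, hσ⟩ := E.σ2hat_bounds hM hW hE hderiv hdict hγ hκ_lam hlam hexp hnondeg
    hRstar ℓ
  have hgs : ∀ᶠ n in atTop, 64 * E.lam n ^ 2 * s n ≤ c := by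
    have h := (hsl.mul hlam).const_mul 64
    rw [mul_zero, mul_zero] at h
    filter_upwards [h.eventually_le_const hc] with n hn
    linarith
  set K₁ := rateConst 1 1 c (2 + R) with hK₁
  have hK₁0 : 0 ≤ K₁ := rateConst_nonneg one_pos zero_le_one hc
  have hsmall : ∀ᶠ n in atTop, (C * (C * ((K₁ + 1) * (s n * E.lam n)))) ^ 2 ≤ v / 4 := by
    have h := ((((hsl.const_mul (K₁ + 1)).const_mul C).const_mul C).pow 2)
    simp only [mul_zero, ne_eq, OfNat.ofNat_ne_zero, not_false_eq_true, zero_pow] at h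
    exact h.eventually_le_const (by linarith)
  refine ⟨rateConst (2 * B + v)⁻¹ (4 / v) c (2 + R), ?_⟩
  refine (((E.Ghat_close hM hW hE hdict hexp ℓ one_pos).and (E.Mhat_close hM hα hW hE hderiv hγ
    hκ_lam hlam hexp ℓ one_pos)).and hσ).mono_ae ?_
  filter_upwards [hE.eventually_compl_size, hsκ, hgs, hsmall,
    eventually_const_mul_le hE.lam_pos hκ_lam A one_pos] with n hn hsκn hgsn hsmalln hAκ
  have hbd : ∀ᵐ ω ∂P, ∀ i : Fin n, (∀ k, |E.b n k (sample W n ω i).2.2| ≤ C) ∧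
      ∀ j, |E.d n j (sample W n ω i).2.1| ≤ C := ae_all_iff.2 fun i => hW.ae (hC n) i
  filter_upwards [hPGMM n ℓ, hbd] with ω hmin hx hω
  obtain ⟨⟨hG, hMh⟩, hσω⟩ := hω
  simp only [one_mul] at hG hMh hAκ
  have hn' : (0 : ℝ) < n := by exact_mod_cast hn.1
  have hN' : 0 < (n : ℝ) - E.foldSize n ℓ := by linarith [hn.2 ℓ]
  have hmom := abs_moment_le (Real.one_le_sqrt.2 (hs' n)) (hE.lam_pos n).le hG hMh (hR n) (hA n)
    hAκ
  have hprelim := (pgmm_rate (hE.q_pos n) (hs n) one_pos (fun _ => ⟨le_rfl, le_rfl⟩) hc (hRE n)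
    (hE.lam_pos n) hG hgsn hmom (hcard n) (by
      have := hmin.1
      rwa [one_eq_diagonal] at this)).1
  have hdist : l1 (E.ρprelim (sample W n ω) ℓ - ρstar n) ≤ (K₁ + 1) * (s n * E.lam n) := by
    refine (l1_sub_le _ (ρbar n) _).trans ?_
    rw [l1_sub_comm (ρbar n)]
    linarith [htr n]
  have hsq : (C * (C * l1 (E.ρprelim (sample W n ω) ℓ - ρstar n))) ^ 2 ≤ v / 4 := by
    refine le_trans ?_ hsmalln
    have := l1_nonneg (E.ρprelim (sample W n ω) ℓ - ρstar n)
    gcongr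
  have hweights : ∀ j, (2 * B + v)⁻¹ ≤
      (E.σ2hat M (sample W n ω) ℓ (E.ρprelim (sample W n ω) ℓ) j)⁻¹ ∧
      (E.σ2hat M (sample W n ω) ℓ (E.ρprelim (sample W n ω) ℓ) j)⁻¹ ≤ 4 / v := by
    intro j
    have h1 := E.σ2hat_le (M := M) hN' hx (E.ρprelim (sample W n ω) ℓ) (ρstar n) j
    have h2 := E.σ2hat_le (M := M) hN' hx (ρstar n) (E.ρprelim (sample W n ω) ℓ) j
    rw [l1_sub_comm (ρstar n)] at h2
    have h3 := hσω j
    -- From `v ≤ σ̂²(ρstar) ≤ 2 σ̂²(ρ̃) + v / 2`.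
    have h4 : v / 4 ≤ E.σ2hat M (sample W n ω) ℓ (E.ρprelim (sample W n ω) ℓ) j := by linarith
    constructor
    · exact inv_anti₀ (by linarith) (by linarith)
    · have := inv_anti₀ (by linarith) h4
      rwa [inv_div] at this
  exact (pgmm_rate (hE.q_pos n) (hs n) (by positivity) hweights hc (hRE n)
    (hE.lam_pos n) hG hgsn hmom (hcard n) hmin.2).1

end Coefficients

/-! ### The score at fixed estimates -/

lemma stronglyMeasurable_sigmaZ {𝒳 𝒵 : Type*} [MeasurableSpace 𝒵] {h : 𝒵 → ℝ}
    (hh : Measurable h) : StronglyMeasurable[sigmaZ 𝒳 𝒵] fun w : Obs 𝒳 𝒵 => h w.2.2 :=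
  (hh.comp (comap_measurable _)).stronglyMeasurable

lemma memLp_bdd_mul {α : Type*} [MeasurableSpace α] {μ : Measure α} {f g : α → ℝ} {C : ℝ}
    (hg : MemLp g 2 μ) (hf : AEStronglyMeasurable f μ) (hC : ∀ᵐ w ∂μ, |f w| ≤ C) :
    MemLp (fun w => f w * g w) 2 μ :=
  hg.of_le_mul (hf.mul hg.1) (hC.mono fun w hw => by
    rw [norm_mul]
    exact mul_le_mul_of_nonneg_right hw (norm_nonneg _))

section Score

variable {𝒳 𝒵 : Type*} [MeasurableSpace 𝒳] [MeasurableSpace 𝒵] {M : Model 𝒳 𝒵}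
  {E : Procedure 𝒳 𝒵}

lemma sigmaZ_le : sigmaZ 𝒳 𝒵 ≤ (inferInstance : MeasurableSpace (Obs 𝒳 𝒵)) :=
  measurable_snd.snd.comap_le

lemma Model.IsNPIV.measurable_resid (hM : M.IsNPIV) : Measurable M.resid :=
  measurable_fst.sub ((hM.measurable_Γ _ hM.γ₀_mem).comp measurable_snd.fst)

/-- Bounded functions of the instruments are orthogonal to the residual. -/
lemma Model.IsNPIV.integral_mul_resid (hM : M.IsNPIV) {h : 𝒵 → ℝ} (hh : Measurable h) {C : ℝ}
    (hC : ∀ᵐ w ∂M.F, |h w.2.2| ≤ C) : ∫ w, h w.2.2 * M.resid w ∂M.F = 0 := by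
  have := hM.prob
  have hint : Integrable ((fun w : Obs 𝒳 𝒵 => h w.2.2) * M.resid) M.F :=
    hM.integrable_resid.bdd_mul (hh.comp measurable_snd.snd).aestronglyMeasurable hC
  have h1 := condExp_mul_of_stronglyMeasurable_left (stronglyMeasurable_sigmaZ (𝒳 := 𝒳) hh) hint
    hM.integrable_resid
  have h2 := integral_condExp (μ := M.F) (sigmaZ_le (𝒳 := 𝒳) (𝒵 := 𝒵))
    (f := (fun w : Obs 𝒳 𝒵 => h w.2.2) * M.resid)
  change ∫ w, ((fun w : Obs 𝒳 𝒵 => h w.2.2) * M.resid) w ∂M.F = 0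
  rw [← h2]
  refine integral_eq_zero_of_ae (h1.trans ?_)
  filter_upwards [hM.exogeneity] with w hw
  simp [hw]

/-- Conditional homoskedasticity bound. -/
lemma Model.IsNPIV.integral_sq_mul_resid_le (hM : M.IsNPIV) (hres : MemLp M.resid 2 M.F)
    {B : ℝ} (hB : ∀ᵐ w ∂M.F, (M.F[fun v => M.resid v ^ 2 | sigmaZ 𝒳 𝒵]) w ≤ B)
    {h : 𝒵 → ℝ} (hh : Measurable h) {C : ℝ} (hC : ∀ᵐ w ∂M.F, |h w.2.2| ≤ C) :
    ∫ w, (h w.2.2 * M.resid w) ^ 2 ∂M.F ≤ B * ∫ w, h w.2.2 ^ 2 ∂M.F := by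
  have := hM.prob
  have hC2 : ∀ᵐ w ∂M.F, ‖h w.2.2 ^ 2‖ ≤ C ^ 2 := hC.mono fun w hw => by
    rw [norm_pow]
    exact pow_le_pow_left₀ (norm_nonneg _) hw 2
  have hm : Measurable fun w : Obs 𝒳 𝒵 => h w.2.2 ^ 2 := (hh.comp measurable_snd.snd).pow_const 2
  have hsq : Integrable (fun w => M.resid w ^ 2) M.F := hres.integrable_sq
  have hint : Integrable ((fun w : Obs 𝒳 𝒵 => h w.2.2 ^ 2) * fun w => M.resid w ^ 2) M.F :=
    hsq.bdd_mul hm.aestronglyMeasurable hC2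
  have h1 := condExp_mul_of_stronglyMeasurable_left
    (stronglyMeasurable_sigmaZ (𝒳 := 𝒳) (hh.pow_const 2)) hint hsq
  have h2 := integral_condExp (μ := M.F) (sigmaZ_le (𝒳 := 𝒳) (𝒵 := 𝒵))
    (f := (fun w : Obs 𝒳 𝒵 => h w.2.2 ^ 2) * fun w => M.resid w ^ 2)
  calc ∫ w, (h w.2.2 * M.resid w) ^ 2 ∂M.F
      = ∫ w, ((fun w : Obs 𝒳 𝒵 => h w.2.2 ^ 2) * fun w => M.resid w ^ 2) w ∂M.F :=
        integral_congr_ae (ae_of_all _ fun w => by simp only [Pi.mul_apply]; ring)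
    _ ≤ ∫ w, B * h w.2.2 ^ 2 ∂M.F := by
        rw [← h2]
        refine integral_mono_ae integrable_condExp
          ((Integrable.of_bound hm.aestronglyMeasurable _ hC2).const_mul B) ?_
        filter_upwards [h1, hB] with w hw1 hw2
        rw [hw1, Pi.mul_apply, mul_comm]
        exact mul_le_mul_of_nonneg_right hw2 (sq_nonneg _)
    _ = _ := integral_const_mul _ _

/-- `m(w, γ) + b(z)'ρ (y - γ(x))` in deviation from `m(w, γ₀) + α₀(z) (y - γ₀(x))`. -/
def Procedure.scoreDiff (M : Model 𝒳 𝒵) (E : Procedure 𝒳 𝒵) (n : ℕ) (γ : 𝒳 → ℝ)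
    (ρ : Fin (E.p n) → ℝ) (w : Obs 𝒳 𝒵) : ℝ :=
  M.m w γ + E.lin n ρ w.2.2 * (w.1 - γ w.2.1) - (M.m w M.γ₀ + M.α₀ w.2.2 * M.resid w)

/-- Separates the error in `m`, a mean-zero term from the error in `α₀`, and a term from the error
in `γ₀` whose first-order part cancels against that of `m`. -/
lemma Procedure.scoreDiff_eq (n : ℕ) (γ : 𝒳 → ℝ) (ρ : Fin (E.p n) → ℝ) (w : Obs 𝒳 𝒵) :
    E.scoreDiff M n γ ρ w = (M.m w γ - M.m w M.γ₀) +
      ((E.lin n ρ w.2.2 - M.α₀ w.2.2) * M.resid w - E.lin n ρ w.2.2 * (γ - M.γ₀) w.2.1) := by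
  simp only [Procedure.scoreDiff, Model.resid, Pi.sub_apply]
  ring

/-- Distance of the linear combination from the Riesz representer. -/
lemma Procedure.integral_lin_sub_sq_le (hM : M.IsNPIV) (hα : M.IsRieszRepresenter)
    (hE : E.IsRegular M) {C : ℝ}
    (hC : ∀ n, ∀ᵐ w ∂M.F, (∀ k, |E.b n k w.2.2| ≤ C) ∧ ∀ j, |E.d n j w.2.1| ≤ C) (n : ℕ)
    (ρ ρ' : Fin (E.p n) → ℝ) :
    ∫ w, (E.lin n ρ w.2.2 - M.α₀ w.2.2) ^ 2 ∂M.F ≤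
      2 * (C * l1 (ρ - ρ')) ^ 2 + 2 * ∫ w, (M.α₀ w.2.2 - E.lin n ρ' w.2.2) ^ 2 ∂M.F := by
  have := hM.prob
  have h0 : Integrable (fun w : Obs 𝒳 𝒵 => (M.α₀ w.2.2 - E.lin n ρ' w.2.2) ^ 2) M.F :=
    (hα.memLp.sub (hE.memLp_lin hM hC n ρ')).integrable_sq
  have h1 : Integrable (fun w : Obs 𝒳 𝒵 => (E.lin n ρ w.2.2 - M.α₀ w.2.2) ^ 2) M.F :=
    ((hE.memLp_lin hM hC n ρ).sub hα.memLp).integrable_sq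
  calc ∫ w, (E.lin n ρ w.2.2 - M.α₀ w.2.2) ^ 2 ∂M.F
      ≤ ∫ w, (2 * (C * l1 (ρ - ρ')) ^ 2 +
          2 * (M.α₀ w.2.2 - E.lin n ρ' w.2.2) ^ 2) ∂M.F := by
        refine integral_mono_ae h1 ((integrable_const _).add (h0.const_mul 2)) ?_
        filter_upwards [hC n] with w hw
        have h2 := E.abs_lin_le hw.1 (ρ - ρ')
        have h3 := sq_le_sq' (abs_le.1 h2).1 (abs_le.1 h2).2
        rw [E.lin_sub] at h3
        nlinarith [sq_nonneg (E.lin n ρ w.2.2 - E.lin n ρ' w.2.2 +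
          (M.α₀ w.2.2 - E.lin n ρ' w.2.2))]
    _ = _ := by
        rw [integral_add (integrable_const _) (h0.const_mul 2), integral_const, integral_const_mul]
        simp

/-- Mean and second moment of the score deviation at fixed estimates. -/
lemma Procedure.scoreDiff_bounds (hM : M.IsNPIV) (hα : M.IsRieszRepresenter)
    (hE : E.IsRegular M) {C Ca B : ℝ}
    (hC : ∀ n, ∀ᵐ w ∂M.F, (∀ k, |E.b n k w.2.2| ≤ C) ∧ ∀ j, |E.d n j w.2.1| ≤ C)
    (hCa : ∀ᵐ w ∂M.F, |M.α₀ w.2.2| ≤ Ca) (hres : MemLp M.resid 2 M.F)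
    (hB : ∀ᵐ w ∂M.F, (M.F[fun v => M.resid v ^ 2 | sigmaZ 𝒳 𝒵]) w ≤ B)
    {n : ℕ} {γ : 𝒳 → ℝ} (hγ : γ ∈ M.Γ)
    (ρ : Fin (E.p n) → ℝ) {δ r : ℝ} (hδ : 0 ≤ δ)
    (hms : ∫⁻ w, ENNReal.ofReal ((M.m w γ - M.m w M.γ₀) ^ 2) ∂M.F ≤ ENNReal.ofReal δ)
    (hr : |∫ w, (M.m w γ - M.m w M.γ₀ - M.D M.γ₀ (γ - M.γ₀) w) ∂M.F| ≤ r) :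
    MemLp (E.scoreDiff M n γ ρ) 2 M.F ∧
    ∫ w, E.scoreDiff M n γ ρ w ^ 2 ∂M.F ≤
      3 * (δ + B * ∫ w, (E.lin n ρ w.2.2 - M.α₀ w.2.2) ^ 2 ∂M.F +
        (C * l1 ρ) ^ 2 * M.normX (γ - M.γ₀) ^ 2) ∧
    |∫ w, E.scoreDiff M n γ ρ w ∂M.F| ≤
      r + √(∫ w, (E.lin n ρ w.2.2 - M.α₀ w.2.2) ^ 2 ∂M.F) * M.normX (γ - M.γ₀) := by
  have := hM.prob
  have hsub : γ - M.γ₀ ∈ M.Γ := M.Γ.sub_mem hγ hM.γ₀_mem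
  have hlb : ∀ᵐ w ∂M.F, |E.lin n ρ w.2.2| ≤ C * l1 ρ :=
    (hC n).mono fun w hw => E.abs_lin_le hw.1 ρ
  have hhm : Measurable fun z => E.lin n ρ z - M.α₀ z :=
    (Finset.measurable_sum _ fun k _ => (hE.measurable_b n k).mul_const _).sub hα.measurable
  have hhb : ∀ᵐ w ∂M.F, |E.lin n ρ w.2.2 - M.α₀ w.2.2| ≤ C * l1 ρ + Ca := by
    filter_upwards [hlb, hCa] with w h1 h2
    exact (abs_sub _ _).trans (add_le_add h1 h2)
  have hmm : Measurable fun w => M.m w γ - M.m w M.γ₀ :=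
    (hM.measurable_m γ hγ).sub (hM.measurable_m _ hM.γ₀_mem)
  -- Square integrability is derived from `hms`, which is stated with a Lebesgue integral; a Bochner
  -- integral would be zero for a non-integrable square and carry no information.
  have hA : MemLp (fun w => M.m w γ - M.m w M.γ₀) 2 M.F := by
    rw [memLp_two_iff_integrable_sq hmm.aestronglyMeasurable]
    refine ⟨(hmm.pow_const 2).aestronglyMeasurable, ?_⟩
    rw [hasFiniteIntegral_iff_ofReal (ae_of_all _ fun w => sq_nonneg _)]
    exact hms.trans_lt ENNReal.ofReal_lt_top
  have hA2 : ∫ w, (M.m w γ - M.m w M.γ₀) ^ 2 ∂M.F ≤ δ := by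
    rw [integral_eq_lintegral_of_nonneg_ae (ae_of_all _ fun w => sq_nonneg _)
      (hmm.pow_const 2).aestronglyMeasurable]
    exact ENNReal.toReal_le_of_le_ofReal hδ hms
  have hBL : MemLp (fun w => (E.lin n ρ w.2.2 - M.α₀ w.2.2) * M.resid w) 2 M.F :=
    memLp_bdd_mul hres (hhm.comp measurable_snd.snd).aestronglyMeasurable hhb
  have hg : MemLp (fun w : Obs 𝒳 𝒵 => (γ - M.γ₀) w.2.1) 2 M.F := hM.memLp_Γ _ hsub
  have hCL : MemLp (fun w => E.lin n ρ w.2.2 * (γ - M.γ₀) w.2.1) 2 M.F :=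
    memLp_bdd_mul hg (hE.measurable_lin n ρ).aestronglyMeasurable hlb
  have hmem : MemLp (E.scoreDiff M n γ ρ) 2 M.F := by
    have := hA.add (hBL.sub hCL)
    refine this.ae_eq (ae_of_all _ fun w => ?_)
    rw [E.scoreDiff_eq]
    rfl
  have hBsq := hM.integral_sq_mul_resid_le hres hB hhm hhb
  have hCsq : ∫ w, (E.lin n ρ w.2.2 * (γ - M.γ₀) w.2.1) ^ 2 ∂M.F ≤
      (C * l1 ρ) ^ 2 * M.normX (γ - M.γ₀) ^ 2 := by
    rw [M.sq_normX, ← integral_const_mul]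
    refine integral_mono_ae hCL.integrable_sq (hg.integrable_sq.const_mul _) ?_
    filter_upwards [hlb] with w hw
    simp only [mul_pow]
    exact mul_le_mul_of_nonneg_right (by
      rw [← mul_pow]; exact sq_le_sq' (abs_le.1 hw).1 (abs_le.1 hw).2) (sq_nonneg _)
  refine ⟨hmem, ?_, ?_⟩
  · calc ∫ w, E.scoreDiff M n γ ρ w ^ 2 ∂M.F
        ≤ ∫ w, 3 * ((M.m w γ - M.m w M.γ₀) ^ 2 +
            ((E.lin n ρ w.2.2 - M.α₀ w.2.2) * M.resid w) ^ 2 +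
            (E.lin n ρ w.2.2 * (γ - M.γ₀) w.2.1) ^ 2) ∂M.F := by
          refine integral_mono hmem.integrable_sq
            (((hA.integrable_sq.add hBL.integrable_sq).add hCL.integrable_sq).const_mul 3)
            fun w => ?_
          simp only [E.scoreDiff_eq]
          set a := M.m w γ - M.m w M.γ₀
          set b := (E.lin n ρ w.2.2 - M.α₀ w.2.2) * M.resid w
          set c := E.lin n ρ w.2.2 * (γ - M.γ₀) w.2.1
          -- These three squares sum exactly to `3 (a² + b² + c²) - (a + b - c)²`.
          nlinarith [sq_nonneg (a - b), sq_nonneg (a + c), sq_nonneg (b + c)]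
      _ = 3 * (∫ w, (M.m w γ - M.m w M.γ₀) ^ 2 ∂M.F +
            ∫ w, ((E.lin n ρ w.2.2 - M.α₀ w.2.2) * M.resid w) ^ 2 ∂M.F +
            ∫ w, (E.lin n ρ w.2.2 * (γ - M.γ₀) w.2.1) ^ 2 ∂M.F) := by
          have hAB : Integrable (fun w => (M.m w γ - M.m w M.γ₀) ^ 2 +
              ((E.lin n ρ w.2.2 - M.α₀ w.2.2) * M.resid w) ^ 2) M.F :=
            hA.integrable_sq.add hBL.integrable_sq
          rw [integral_const_mul, integral_add hAB hCL.integrable_sq,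
            integral_add hA.integrable_sq hBL.integrable_sq]
      _ ≤ _ := by linarith
  · have hDi := hα.integrable _ hsub
    have hαg : Integrable (fun w : Obs 𝒳 𝒵 => M.α₀ w.2.2 * (γ - M.γ₀) w.2.1) M.F :=
      hα.memLp.integrable_mul hg
    have hhL : MemLp (fun w : Obs 𝒳 𝒵 => E.lin n ρ w.2.2 - M.α₀ w.2.2) 2 M.F :=
      (hE.memLp_lin hM hC n ρ).sub hα.memLp
    have hhg : Integrable (fun w : Obs 𝒳 𝒵 =>
        (E.lin n ρ w.2.2 - M.α₀ w.2.2) * (γ - M.γ₀) w.2.1) M.F := hhL.integrable_mul hg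
    have hAi := hA.integrable one_le_two
    have hBi := hBL.integrable one_le_two
    -- Orthogonality: the Riesz identity trades the mean of the derivative for `E[α₀ (γ - γ₀)]`.
    -- Against `E[b'ρ (γ - γ₀)]` only the product of the two errors survives.
    have h1 : ∫ w, E.scoreDiff M n γ ρ w ∂M.F =
        ∫ w, (M.m w γ - M.m w M.γ₀ - M.D M.γ₀ (γ - M.γ₀) w) ∂M.F -
        ∫ w, (E.lin n ρ w.2.2 - M.α₀ w.2.2) * (γ - M.γ₀) w.2.1 ∂M.F := by
      rw [integral_sub hAi hDi, hα.riesz _ hsub, sub_sub, ← integral_add hαg hhg]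
      have h2 : ∀ w : Obs 𝒳 𝒵, M.α₀ w.2.2 * (γ - M.γ₀) w.2.1 +
          (E.lin n ρ w.2.2 - M.α₀ w.2.2) * (γ - M.γ₀) w.2.1 =
          E.lin n ρ w.2.2 * (γ - M.γ₀) w.2.1 := fun w => by ring
      simp only [h2, E.scoreDiff_eq]
      have hCi := hCL.integrable one_le_two
      have hBC : Integrable (fun w => (E.lin n ρ w.2.2 - M.α₀ w.2.2) * M.resid w -
          E.lin n ρ w.2.2 * (γ - M.γ₀) w.2.1) M.F := hBi.sub hCi
      rw [integral_add hAi hBC, integral_sub hBi hCi,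
        hM.integral_mul_resid hhm hhb, zero_sub, ← sub_eq_add_neg]
    rw [h1]
    exact (abs_sub _ _).trans (add_le_add hr (abs_integral_mul_le hhL hg))

end Score

/-! ### Negligibility of the estimation error in the score -/

section ScoreErr

variable {𝒳 𝒵 : Type*} [MeasurableSpace 𝒳] [MeasurableSpace 𝒵] {M : Model 𝒳 𝒵}
  {E : Procedure 𝒳 𝒵}

/-- The observations outside fold `ℓ`. -/
abbrev Procedure.train (E : Procedure 𝒳 𝒵) (ℓ : Fin E.L) (n : ℕ) (i : Fin n) : Prop :=
  E.fold n i ≠ ℓ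

/-- The score deviation with the estimates computed from the data `t`. -/
def Procedure.scoreErr (M : Model 𝒳 𝒵) (E : Procedure 𝒳 𝒵) (n : ℕ) (ℓ : Fin E.L)
    (t : {i : Fin n // E.train ℓ n i} → Obs 𝒳 𝒵) (w : Obs 𝒳 𝒵) : ℝ :=
  E.scoreDiff M n (E.γhat n ℓ t) (E.ρhat n ℓ t) w

/-- The error enters through the data outside fold `ℓ` alone, the form the cross-fitting
inequalities require. -/
lemma Procedure.score_eq {Ω : Type*} {n : ℕ} (W : ℕ → Ω → Obs 𝒳 𝒵) (ω : Ω) (ℓ : Fin E.L) (w : Obs 𝒳 𝒵) :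
    E.score M (sample W n ω) ℓ w =
      M.ψ₀ w + M.θ₀ + E.scoreErr M n ℓ (subsample W (E.train ℓ n) ω) w := by
  change _ = M.ψ₀ w + M.θ₀ +
    E.scoreDiff M n (E.gam (sample W n ω) ℓ) (E.ρfinal (sample W n ω) ℓ) w
  simp only [Procedure.score, Procedure.scoreDiff, Model.ψ₀]
  ring

end ScoreErr

section Negligible

variable {Ω 𝒳 𝒵 : Type*} [MeasurableSpace Ω] [MeasurableSpace 𝒳] [MeasurableSpace 𝒵]
  {M : Model 𝒳 𝒵} {E : Procedure 𝒳 𝒵} {P : Measure Ω} {W : ℕ → Ω → Obs 𝒳 𝒵}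

lemma Procedure.IsRegular.measurable_score (hE : E.IsRegular M) (n : ℕ)
    (ℓ : Fin E.L) : Measurable fun x : ({i : Fin n // E.train ℓ n i} → Obs 𝒳 𝒵) × Obs 𝒳 𝒵 =>
      M.m x.2 (E.γhat n ℓ x.1) + E.lin n (E.ρhat n ℓ x.1) x.2.2.2 *
        (x.2.1 - E.γhat n ℓ x.1 x.2.2.1) := by
  refine (hE.measurable_m_γhat n ℓ).add (Measurable.mul ?_ (measurable_snd.fst.sub ?_))
  · exact Finset.measurable_sum _ fun k _ =>
      ((hE.measurable_b n k).comp measurable_snd.snd.snd).mul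
        ((measurable_pi_apply k).comp ((hE.measurable_ρhat n ℓ).comp measurable_fst))
  · exact (hE.measurable_γhat n ℓ).comp (measurable_fst.prodMk measurable_snd.snd.fst)

lemma Procedure.IsRegular.measurable_scoreErr (hM : M.IsNPIV) (hα : M.IsRieszRepresenter)
    (hE : E.IsRegular M) (n : ℕ) (ℓ : Fin E.L) :
    Measurable (Function.uncurry (E.scoreErr M n ℓ)) :=
  (hE.measurable_score n ℓ).sub
    (((hM.measurable_m _ hM.γ₀_mem).add
      ((hα.measurable.comp measurable_snd.snd).mul hM.measurable_resid)).comp measurable_snd)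

/-- Turns the fourth-root rate into negligibility of the quadratic remainder after scaling by `√n`.
-/
lemma sqrt_mul_sq_eq (n : ℕ) (x : ℝ) : √(n : ℝ) * x ^ 2 = ((n : ℝ) ^ (1 / 4 : ℝ) * x) ^ 2 := by
  rw [mul_pow, Real.sqrt_eq_rpow, ← Real.rpow_natCast ((n : ℝ) ^ (1 / 4 : ℝ)) 2,
    ← Real.rpow_mul (Nat.cast_nonneg _)]
  norm_num

/-- Outside an event of small probability the score deviation has small mean and second
moment. -/
lemma Procedure.exists_good (hM : M.IsNPIV) (hα : M.IsRieszRepresenter) (hE : E.IsRegular M)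
    {κ : ℕ → ℝ} {s : ℕ → ℕ} {ρbar : ∀ n, Fin (E.p n) → ℝ} (hdict : E.BoundedDictionaries M)
    (hsparse : E.SparseApprox M s κ ρbar) (hprim : M.BoundedPrimitives)
    (hrem : M.QuadraticRemainder) (hγ : E.StructuralRates M P W κ)
    (hms : E.MeanSquareConsistent M P W) (hκ_pos : ∀ n, 0 < κ n) (hκ_lam : κ =o[atTop] E.lam)
    (hs_lam : Tendsto (fun n => (s n : ℝ) ^ 2 * E.lam n) atTop (𝓝 0))
    (hrate : Tendsto (fun n : ℕ => √(n : ℝ) * (s n * E.lam n) * κ n) atTop (𝓝 0))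
    (ℓ : Fin E.L) {K : ℝ}
    (hcoef : HoldsWHP P fun n ω =>
      l1 (E.ρfinal (sample W n ω) ℓ - ρbar n) ≤ K * (s n * E.lam n)) {η : ℝ} (hη : 0 < η) :
    ∃ Good : ∀ n, Set ({i : Fin n // E.train ℓ n i} → Obs 𝒳 𝒵),
      (∀ n, MeasurableSet (Good n)) ∧
      (HoldsWHP P fun n ω => subsample W (E.train ℓ n) ω ∈ Good n) ∧
      ∀ᶠ n in atTop, ∀ t ∈ Good n, MemLp (E.scoreErr M n ℓ t) 2 M.F ∧
        ∫ w, E.scoreErr M n ℓ t w ^ 2 ∂M.F ≤ η ∧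
        √(n : ℝ) * |∫ w, E.scoreErr M n ℓ t w ∂M.F| ≤ η := by
  have := hM.prob
  obtain ⟨hsl, hlam⟩ := tendsto_zero_of_sq_mul hsparse.1 hE.lam_pos hs_lam
  obtain ⟨C, hC1, hC⟩ := hdict.exists_pos
  obtain ⟨hs, -, ⟨R, hR⟩, A, hA1, hA⟩ := hsparse
  obtain ⟨⟨Ca, hCa⟩, hres, ⟨B₀, hB₀⟩, -⟩ := hprim
  obtain ⟨C₀, ε, hC₀, hε, hquad⟩ := hrem
  have hs' : ∀ n, (1 : ℝ) ≤ s n := fun n => by exact_mod_cast hs n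
  set B := |B₀| with hBdef
  have hB : ∀ᵐ w ∂M.F, (M.F[fun v => M.resid v ^ 2 | sigmaZ 𝒳 𝒵]) w ≤ B :=
    hB₀.mono fun w hw => hw.trans (le_abs_self _)
  -- Constant of the mean square error of `b'ρ̂`; it is positive because `A > 1`, so `u n` may
  -- divide by its root.
  set C' := 2 * (C * K) ^ 2 + 2 * A with hC'
  have hC'0 : 0 < C' := by positivity
  set Q := (C * (R + 1)) ^ 2 with hQ
  have hQ0 : 0 ≤ Q := sq_nonneg _
  set δ' := min ε (min 1 (η / (9 * (Q + 1)))) with hδ'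
  have hδ'0 : 0 < δ' := lt_min hε (lt_min one_pos (by positivity))
  set δ₃ := √(η / (2 * C₀)) with hδ₃
  have hδ₃0 : 0 < δ₃ := Real.sqrt_pos.2 (by positivity)
  set u : ℕ → ℝ := fun n => η / 2 / (√(n : ℝ) * (√C' * (s n * E.lam n))) with hu
  -- The thresholds split `η`. Each of the three second moment terms is at most `η / 9`, and
  -- `scoreDiff_bounds` multiplies their sum by `3`. In the mean, `C₀ δ₃² = η / 2` handles the
  -- quadratic remainder and `u n` is chosen so that the product of the errors, scaled by `√n`, is
  -- `η / 2`.
  refine ⟨fun n => {t |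
    ∫⁻ w, ENNReal.ofReal ((M.m w (E.γhat n ℓ t) - M.m w M.γ₀) ^ 2) ∂M.F ≤ ENNReal.ofReal (η / 9)} ∩
    ({t | M.normX (E.γhat n ℓ t - M.γ₀) ≤ δ'} ∩
    ({t | l1 (E.ρhat n ℓ t - ρbar n) ≤ K * (s n * E.lam n)} ∩
    ({t | (n : ℝ) ^ (1 / 4 : ℝ) * M.normX (E.γhat n ℓ t - M.γ₀) ≤ δ₃} ∩
    {t | M.normX (E.γhat n ℓ t - M.γ₀) ≤ u n}))), fun n => ?_, ?_, ?_⟩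
  · have hnm := hM.measurable_normX (hE.measurable_γhat n ℓ)
    refine MeasurableSet.inter (measurableSet_le ?_ measurable_const)
      ((measurableSet_le hnm measurable_const).inter
      ((measurableSet_le ?_ measurable_const).inter
      ((measurableSet_le (hnm.const_mul _) measurable_const).inter
      (measurableSet_le hnm measurable_const))))
    · refine Measurable.lintegral_prod_right' (f := fun x : _ × Obs 𝒳 𝒵 =>
        ENNReal.ofReal ((M.m x.2 (E.γhat n ℓ x.1) - M.m x.2 M.γ₀) ^ 2)) ?_
      exact (((hE.measurable_m_γhat n ℓ).sub
        ((hM.measurable_m _ hM.γ₀_mem).comp measurable_snd)).pow_const 2).ennreal_ofReal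
    · exact Finset.measurable_sum _ fun k _ =>
        (((measurable_pi_apply k).comp (hE.measurable_ρhat n ℓ)).sub_const _).abs
  · refine HoldsWHP.and ?_ (HoldsWHP.and ?_ (HoldsWHP.and hcoef (HoldsWHP.and ?_ ?_)))
    · refine tendsto_zero_of_eventually_le (hms ℓ (η / 9) (by positivity))
        (Eventually.of_forall fun n => measure_mono fun ω hω => ?_)
      simp only [Set.mem_ofPred_eq, not_le] at hω ⊢
      exact hω.le
    · refine hγ.holdsWHP_gam (u := fun _ => δ') (fun k => ?_) ℓ
      filter_upwards [eventually_const_mul_le hE.lam_pos hκ_lam k one_pos,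
        hlam.eventually_le_const hδ'0] with n h1 h2
      linarith
    · refine (TendstoInMeasure.holdsWHP (hγ.fourthRoot ℓ) hδ₃0).mono
        (Eventually.of_forall fun n ω hω => ?_)
      rw [sub_zero] at hω
      exact (le_abs_self _).trans hω
    -- That `k·κ` is eventually below `u n`, for every `k`, is exactly the product rate condition.
    · refine hγ.holdsWHP_gam (fun k => ?_) ℓ
      have h := (hrate.const_mul (k * √C'))
      rw [mul_zero] at h
      filter_upwards [h.eventually_le_const (half_pos hη), eventually_gt_atTop 0] with n h1 h2
      have h2' : (0 : ℝ) < n := by exact_mod_cast h2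
      have := hE.lam_pos n
      have := hs' n
      have hsn : (0 : ℝ) < s n := by linarith
      rw [hu, le_div_iff₀ (by positivity)]
      linarith
  · have hsmall : ∀ᶠ n in atTop, B * (C' * (s n * E.lam n) ^ 2) ≤ η / 9 := by
      have h := ((hsl.pow 2).const_mul C').const_mul B
      simp only [ne_eq, OfNat.ofNat_ne_zero, not_false_eq_true, zero_pow, mul_zero] at h
      exact h.eventually_le_const (by positivity)
    have hsmall2 : ∀ᶠ n in atTop, K * (s n * E.lam n) ≤ 1 := by
      have h := hsl.const_mul K
      rw [mul_zero] at h
      exact h.eventually_le_const one_pos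
    filter_upwards [hsmall, hsmall2, eventually_const_mul_le hE.lam_pos hκ_lam 1 one_pos,
      eventually_gt_atTop 0] with n hn1 hn2 hn3 hn0 t ht
    obtain ⟨ht1, ht2, ht3, ht4, ht5⟩ := ht
    simp only [Set.mem_ofPred_eq] at ht1 ht2 ht3 ht4 ht5
    have hn' : (0 : ℝ) < n := by exact_mod_cast hn0
    have hlamn := hE.lam_pos n
    have hsn : (0 : ℝ) < s n := by linarith [hs' n]
    set γ := E.γhat n ℓ t with hγdef
    set ρ := E.ρhat n ℓ t with hρdef
    set x := M.normX (γ - M.γ₀) with hx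
    have hx0 : 0 ≤ x := M.normX_nonneg _
    have hγm : γ ∈ M.Γ := hE.γhat_mem n ℓ t
    obtain ⟨hmem, hsq, hint⟩ := E.scoreDiff_bounds hM hα hE hC hCa hres hB hγm ρ
      (by positivity : 0 ≤ η / 9) ht1 (hquad γ hγm (ht2.trans (min_le_left _ _))).2
    -- The approximation error `A s κ²` is absorbed into `A (s·lam)²`, as `s ≤ s²` and eventually `κ
    -- ≤ lam`.
    have hD : ∫ w, (E.lin n ρ w.2.2 - M.α₀ w.2.2) ^ 2 ∂M.F ≤ C' * (s n * E.lam n) ^ 2 := by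
      refine (E.integral_lin_sub_sq_le hM hα hE hC n ρ (ρbar n)).trans ?_
      have h1 : (C * l1 (ρ - ρbar n)) ^ 2 ≤ (C * (K * (s n * E.lam n))) ^ 2 := by
        have := l1_nonneg (ρ - ρbar n)
        gcongr
      have h2 : A * s n * κ n ^ 2 ≤ A * (s n * E.lam n) ^ 2 := by
        have h3 : κ n ≤ E.lam n := by linarith
        have h4 : κ n ^ 2 ≤ E.lam n ^ 2 := pow_le_pow_left₀ (hκ_pos n).le h3 2
        have h5 : (s n : ℝ) ≤ s n ^ 2 := by nlinarith [hs' n]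
        rw [mul_pow, mul_assoc]
        gcongr
      calc _ ≤ 2 * (C * (K * (s n * E.lam n))) ^ 2 + 2 * (A * (s n * E.lam n) ^ 2) := by
            linarith [hA n]
        _ = _ := by rw [hC']; ring
    refine ⟨hmem, hsq.trans ?_, ?_⟩
    · have h1 : B * ∫ w, (E.lin n ρ w.2.2 - M.α₀ w.2.2) ^ 2 ∂M.F ≤ η / 9 :=
        (mul_le_mul_of_nonneg_left hD (abs_nonneg _)).trans hn1
      have h2 : l1 ρ ≤ R + 1 := by
        have := l1_le_add ρ (ρbar n)
        have := hR n
        rw [← l1] at this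
        linarith
      have h3 : (C * l1 ρ) ^ 2 ≤ Q := by
        have := l1_nonneg ρ
        rw [hQ]
        gcongr
      have h4 : x ^ 2 ≤ η / (9 * (Q + 1)) := by
        have h5 : x ≤ 1 := ht2.trans ((min_le_right _ _).trans (min_le_left _ _))
        have h6 : x ≤ η / (9 * (Q + 1)) :=
          ht2.trans ((min_le_right _ _).trans (min_le_right _ _))
        nlinarith
      have h5 : (C * l1 ρ) ^ 2 * x ^ 2 ≤ η / 9 := by
        calc (C * l1 ρ) ^ 2 * x ^ 2 ≤ (Q + 1) * (η / (9 * (Q + 1))) :=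
              mul_le_mul (by linarith) h4 (sq_nonneg _) (by linarith)
          _ = η / 9 := by field_simp
      linarith
    · have h1 : √(∫ w, (E.lin n ρ w.2.2 - M.α₀ w.2.2) ^ 2 ∂M.F) ≤ √C' * (s n * E.lam n) := by
        refine (Real.sqrt_le_sqrt hD).trans_eq ?_
        rw [Real.sqrt_mul hC'0.le, Real.sqrt_sq (by positivity)]
      have h2 : √(n : ℝ) * (C₀ * x ^ 2) ≤ η / 2 := by
        have h3 := pow_le_pow_left₀ (by positivity) ht4 2
        rw [← sqrt_mul_sq_eq, hδ₃, Real.sq_sqrt (by positivity), le_div_iff₀ (by positivity)] at h3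
        linarith
      have h3 : √(n : ℝ) * (√(∫ w, (E.lin n ρ w.2.2 - M.α₀ w.2.2) ^ 2 ∂M.F) * x) ≤ η / 2 := by
        calc _ ≤ √(n : ℝ) * (√C' * (s n * E.lam n) * u n) := by gcongr
          _ = η / 2 := by
            rw [hu]
            have : √C' ≠ 0 := (Real.sqrt_pos.2 hC'0).ne'
            have : √(n : ℝ) ≠ 0 := (Real.sqrt_pos.2 hn').ne'
            field_simp
      calc _ ≤ √(n : ℝ) * (C₀ * x ^ 2 +
            √(∫ w, (E.lin n ρ w.2.2 - M.α₀ w.2.2) ^ 2 ∂M.F) * x) := by gcongr; exact hint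
        _ ≤ η := by linarith

/-- A bound on the failure probability up to arbitrarily small constants suffices. -/
lemma HoldsWHP.of_forall_le {B : ℕ → Ω → Prop} (h : ∀ τ : ℝ, 0 < τ → ∃ A : ℕ → Ω → Prop,
    HoldsWHP P A ∧ ∀ᶠ n in atTop, P {ω | ¬ B n ω} ≤ P {ω | ¬ A n ω} + ENNReal.ofReal τ) :
    HoldsWHP P B := by
  refine ENNReal.tendsto_nhds_zero.2 fun τ hτ => ?_
  obtain ⟨r, hr, hrτ⟩ := exists_pos_ofReal_le hτ
  obtain ⟨A, hA, hle⟩ := h (r / 2) (half_pos hr)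
  have hr2 : 0 < ENNReal.ofReal (r / 2) := ENNReal.ofReal_pos.2 (half_pos hr)
  filter_upwards [hle, ENNReal.tendsto_nhds_zero.1 hA _ hr2] with n h1 h2
  refine h1.trans ((add_le_add h2 le_rfl).trans ?_)
  rw [← ENNReal.ofReal_add (half_pos hr).le (half_pos hr).le, add_halves]
  exact hrτ

/-- The estimation error in the score is negligible within every fold. -/
lemma Procedure.scoreErr_negligible [IsProbabilityMeasure P] (hM : M.IsNPIV)
    (hα : M.IsRieszRepresenter) (hW : IsIIDSample M P W) (hE : E.IsRegular M) (ℓ : Fin E.L)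
    (hgood : ∀ η : ℝ, 0 < η → ∃ Good : ∀ n, Set ({i : Fin n // E.train ℓ n i} → Obs 𝒳 𝒵),
      (∀ n, MeasurableSet (Good n)) ∧
      (HoldsWHP P fun n ω => subsample W (E.train ℓ n) ω ∈ Good n) ∧
      ∀ᶠ n in atTop, ∀ t ∈ Good n, MemLp (E.scoreErr M n ℓ t) 2 M.F ∧
        ∫ w, E.scoreErr M n ℓ t w ^ 2 ∂M.F ≤ η ∧
        √(n : ℝ) * |∫ w, E.scoreErr M n ℓ t w ∂M.F| ≤ η) {u : ℝ} (hu : 0 < u) :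
    (HoldsWHP P fun n ω => |∑ i : Fin n with E.fold n i = ℓ,
      E.scoreErr M n ℓ (subsample W (E.train ℓ n) ω) (W i ω)| ≤ u * √(n : ℝ)) ∧
    HoldsWHP P fun n ω => ∑ i : Fin n with E.fold n i = ℓ,
      E.scoreErr M n ℓ (subsample W (E.train ℓ n) ω) (W i ω) ^ 2 ≤ u * n := by
  have hmeas := fun n => hE.measurable_scoreErr hM hα n ℓ
  have htest : ∀ n, ∀ i ∈ Finset.univ.filter fun i : Fin n => E.fold n i = ℓ,
      ¬ E.train ℓ n i := fun n i hi h => h (Finset.mem_filter.1 hi).2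
  constructor
  · have h1 : HoldsWHP P fun n ω => |∑ i : Fin n with E.fold n i = ℓ,
        (E.scoreErr M n ℓ (subsample W (E.train ℓ n) ω) (W i ω) -
          ∫ w, E.scoreErr M n ℓ (subsample W (E.train ℓ n) ω) w ∂M.F)| ≤ u / 2 * √(n : ℝ) := by
      refine HoldsWHP.of_forall_le fun τ hτ => ?_
      -- With this second moment, Chebyshev's bound at level `u / 2` is exactly `τ`.
      obtain ⟨Good, hGm, hGw, hGb⟩ := hgood (τ * (u / 2) ^ 2) (by positivity)
      refine ⟨_, hGw, ?_⟩
      filter_upwards [hGb, eventually_gt_atTop 0] with n hn hn0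
      have := crossfit_chebyshev hW hn0 (htest n) (hmeas n) (hGm n)
        (fun t ht => (hn t ht).1) (fun t ht => (hn t ht).2.1) (half_pos hu)
      rwa [mul_div_cancel_right₀ _ (by positivity)] at this
    -- A second good event controls the bias: at most `n` observations, each with mean error at most
    -- `(u / 2) / √n`.
    obtain ⟨Good, -, hGw, hGb⟩ := hgood (u / 2) (half_pos hu)
    refine (h1.and hGw).mono ?_
    filter_upwards [hGb, eventually_gt_atTop 0] with n hn hn0 ω hω
    have hn' : (0 : ℝ) < n := by exact_mod_cast hn0
    have hb := (hn _ hω.2).2.2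
    set f := E.scoreErr M n ℓ (subsample W (E.train ℓ n) ω)
    have h2 : ∑ i : Fin n with E.fold n i = ℓ, f (W i ω) =
        ∑ i : Fin n with E.fold n i = ℓ, (f (W i ω) - ∫ w, f w ∂M.F) +
        (Finset.univ.filter fun i : Fin n => E.fold n i = ℓ).card * ∫ w, f w ∂M.F := by
      rw [← nsmul_eq_mul, ← Finset.sum_const, ← Finset.sum_add_distrib]
      exact Finset.sum_congr rfl fun i _ => by ring
    rw [h2]
    refine (abs_add_le _ _).trans ((add_le_add hω.1 (?_ : _ ≤ u / 2 * √(n : ℝ))).trans_eq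
      (by ring))
    rw [abs_mul, Nat.abs_cast]
    calc _ ≤ n * |∫ w, f w ∂M.F| :=
          mul_le_mul_of_nonneg_right (E.card_fold_le n ℓ) (abs_nonneg _)
      _ = √(n : ℝ) * |∫ w, f w ∂M.F| * √(n : ℝ) := by
          nth_rw 1 [← Real.mul_self_sqrt hn'.le]
          ring
      _ ≤ _ := mul_le_mul_of_nonneg_right hb (Real.sqrt_nonneg _)
  · refine HoldsWHP.of_forall_le fun τ hτ => ?_
    obtain ⟨Good, hGm, hGw, hGb⟩ := hgood (τ * u) (by positivity)
    refine ⟨_, hGw, ?_⟩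
    filter_upwards [hGb, eventually_gt_atTop 0] with n hn hn0
    have := crossfit_markov hW hn0 (htest n) (f := fun t w => E.scoreErr M n ℓ t w ^ 2)
      ((hmeas n).pow_const 2) (fun t w => sq_nonneg _) (hGm n) (δ := τ * u)
      (fun t ht => by
        rw [← ofReal_integral_eq_lintegral_ofReal (hn t ht).1.integrable_sq
          (ae_of_all _ fun w => sq_nonneg _)]
        exact ENNReal.ofReal_le_ofReal (hn t ht).2.1) hu
    rwa [mul_div_cancel_right₀ _ hu.ne'] at this

end Negligible

/-! ### Limit theorems -/

section Limits

variable {Ω 𝒳 𝒵 : Type*} [MeasurableSpace Ω] [MeasurableSpace 𝒳] [MeasurableSpace 𝒵]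
  {M : Model 𝒳 𝒵} {E : Procedure 𝒳 𝒵} {P : Measure Ω} {W : ℕ → Ω → Obs 𝒳 𝒵}

lemma IsIIDSample.identDistrib (hW : IsIIDSample M P W) {f : Obs 𝒳 𝒵 → ℝ} (hf : Measurable f)
    (i : ℕ) : IdentDistrib (fun ω => f (W i ω)) (fun ω => f (W 0 ω)) P P := by
  have h : IdentDistrib (W i) (W 0) P P :=
    ⟨(hW.measurable i).aemeasurable, (hW.measurable 0).aemeasurable, by rw [hW.law, hW.law]⟩
  exact h.comp hf

/-- The weak law of large numbers. -/
lemma IsIIDSample.holdsWHP_mean [IsProbabilityMeasure P] (hW : IsIIDSample M P W)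
    {f : Obs 𝒳 𝒵 → ℝ} (hf : Measurable f) (hint : Integrable f M.F) {u : ℝ} (hu : 0 < u) :
    HoldsWHP P fun n ω => |(n : ℝ)⁻¹ * ∑ i : Fin n, f (W i ω) - ∫ w, f w ∂M.F| ≤ u := by
  have hi : Integrable (fun ω => f (W 0 ω)) P :=
    memLp_one_iff_integrable.1 (hW.memLp_comp (memLp_one_iff_integrable.2 hint) 0)
  have h := strong_law_ae_real (fun i ω => f (W i ω)) hi
    (fun i j hij => (hW.indep.indepFun hij).comp hf hf) (hW.identDistrib hf)
  rw [hW.integral_comp hf.aemeasurable] at h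
  have hm : ∀ n : ℕ, AEStronglyMeasurable
      (fun ω => (∑ i ∈ Finset.range n, f (W i ω)) / (n : ℝ)) P := fun n =>
    ((Finset.measurable_sum _ fun i _ => hf.comp (hW.measurable i)).div_const _).aestronglyMeasurable
  refine (TendstoInMeasure.holdsWHP (tendstoInMeasure_of_tendsto_ae hm h) hu).mono
    (Eventually.of_forall fun n ω hω => ?_)
  rwa [div_eq_inv_mul, Finset.sum_range] at hω

lemma Model.IsNPIV.measurable_ψ₀ (hM : M.IsNPIV) (hα : M.IsRieszRepresenter) :
    Measurable M.ψ₀ :=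
  ((hM.measurable_m _ hM.γ₀_mem).sub_const _).add
    ((hα.measurable.comp measurable_snd.snd).mul hM.measurable_resid)

lemma Model.IsNPIV.memLp_ψ₀ (hM : M.IsNPIV) (hα : M.IsRieszRepresenter)
    (hprim : M.BoundedPrimitives) : MemLp M.ψ₀ 2 M.F := by
  have := hM.prob
  obtain ⟨C, hC⟩ := hprim.α₀_bdd
  exact (hprim.m_memLp.sub (memLp_const _)).add (memLp_bdd_mul hprim.resid_memLp
    (hα.measurable.comp measurable_snd.snd).aestronglyMeasurable hC)

lemma Model.IsNPIV.integral_ψ₀ (hM : M.IsNPIV) (hα : M.IsRieszRepresenter)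
    (hprim : M.BoundedPrimitives) : ∫ w, M.ψ₀ w ∂M.F = 0 := by
  have := hM.prob
  obtain ⟨C, hC⟩ := hprim.α₀_bdd
  have hi : Integrable (fun w => M.m w M.γ₀) M.F := hprim.m_memLp.integrable one_le_two
  have hi2 : Integrable (fun w => M.m w M.γ₀ - M.θ₀) M.F := hi.sub (integrable_const _)
  have hi3 : Integrable (fun w => M.α₀ w.2.2 * M.resid w) M.F :=
    (memLp_bdd_mul hprim.resid_memLp
      (hα.measurable.comp measurable_snd.snd).aestronglyMeasurable hC).integrable one_le_two
  simp only [Model.ψ₀]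
  rw [integral_add hi2 hi3, hM.integral_mul_resid hα.measurable hC,
    integral_sub hi (integrable_const _)]
  simp [Model.θ₀]

/-- The central limit theorem for the influence function. -/
lemma IsIIDSample.tendstoInDistribution_ψ₀ [IsProbabilityMeasure P] (hW : IsIIDSample M P W)
    (hM : M.IsNPIV) (hα : M.IsRieszRepresenter) (hprim : M.BoundedPrimitives) :
    TendstoInDistribution (fun (n : ℕ) ω => (√(n : ℝ))⁻¹ * ∑ i : Fin n, M.ψ₀ (W i ω)) atTop
      (id : ℝ → ℝ) (fun _ => P) (gaussianReal 0 M.V.toNNReal) := by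
  have hm := hM.measurable_ψ₀ hα
  have h0 : ∫ ω, M.ψ₀ (W 0 ω) ∂P = 0 := by
    rw [hW.integral_comp hm.aemeasurable, hM.integral_ψ₀ hα hprim]
  have hV : Var[fun ω => M.ψ₀ (W 0 ω); P] = M.V := by
    rw [variance_of_integral_eq_zero (hW.aemeasurable_comp hm.aemeasurable 0) h0, Model.V]
    exact hW.integral_comp (hm.pow_const 2).aemeasurable 0
  have h := tendstoInDistribution_inv_sqrt_mul_sum_sub (P := P)
    (P' := gaussianReal 0 M.V.toNNReal) (X := fun i ω => M.ψ₀ (W i ω)) (Y := id)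
    (by rw [hV]; exact HasLaw.id) (hW.memLp_comp (hM.memLp_ψ₀ hα hprim) 0)
    (hW.indep.comp (fun _ => M.ψ₀) fun _ => hm) (hW.identDistrib hm)
  simp only [h0, mul_zero, sub_zero, Finset.sum_range] at h
  exact h

/-- The debiased estimator in deviation from the target. -/
lemma Procedure.θhat_sub {Ω : Type*} {n : ℕ} (hn : 0 < n) (W : ℕ → Ω → Obs 𝒳 𝒵) (ω : Ω) :
    E.θhat M (sample W n ω) - M.θ₀ = (n : ℝ)⁻¹ * ∑ i : Fin n, M.ψ₀ (W i ω) +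
      (n : ℝ)⁻¹ * ∑ ℓ : Fin E.L, ∑ i : Fin n with E.fold n i = ℓ,
        E.scoreErr M n ℓ (subsample W (E.train ℓ n) ω) (W i ω) := by
  have hn' : (n : ℝ) ≠ 0 := by exact_mod_cast hn.ne'
  simp only [Procedure.θhat, E.score_eq, Finset.sum_add_distrib]
  rw [Finset.sum_fiberwise Finset.univ (E.fold n) fun i : Fin n => M.ψ₀ (sample W n ω i),
    Finset.sum_fiberwise Finset.univ (E.fold n) fun _ : Fin n => M.θ₀]
  simp only [Finset.sum_const, Finset.card_univ, Fintype.card_fin, nsmul_eq_mul, sample]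
  field_simp
  ring

lemma Procedure.measurable_θhat (hE : E.IsRegular M) (hW : IsIIDSample M P W) (n : ℕ) :
    Measurable fun ω => E.θhat M (sample W n ω) := by
  refine Measurable.const_mul (Finset.measurable_sum _ fun ℓ _ =>
    Finset.measurable_sum _ fun i _ => ?_) _
  exact (hE.measurable_score n ℓ).comp
    ((measurable_subsample hW (E.train ℓ n)).prodMk (hW.measurable i))

lemma abs_sum_fin_le {L : ℕ} {f : Fin L → ℝ} {c : ℝ} (h : ∀ ℓ, |f ℓ| ≤ c) :
    |∑ ℓ, f ℓ| ≤ L * c := by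
  refine (Finset.abs_sum_le_sum_abs _ _).trans ((Finset.sum_le_sum fun ℓ _ => h ℓ).trans_eq ?_)
  rw [Finset.sum_const, Finset.card_univ, Fintype.card_fin, nsmul_eq_mul]

/-- Asymptotic normality of the debiased estimator. -/
lemma Procedure.tendstoInDistribution_θhat [IsProbabilityMeasure P] (hM : M.IsNPIV)
    (hα : M.IsRieszRepresenter) (hprim : M.BoundedPrimitives) (hE : E.IsRegular M)
    (hW : IsIIDSample M P W)
    (herr : ∀ u : ℝ, 0 < u → ∀ ℓ, HoldsWHP P fun n ω => |∑ i : Fin n with E.fold n i = ℓ,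
      E.scoreErr M n ℓ (subsample W (E.train ℓ n) ω) (W i ω)| ≤ u * √(n : ℝ)) :
    TendstoInDistribution
      (fun (n : ℕ) ω => √(n : ℝ) * (E.θhat M (sample W n ω) - M.θ₀)) atTop
      (id : ℝ → ℝ) (fun _ => P) (gaussianReal 0 M.V.toNNReal) := by
  have hL : (0 : ℝ) < E.L := by exact_mod_cast two_pos.trans_le hE.two_le_L
  -- Slutsky: the difference from the normalized sum of `ψ₀` is `1 / √n` times `L` fold sums, each
  -- at most `(u / L) √n`.
  refine tendstoInDistribution_of_tendstoInMeasure_sub _ _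
    (hW.tendstoInDistribution_ψ₀ hM hα hprim) ?_
    fun n => (((E.measurable_θhat hE hW n).sub_const _).const_mul _).aemeasurable
  refine tendstoInMeasure_zero_of_holdsWHP fun u hu => ?_
  refine (HoldsWHP.all (herr (u / E.L) (by positivity))).mono ?_
  filter_upwards [eventually_gt_atTop 0] with n hn ω hω
  have hn' : (0 : ℝ) < n := by exact_mod_cast hn
  have hs : 0 < √(n : ℝ) := Real.sqrt_pos.2 hn'
  have h1 : √(n : ℝ) * (n : ℝ)⁻¹ = (√(n : ℝ))⁻¹ := by
    nth_rw 2 [← Real.mul_self_sqrt hn'.le]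
    field_simp
  simp only [Pi.sub_apply]
  rw [E.θhat_sub hn, mul_add, ← mul_assoc, ← mul_assoc, h1, add_sub_cancel_left, abs_mul,
    abs_of_pos (inv_pos.2 hs), inv_mul_le_iff₀ hs]
  refine (abs_sum_fin_le hω).trans_eq ?_
  field_simp

/-- Young's inequality with a free weight: a small `a` tames the part in `x²`, whose average is
merely bounded, at the expense of `e²`, whose average vanishes. -/
lemma abs_add_sq_sub_sq_le {a : ℝ} (ha : 0 < a) (x e : ℝ) :
    |(x + e) ^ 2 - x ^ 2| ≤ a * x ^ 2 + (a⁻¹ + 1) * e ^ 2 := by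
  have h : 2 * |x * e| ≤ a * x ^ 2 + a⁻¹ * e ^ 2 := by
    have h1 : a * x ^ 2 + a⁻¹ * e ^ 2 - 2 * |x * e| = a⁻¹ * (a * |x| - |e|) ^ 2 := by
      rw [abs_mul, ← sq_abs x, ← sq_abs e]
      field_simp
      ring
    have h2 : 0 ≤ a⁻¹ * (a * |x| - |e|) ^ 2 := by positivity
    linarith
  have h2 : (x + e) ^ 2 - x ^ 2 = 2 * (x * e) + e ^ 2 := by ring
  rw [h2]
  refine (abs_add_le _ _).trans ?_
  rw [abs_mul, abs_two, abs_of_nonneg (sq_nonneg e)]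
  linarith

/-- Consistency of the debiased estimator. -/
lemma Procedure.holdsWHP_θhat [IsProbabilityMeasure P] (hM : M.IsNPIV)
    (hα : M.IsRieszRepresenter) (hprim : M.BoundedPrimitives) (hE : E.IsRegular M)
    (hW : IsIIDSample M P W)
    (herr : ∀ u : ℝ, 0 < u → ∀ ℓ, HoldsWHP P fun n ω => |∑ i : Fin n with E.fold n i = ℓ,
      E.scoreErr M n ℓ (subsample W (E.train ℓ n) ω) (W i ω)| ≤ u * √(n : ℝ))
    {u : ℝ} (hu : 0 < u) :
    HoldsWHP P fun n ω => |E.θhat M (sample W n ω) - M.θ₀| ≤ u := by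
  have := hM.prob
  have hL : (0 : ℝ) < E.L := by exact_mod_cast two_pos.trans_le hE.two_le_L
  have h1 := hW.holdsWHP_mean (hM.measurable_ψ₀ hα)
    ((hM.memLp_ψ₀ hα hprim).integrable one_le_two) (half_pos hu)
  rw [hM.integral_ψ₀ hα hprim] at h1
  refine (h1.and (HoldsWHP.all (herr (u / 2 / E.L) (by positivity)))).mono ?_
  filter_upwards [eventually_gt_atTop 0] with n hn ω hω
  have hn' : (1 : ℝ) ≤ n := by exact_mod_cast hn
  rw [E.θhat_sub hn]
  refine (abs_add_le _ _).trans ((add_le_add (by simpa using hω.1) ?_).trans_eq (add_halves u))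
  rw [abs_mul, abs_of_pos (inv_pos.2 (by linarith)), inv_mul_le_iff₀ (by linarith)]
  refine (abs_sum_fin_le hω.2).trans ?_
  have h2 : √(n : ℝ) ≤ n := by
    rw [Real.sqrt_le_left (by linarith)]
    nlinarith
  calc (E.L : ℝ) * (u / 2 / E.L * √(n : ℝ)) = √(n : ℝ) * (u / 2) := by field_simp
    _ ≤ n * (u / 2) := by gcongr

/-- Consistency of the variance estimator. -/
lemma Procedure.tendstoInMeasure_Vhat [IsProbabilityMeasure P] (hM : M.IsNPIV)
    (hα : M.IsRieszRepresenter) (hprim : M.BoundedPrimitives) (hE : E.IsRegular M)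
    (hW : IsIIDSample M P W)
    (herr : ∀ u : ℝ, 0 < u → ∀ ℓ, HoldsWHP P fun n ω => |∑ i : Fin n with E.fold n i = ℓ,
      E.scoreErr M n ℓ (subsample W (E.train ℓ n) ω) (W i ω)| ≤ u * √(n : ℝ))
    (herr2 : ∀ u : ℝ, 0 < u → ∀ ℓ, HoldsWHP P fun n ω => ∑ i : Fin n with E.fold n i = ℓ,
      E.scoreErr M n ℓ (subsample W (E.train ℓ n) ω) (W i ω) ^ 2 ≤ u * n) :
    TendstoInMeasure P (fun (n : ℕ) ω => E.Vhat M (sample W n ω)) atTop (fun _ => M.V) := by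
  have hL : (0 : ℝ) < E.L := by exact_mod_cast two_pos.trans_le hE.two_le_L
  have hV : 0 ≤ M.V := integral_nonneg fun _ => sq_nonneg _
  suffices h : ∀ u > 0, HoldsWHP P fun n ω => |E.Vhat M (sample W n ω) - M.V| ≤ u by
    have h' := tendstoInMeasure_zero_of_holdsWHP h
    rw [tendstoInMeasure_iff_norm] at h' ⊢
    simpa using h'
  intro u hu
  -- The tolerance is spent in thirds: on the law of large numbers for `ψ₀²`, on `a·S` with `S ≤ V +
  -- u / 3`, and on `(a⁻¹ + 1)·4r`, where `4r` collects `2r` from the score errors and `2r` from `θ̂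
  -- - θ₀`.
  set a := u / 3 / (M.V + u / 3) with ha
  have ha0 : 0 < a := by positivity
  set r := u / 3 / (4 * (a⁻¹ + 1)) with hr
  have hr0 : 0 < r := by positivity
  refine ((hW.holdsWHP_mean ((hM.measurable_ψ₀ hα).pow_const 2)
    (hM.memLp_ψ₀ hα hprim).integrable_sq (by positivity : 0 < u / 3)).and
    ((E.holdsWHP_θhat hM hα hprim hE hW herr (Real.sqrt_pos.2 hr0)).and
    (HoldsWHP.all (herr2 (r / E.L) (by positivity))))).mono ?_
  filter_upwards [eventually_gt_atTop 0] with n hn ω hω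
  obtain ⟨h1, h2, h3⟩ := hω
  have hn' : (0 : ℝ) < n := by exact_mod_cast hn
  change |_ - M.V| ≤ _ at h1
  set S := (n : ℝ)⁻¹ * ∑ i : Fin n, M.ψ₀ (W i ω) ^ 2 with hS
  set D := E.θhat M (sample W n ω) - M.θ₀ with hD
  set e : Fin E.L → Fin n → ℝ := fun ℓ i =>
    E.scoreErr M n ℓ (subsample W (E.train ℓ n) ω) (W i ω) with he
  have hfib : ∀ f : Fin n → ℝ, ∑ ℓ : Fin E.L, ∑ i : Fin n with E.fold n i = ℓ, f i = ∑ i, f i :=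
    fun f => Finset.sum_fiberwise Finset.univ (E.fold n) f
  -- The centred estimated score is `ψ₀` perturbed by `e - D`, the score error minus the error of
  -- `θ̂`.
  have hVhat : E.Vhat M (sample W n ω) - S = (n : ℝ)⁻¹ *
      ∑ ℓ : Fin E.L, ∑ i : Fin n with E.fold n i = ℓ,
        ((M.ψ₀ (W i ω) + (e ℓ i - D)) ^ 2 - M.ψ₀ (W i ω) ^ 2) := by
    simp only [Finset.sum_sub_distrib]
    rw [hfib, mul_sub, ← hS, Procedure.Vhat]
    congr 2
    refine Finset.sum_congr rfl fun ℓ _ => Finset.sum_congr rfl fun i _ => ?_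
    rw [E.score_eq, hD, he]
    simp only [sample]
    ring
  have hD2 : D ^ 2 ≤ r := by
    have := sq_le_sq' (abs_le.1 h2).1 (abs_le.1 h2).2
    rwa [Real.sq_sqrt hr0.le] at this
  have he2 : ∑ ℓ : Fin E.L, ∑ i : Fin n with E.fold n i = ℓ, e ℓ i ^ 2 ≤ r * n := by
    refine (Finset.sum_le_sum fun ℓ _ => h3 ℓ).trans_eq ?_
    rw [Finset.sum_const, Finset.card_univ, Fintype.card_fin, nsmul_eq_mul]
    field_simp
  have hmain : |E.Vhat M (sample W n ω) - S| ≤ a * S + (a⁻¹ + 1) * (4 * r) := by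
    rw [hVhat, abs_mul, abs_of_pos (inv_pos.2 hn'), inv_mul_le_iff₀ hn']
    calc _ ≤ ∑ ℓ : Fin E.L, ∑ i : Fin n with E.fold n i = ℓ,
          (a * M.ψ₀ (W i ω) ^ 2 + (a⁻¹ + 1) * (2 * e ℓ i ^ 2 + 2 * D ^ 2)) := by
          refine (Finset.abs_sum_le_sum_abs _ _).trans (Finset.sum_le_sum fun ℓ _ =>
            (Finset.abs_sum_le_sum_abs _ _).trans (Finset.sum_le_sum fun i _ => ?_))
          refine (abs_add_sq_sub_sq_le ha0 _ _).trans (add_le_add le_rfl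
            (mul_le_mul_of_nonneg_left ?_ (by positivity)))
          nlinarith [sq_nonneg (e ℓ i + D)]
      _ = a * ∑ i : Fin n, M.ψ₀ (W i ω) ^ 2 + (a⁻¹ + 1) *
          (2 * ∑ ℓ : Fin E.L, ∑ i : Fin n with E.fold n i = ℓ, e ℓ i ^ 2 + n * (2 * D ^ 2)) := by
          simp only [Finset.sum_add_distrib, ← Finset.mul_sum]
          rw [hfib fun i => M.ψ₀ (W i ω) ^ 2, hfib fun _ => D ^ 2, Finset.sum_const,
            Finset.card_univ, Fintype.card_fin, nsmul_eq_mul]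
          ring
      _ ≤ a * (n * S) + (a⁻¹ + 1) * (2 * (r * n) + n * (2 * r)) := by
          rw [hS, mul_inv_cancel_left₀ hn'.ne']
          gcongr
      _ = _ := by ring
  have hSV : S ≤ M.V + u / 3 := by linarith [(abs_le.1 h1).2]
  have haS : a * S ≤ u / 3 := by
    calc a * S ≤ a * (M.V + u / 3) := mul_le_mul_of_nonneg_left hSV ha0.le
      _ = u / 3 := by
        have : M.V + u / 3 ≠ 0 := by positivity
        rw [ha]
        field_simp
  have har : (a⁻¹ + 1) * (4 * r) = u / 3 := by
    have : a⁻¹ + 1 ≠ 0 := by positivity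
    rw [hr]
    field_simp
  have := abs_sub_le (E.Vhat M (sample W n ω)) S M.V
  linarith

end Limits

end NPIV

end

/-! ### Asymptotic normality and variance consistency, from the coefficient rate and negligible
score errors. -/

theorem mainTheorem6 {Ω 𝒳 𝒵 : Type*} [MeasurableSpace Ω] [MeasurableSpace 𝒳]
    [MeasurableSpace 𝒵] (P : Measure Ω) [IsProbabilityMeasure P]
    (M : NPIV.Model 𝒳 𝒵) (E : NPIV.Procedure 𝒳 𝒵) (W : ℕ → Ω → NPIV.Obs 𝒳 𝒵)
    (κ : ℕ → ℝ) (s : ℕ → ℕ) (ρbar ρL ρstar : ∀ n, Fin (E.p n) → ℝ)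
    -- the model, the functional, the sample and the estimators
    (hM : M.IsNPIV) (hD : M.IsGateaux) (hα : M.IsRieszRepresenter)
    (hW : NPIV.IsIIDSample M P W) (hE : E.IsRegular M)
    (hPGMM : E.IsDiagonalPGMM M P W)
    -- assumptions
    (hdict : E.BoundedDictionaries M)
    (hsparse : E.SparseApprox M s κ ρbar)
    (htarget : E.IsPopulationTarget M κ ρbar ρL ρstar)
    (hnondeg : E.NondegenerateMoments M ρstar)
    (heig : E.EigenvalueCondition M s ρstar)
    (hprim : M.BoundedPrimitives)
    (hderiv : E.BoundedDerivative M)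
    (hrem : M.QuadraticRemainder)
    (hγ : E.StructuralRates M P W κ)
    (hms : E.MeanSquareConsistent M P W)
    -- rates
    (hκ_pos : ∀ n, 0 < κ n)
    (hκ_slow : (fun n : ℕ => √(Real.log (E.q n) / n)) =O[atTop] κ)
    (hκ_lam : κ =o[atTop] E.lam)
    (hs_lam : Tendsto (fun n => (s n : ℝ) ^ 2 * E.lam n) atTop (𝓝 0))
    (hrate : Tendsto (fun n : ℕ => √(n : ℝ) * (s n * E.lam n) * κ n) atTop (𝓝 0)) :
    MemLp M.ψ₀ 2 M.F ∧
    TendstoInDistribution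
      (fun (n : ℕ) ω => √(n : ℝ) * (E.θhat M (NPIV.sample W n ω) - M.θ₀)) atTop
      (id : ℝ → ℝ) (fun _ => P) (gaussianReal 0 M.V.toNNReal) ∧
    TendstoInMeasure P (fun (n : ℕ) ω => E.Vhat M (NPIV.sample W n ω)) atTop
      (fun _ => M.V) := by
  have hcoef := E.exists_coef_rate hM hα hW hE hPGMM hdict hsparse htarget hnondeg heig hderiv hγ
    hκ_pos hκ_slow hκ_lam hs_lam
  choose K hK using hcoef
  have hneg := fun (u : ℝ) (hu : 0 < u) ℓ =>
    E.scoreErr_negligible hM hα hW hE ℓ (fun η hη => E.exists_good hM hα hE hdict hsparse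
      hprim hrem hγ hms hκ_pos hκ_lam hs_lam hrate ℓ (hK ℓ) hη) hu
  exact ⟨hM.memLp_ψ₀ hα hprim,
    E.tendstoInDistribution_θhat hM hα hprim hE hW fun u hu ℓ => (hneg u hu ℓ).1,
    E.tendstoInMeasure_Vhat hM hα hprim hE hW (fun u hu ℓ => (hneg u hu ℓ).1)
      fun u hu ℓ => (hneg u hu ℓ).2⟩
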